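/- Con-Sum on trees is the following problem. An instance consists of a tree $G$ with vertex set $\{0,\dots,n-1\}$, $n\ge 1$, and a function $\sigma:\{1,\dots,k\}\to V(G)$, $k\ge 1$, giving the start vertices of $k$ pebbles (several pebbles may share a vertex). A feasible solution is a function $\mu:\{1,\dots,k\}\to V(G)$, not necessarily injective, such that the subgraph of $G$ induced by the set of end vertices $\{\mu(1),\dots,\mu(k)\}$ is connected. The task is to find a feasible solution that minimises the overall movement $\sum_{p=1}^{k} d_G(\sigma(p),\mu(p))$, where $d_G$ is the distance in $G$. **Theorem.** Con-Sum on trees can be solved exactly in $O(n\cdot k^2\cdot\log n)$ time. Precisely: there are one program for a unit-cost random access machine (constants, registers, indirectly addressed memory; addition, truncated subtraction, multiplication, integer division, comparisons, branches and loops), an integer $c\ge 0$ and a constant $C$ such that the following holds for all $n,k\ge 1$ and every instance as above, given to the program as $n$, $k$, a list of the edges of $G$ in any order (each edge once, with its endpoints in either order), and $\sigma(1),\dots,\sigma(k)$. The program halts after at most $C\cdot n\cdot k^2\cdot\log(\max\{n,2\})$ elementary steps, all numbers that it handles, memory addresses included, are smaller than $(n+k)^c$ (that is, it works with words of $O(\log(n+k))$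 bits), and it outputs an optimal solution $\mu$ together with its overall movement. -/

import Mathlib

/-! ### Pebble motion problems -/

namespace PebbleMotion

/-- The connectivity goal: the subgraph of `G` induced by `U` is connected. -/
def Con {V : Type*} (G : SimpleGraph V) (U : Set V) : Prop :=
  (G.induce U).Connected

/-- The overall movement: the sum of the distances travelled by the pebbles that start at `σ`
and end at `μ`, each moving along a shortest path. -/
noncomputable def sumCost {V : Type*} {k : ℕ} (G : SimpleGraph V) (σ μ : Fin k → V) : ℕ :=
  ∑ p, G.dist (σ p) (μ p)

/-- `μ` is an optimal solution for the goal `ψ` and the measure `c`: it is feasible, that is,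
the set of its end vertices satisfies `ψ`, and its measure is minimum among all feasible
solutions. -/
def IsOptimal {V : Type*} {k : ℕ} (ψ : Set V → Prop) (c : (Fin k → V) → ℕ)
    (μ : Fin k → V) : Prop :=
  ψ (Set.range μ) ∧ ∀ ν : Fin k → V, ψ (Set.range ν) → c μ ≤ c ν

end PebbleMotion

/-! ### A random access machine with bounded words and a step count -/

namespace WordRAM

/-- Binary operations of the machine. Subtraction is truncated at `0`, division rounds down
(with `x / 0 = 0`), and the comparisons return `1` (true) or `0` (false). -/
inductive BinOp
  | add
  | sub
  | mul
  | div
  | lt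
  | eq

/-- The value of a binary operation. -/
def BinOp.eval : BinOp → ℕ → ℕ → ℕ
  | .add, x, y => x + y
  | .sub, x, y => x - y
  | .mul, x, y => x * y
  | .div, x, y => x / y
  | .lt, x, y => if x < y then 1 else 0
  | .eq, x, y => if x = y then 1 else 0

/-- Expressions: constants, registers, memory cells with a computed address, and binary
operations. -/
inductive Expr
  | lit (v : ℕ)
  | reg (r : ℕ)
  | load (a : Expr)
  | bin (o : BinOp) (a b : Expr)

/-- Programs. They are finite, so a program uses finitely many registers and constants. -/
inductive Prog
  | skip
  | assign (r : ℕ) (e : Expr)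
  | store (a e : Expr)
  | seq (p q : Prog)
  | ite (e : Expr) (p q : Prog)
  | loop (e : Expr) (p : Prog)

/-- The contents of the registers and of the memory. -/
structure State where
  reg : ℕ → ℕ
  mem : ℕ → ℕ

/-- Write `v` to register `r`. -/
def State.setReg (s : State) (r v : ℕ) : State :=
  { s with reg := Function.update s.reg r v }

/-- Write `v` to the memory cell with address `a`. -/
def State.setMem (s : State) (a v : ℕ) : State :=
  { s with mem := Function.update s.mem a v }

/-- `v`, if it is one of the `W` words `0, …, W - 1`; failure (overflow) otherwise. -/
def word (W v : ℕ) : Option ℕ :=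
  if v < W then some v else none

/-- The value of an expression on a machine whose words are `0, …, W - 1`. The evaluation fails
if the value of some subexpression (an address, for instance) is not a word. -/
def Expr.eval (W : ℕ) (s : State) : Expr → Option ℕ
  | .lit v => word W v
  | .reg r => word W (s.reg r)
  | .load a => do
      let x ← a.eval W s
      word W (s.mem x)
  | .bin o a b => do
      let x ← a.eval W s
      let y ← b.eval W s
      word W (o.eval x y)

/-- The number of elementary steps in the evaluation of an expression: one for each constant,
register access, memory access and operation in it. -/
def Expr.cost : Expr → ℕ
  | .lit _ => 1
  | .reg _ => 1
  | .load a => a.cost + 1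
  | .bin _ a b => a.cost + b.cost + 1

/-- `Exec W p s t s'`: started in the state `s` on a machine whose words are `0, …, W - 1`, the
program `p` halts without overflow after exactly `t` elementary steps, in the state `s'`. Every
assignment, every store, every test of a branch or of a loop and every `skip` counts as one
step, in addition to the steps for the evaluation of its expressions. A test succeeds if its
expression has a nonzero value. -/
inductive Exec (W : ℕ) : Prog → State → ℕ → State → Prop
  | skip (s : State) : Exec W .skip s 1 s
  | assign {s : State} {r : ℕ} {e : Expr} {v : ℕ} (he : e.eval W s = some v) :
      Exec W (.assign r e) s (e.cost + 1) (s.setReg r v)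
  | store {s : State} {a e : Expr} {x v : ℕ} (ha : a.eval W s = some x)
      (he : e.eval W s = some v) :
      Exec W (.store a e) s (a.cost + e.cost + 1) (s.setMem x v)
  | seq {p q : Prog} {s s₁ s₂ : State} {t₁ t₂ : ℕ} (hp : Exec W p s t₁ s₁)
      (hq : Exec W q s₁ t₂ s₂) :
      Exec W (.seq p q) s (t₁ + t₂) s₂
  | iteTrue {e : Expr} {p q : Prog} {s s₁ : State} {v t : ℕ} (he : e.eval W s = some v)
      (hv : v ≠ 0) (hp : Exec W p s t s₁) :
      Exec W (.ite e p q) s (e.cost + 1 + t) s₁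
  | iteFalse {e : Expr} {p q : Prog} {s s₁ : State} {t : ℕ} (he : e.eval W s = some 0)
      (hq : Exec W q s t s₁) :
      Exec W (.ite e p q) s (e.cost + 1 + t) s₁
  | loopTrue {e : Expr} {p : Prog} {s s₁ s₂ : State} {v t₁ t₂ : ℕ}
      (he : e.eval W s = some v) (hv : v ≠ 0) (hp : Exec W p s t₁ s₁)
      (hl : Exec W (.loop e p) s₁ t₂ s₂) :
      Exec W (.loop e p) s (e.cost + 1 + t₁ + t₂) s₂
  | loopFalse {e : Expr} {p : Prog} {s : State} (he : e.eval W s = some 0) :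
      Exec W (.loop e p) s (e.cost + 1) s

/-- The initial state on the input `l`: it is stored in the memory cells `0, 1, 2, …`, and all
other cells and all registers contain `0`. -/
def State.init (l : List ℕ) : State where
  reg := fun _ => 0
  mem := fun i => l.getD i 0

end WordRAM

/-! ### The input of a pebble motion problem -/

namespace PebbleMotion

/-- The list `E` contains every edge of `G` exactly once, in any order and with its two
endpoints in any order, and nothing else. -/
def IsEdgeList {V : Type*} (G : SimpleGraph V) (E : List (V × V)) : Prop :=
  (E.map fun e => s(e.1, e.2)).Nodup ∧
    ∀ x : Sym2 V, x ∈ E.map (fun e => s(e.1, e.2)) ↔ x ∈ G.edgeSet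

/-- The encoding of an instance as a list of numbers: the number `n` of vertices, the number `k`
of pebbles, the endpoints of the edges, one edge after the other, and the start vertices of the
pebbles. -/
def encode {n k : ℕ} (E : List (Fin n × Fin n)) (σ : Fin k → Fin n) : List ℕ :=
  n :: k :: ((E.flatMap fun e => [(e.1 : ℕ), (e.2 : ℕ)]) ++ List.ofFn fun p => (σ p : ℕ))

end PebbleMotion

/-! ### A program logic for the machine -/

namespace WordRAM

/-! The decisive choice is to root the tree at a weighted centroid of the start vertices: a vertex r
such that every branch at r contains the starts of at most k/2 pebbles. Then some optimal solution
uses r. Indeed, if the topmost end vertex t of a connected solution is not r, push every end vertex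
one edge towards r. The end set stays connected; the at most k/2 pebbles starting below t pay at
most one extra step each, and all others save one. Repeating this reaches r (`TopClosed.shift`,
`TopClosed.table_le`). Hence one root suffices, and the running time is even O(n k²); the factor log
max{n,2}, being at least log 2, is absorbed by the constant.

Let S c be the number of pebbles starting below c, and F c the number ending there. At least |S c -
F c| pebbles cross the edge above c (`sum_absDiff_le`). Conversely, prescribed end counts are
realised at no more than the sum of these values: surpluses travel upwards from the leaves, then
deficits are filled downwards from the root (`UpPass`, `DownPass`). It remains to minimise the sum
of |S c - F c| over end counts whose support contains the root and is closed under parents. This is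
a tree knapsack: children are merged one by one into the row of their parent, and each entry
minimises over the number of pebbles given to the child, at least one being kept for the parent side
if there is any. The table is a lower bound by `sum_table_le`, `Backtrack` recovers counts that
attain it, and `Labelling.isOptimal` closes the sandwich. The lower bound needs only `labelDist` ≤
distance and the upper bound only the triangle inequality, so no formula for distances in the tree
is required.

The centroid comes from repeatedly removing a leaf of accumulated weight at most k/2 and adding its
weight to its neighbour. Two leaves cannot both be heavier than k/2, and a tree with two or more
vertices has two leaves, so the process stops only at a single vertex (`Elim.card_eq_one`). The
removal order labels the vertices so that parents have larger labels (`Elim.labelling`); every later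
sweep is therefore a plain loop over labels, without recursion. Keeping the sum of the remaining
neighbours of each vertex makes adjacency lists unnecessary, since for a leaf this sum is its
neighbour.

The machine is handled by Hoare triples with a time bound (`Run`). Loop-free code is executed
symbolically through `Prog.wp`, loops get invariants, and all stored numbers are bounded by Z =
(n+k)², far below the word bound. -/

/-- The value of an expression, overflow ignored. -/
def Expr.val (s : State) : Expr → ℕ
  | .lit v => v
  | .reg r => s.reg r
  | .load a => s.mem (a.val s)
  | .bin o a b => o.eval (a.val s) (b.val s)

/-- The evaluation of an expression does not overflow. -/
def Expr.ok (W : ℕ) (s : State) : Expr → Prop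
  | .lit v => v < W
  | .reg r => s.reg r < W
  | .load a => a.ok W s ∧ s.mem (a.val s) < W
  | .bin o a b => a.ok W s ∧ b.ok W s ∧ o.eval (a.val s) (b.val s) < W

theorem Expr.eval_of_ok {W : ℕ} {s : State} {e : Expr} (h : e.ok W s) :
    e.eval W s = some (e.val s) := by
  induction e with
  | lit v => exact if_pos h
  | reg r => exact if_pos h
  | load a ih =>
    simp only [Expr.eval, ih h.1]
    exact if_pos h.2
  | bin o a b iha ihb =>
    simp only [Expr.eval, iha h.1, ihb h.2.1]
    exact if_pos h.2.2

/-- The program halts within `T` steps in a state that satisfies `Q`. -/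
def Run (W : ℕ) (p : Prog) (s : State) (T : ℕ) (Q : State → Prop) : Prop :=
  ∃ t s', Exec W p s t s' ∧ t ≤ T ∧ Q s'

theorem Run.mono {W : ℕ} {p : Prog} {s : State} {T T' : ℕ} {Q Q' : State → Prop}
    (h : Run W p s T Q) (hT : T ≤ T') (hQ : ∀ s', Q s' → Q' s') : Run W p s T' Q' := by
  obtain ⟨t, s', h, ht, hq⟩ := h
  exact ⟨t, s', h, ht.trans hT, hQ _ hq⟩

theorem Run.seq {W : ℕ} {p q : Prog} {s : State} {T₁ T₂ : ℕ} {P Q : State → Prop}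
    (hp : Run W p s T₁ P) (hq : ∀ s', P s' → Run W q s' T₂ Q) :
    Run W (.seq p q) s (T₁ + T₂) Q := by
  obtain ⟨t₁, s₁, h₁, ht₁, hP⟩ := hp
  obtain ⟨t₂, s₂, h₂, ht₂, hQ⟩ := hq _ hP
  exact ⟨_, _, .seq h₁ h₂, add_le_add ht₁ ht₂, hQ⟩

theorem Run.assign_seq {W : ℕ} {r : ℕ} {e : Expr} {q : Prog} {s : State} {T : ℕ}
    {Q : State → Prop} (he : e.ok W s) (hq : Run W q (s.setReg r (e.val s)) T Q) :
    Run W (.seq (.assign r e) q) s (e.cost + 1 + T) Q := by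
  obtain ⟨t, s', h, ht, hQ⟩ := hq
  exact ⟨_, s', .seq (.assign (Expr.eval_of_ok he)) h, Nat.add_le_add_left ht _, hQ⟩

/-- A loop with invariant `I m`, where `m` bounds the number of iterations that are left. -/
theorem Run.loop {W : ℕ} {e : Expr} {p : Prog} {T : ℕ} {I : ℕ → State → Prop}
    {Q : State → Prop}
    (h : ∀ m s, I m s → e.ok W s ∧ (e.val s = 0 → Q s) ∧
      (e.val s ≠ 0 → ∃ m', m = m' + 1 ∧ Run W p s T (I m'))) {m : ℕ} {s : State} (hs : I m s) :
    Run W (.loop e p) s (m * (e.cost + 1 + T) + (e.cost + 1)) Q := by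
  induction m generalizing s with
  | zero =>
    obtain ⟨ho, hq, hr⟩ := h _ _ hs
    by_cases hv : e.val s = 0
    · exact ⟨_, s, .loopFalse (by rw [Expr.eval_of_ok ho, hv]), by simp, hq hv⟩
    · obtain ⟨m', hm, -⟩ := hr hv
      omega
  | succ m ih =>
    obtain ⟨ho, hq, hr⟩ := h _ _ hs
    by_cases hv : e.val s = 0
    · exact ⟨_, s, .loopFalse (by rw [Expr.eval_of_ok ho, hv]), by simp, hq hv⟩
    · obtain ⟨m', hm, t₁, s₁, h₁, ht₁, hI⟩ := hr hv
      obtain rfl : m = m' := by omega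
      obtain ⟨t₂, s₂, h₂, ht₂, hQ⟩ := ih hI
      refine ⟨_, s₂, .loopTrue (Expr.eval_of_ok ho) hv h₁ h₂, ?_, hQ⟩
      rw [add_mul]
      omega

/-- A loop in which the register `r` counts down. -/
theorem Run.countdown {W : ℕ} {r : ℕ} {p : Prog} {T : ℕ} {I : ℕ → State → Prop}
    (hr : ∀ m s, I m s → s.reg r = m ∧ m < W)
    (h : ∀ m s, I (m + 1) s → Run W p s T (I m)) {m : ℕ} {s : State} (hs : I m s) :
    Run W (.loop (.reg r) p) s (m * (2 + T) + 2) (I 0) := by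
  refine Run.loop (e := .reg r) (T := T) (I := I) (fun m s hI => ?_) hs
  obtain ⟨h₁, h₂⟩ := hr m s hI
  refine ⟨by simpa [Expr.ok, h₁] using h₂, fun h₀ => ?_, fun h₀ => ?_⟩
  · simp only [Expr.val, h₁] at h₀
    rwa [h₀] at hI
  · simp only [Expr.val, h₁] at h₀
    obtain ⟨m', rfl⟩ := Nat.exists_eq_succ_of_ne_zero h₀
    exact ⟨m', rfl, h _ _ hI⟩

/-- The weakest precondition of a program without loops. -/
def Prog.wp (W : ℕ) : Prog → State → (State → Prop) → Prop
  | .skip, s, Q => Q s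
  | .assign r e, s, Q => e.ok W s ∧ Q (s.setReg r (e.val s))
  | .store a e, s, Q => a.ok W s ∧ e.ok W s ∧ Q (s.setMem (a.val s) (e.val s))
  | .seq p q, s, Q => p.wp W s fun s' => q.wp W s' Q
  | .ite e p q, s, Q => e.ok W s ∧ (e.val s ≠ 0 → p.wp W s Q) ∧ (e.val s = 0 → q.wp W s Q)
  | .loop _ _, _, _ => False

/-- An upper bound for the running time of a program without loops. -/
def Prog.cost : Prog → ℕ
  | .skip => 1
  | .assign _ e => e.cost + 1
  | .store a e => a.cost + e.cost + 1
  | .seq p q => p.cost + q.cost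
  | .ite e p q => e.cost + 1 + (p.cost + q.cost)
  | .loop _ _ => 0

/-- The cost charged to a branch is the sum for both arms, so the time bound depends on the program
text only and can be evaluated by `decide`. -/
theorem Run.of_wp {W : ℕ} {p : Prog} {s : State} {Q : State → Prop} (h : p.wp W s Q) :
    Run W p s p.cost Q := by
  induction p generalizing s Q with
  | skip => exact ⟨_, _, .skip s, le_rfl, h⟩
  | assign r e => exact ⟨_, _, .assign (Expr.eval_of_ok h.1), le_rfl, h.2⟩
  | store a e =>
    exact ⟨_, _, .store (Expr.eval_of_ok h.1) (Expr.eval_of_ok h.2.1), le_rfl, h.2.2⟩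
  | seq p q ihp ihq => exact (ihp h).seq fun _ => ihq
  | ite e p q ihp ihq =>
    obtain ⟨ho, hp, hq⟩ := h
    by_cases hv : e.val s = 0
    · obtain ⟨t, s', h₁, ht, hQ⟩ := ihq (hq hv)
      refine ⟨_, s', .iteFalse (by rw [Expr.eval_of_ok ho, hv]) h₁, ?_, hQ⟩
      simp only [Prog.cost]
      omega
    · obtain ⟨t, s', h₁, ht, hQ⟩ := ihp (hp hv)
      refine ⟨_, s', .iteTrue (Expr.eval_of_ok ho) hv h₁, ?_, hQ⟩
      simp only [Prog.cost]
      omega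
  | loop => exact h.elim

/-! ### Sixteen interleaved arrays -/

/-- The entry `i` of the array `a`, where the arrays are interleaved from address `b` on. -/
def State.arr (s : State) (b a i : ℕ) : ℕ := s.mem (16 * i + (b + a))

/-- Write `v` to the entry `i` of the array `a`. -/
def State.setArr (s : State) (b a i v : ℕ) : State := s.setMem (16 * i + (b + a)) v

/-- The address of an array entry; the register `0` holds the address of the first array. -/
def Expr.addr (a : ℕ) (e : Expr) : Expr :=
  .bin .add (.bin .mul (.lit 16) e) (.bin .add (.reg 0) (.lit a))

/-- An array entry. -/
def Expr.get (a : ℕ) (e : Expr) : Expr := .load (.addr a e)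

/-- The assignment to an array entry. -/
def Prog.put (a : ℕ) (i e : Expr) : Prog := .store (.addr a i) e

instance : Add Expr := ⟨.bin .add⟩
instance : Sub Expr := ⟨.bin .sub⟩
instance : Mul Expr := ⟨.bin .mul⟩
instance (v : ℕ) : OfNat Expr v := ⟨.lit v⟩

section
variable {W : ℕ} {s : State} {e e₁ e₂ i : Expr} {p q : Prog} {Q : State → Prop}
  {a a' b j j' r r' v x y : ℕ}

@[simp] theorem reg_setReg : (s.setReg r v).reg r' = if r' = r then v else s.reg r' := by
  simp [State.setReg, Function.update_apply]

@[simp] theorem mem_setReg : (s.setReg r v).mem = s.mem := rfl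

@[simp] theorem reg_setMem : (s.setMem x v).reg = s.reg := rfl

theorem mem_setMem : (s.setMem x v).mem y = if y = x then v else s.mem y := by
  simp [State.setMem, Function.update_apply]

@[simp] theorem reg_setArr : (s.setArr b a j v).reg = s.reg := rfl

@[simp] theorem arr_setReg : (s.setReg r v).arr = s.arr := rfl

-- Array numbers below 16 act as residues modulo 16, so distinct pairs of array and index have
-- distinct addresses.
@[simp] theorem arr_setArr (ha : a < 16) (ha' : a' < 16) :
    (s.setArr b a j v).arr b a' j' = if a' = a ∧ j' = j then v else s.arr b a' j' := by
  rw [State.setArr, State.arr, mem_setMem]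
  congr 1
  rw [eq_iff_iff]
  omega

/-- All arrays lie at or above `b`; hence the input below `b` survives every array assignment. -/
theorem mem_setArr_of_lt (h : x < b) : (s.setArr b a j v).mem x = s.mem x := by
  rw [State.setArr, mem_setMem, if_neg (by omega)]

theorem arr_setMem_of_lt (h : x < b) : (s.setMem x v).arr b a j = s.arr b a j := by
  rw [State.arr, mem_setMem, if_neg (by omega), State.arr]

theorem mem_setArr_le {B : ℕ} (h : ∀ x, s.mem x ≤ B) (hv : v ≤ B) (x : ℕ) :
    (s.setArr b a j v).mem x ≤ B := by
  rw [State.setArr, mem_setMem]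
  split
  · exact hv
  · exact h x

-- Together with the `ok` and `wp` rules below, these rules let `simp` execute straight-line code
-- and leave arithmetic side goals for `omega`.
@[simp] theorem val_ofNat : Expr.val s (no_index (OfNat.ofNat v)) = v := rfl
@[simp] theorem val_reg : (Expr.reg r).val s = s.reg r := rfl
@[simp] theorem val_load : (Expr.load e).val s = s.mem (e.val s) := rfl
@[simp] theorem val_get : (Expr.get a e).val s = s.arr (s.reg 0) a (e.val s) := rfl
@[simp] theorem val_add : (e₁ + e₂).val s = e₁.val s + e₂.val s := rfl
@[simp] theorem val_sub : (e₁ - e₂).val s = e₁.val s - e₂.val s := rfl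
@[simp] theorem val_mul : (e₁ * e₂).val s = e₁.val s * e₂.val s := rfl
@[simp] theorem val_lt : (Expr.bin .lt e₁ e₂).val s = if e₁.val s < e₂.val s then 1 else 0 := rfl
@[simp] theorem val_eq : (Expr.bin .eq e₁ e₂).val s = if e₁.val s = e₂.val s then 1 else 0 := rfl

@[simp] theorem ok_ofNat : Expr.ok W s (no_index (OfNat.ofNat v)) ↔ v < W := .rfl
@[simp] theorem ok_reg : (Expr.reg r).ok W s ↔ s.reg r < W := .rfl
@[simp] theorem ok_load : (Expr.load e).ok W s ↔ e.ok W s ∧ s.mem (e.val s) < W := .rfl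
@[simp] theorem ok_add : (e₁ + e₂).ok W s ↔
    e₁.ok W s ∧ e₂.ok W s ∧ e₁.val s + e₂.val s < W := .rfl
@[simp] theorem ok_mul : (e₁ * e₂).ok W s ↔
    e₁.ok W s ∧ e₂.ok W s ∧ e₁.val s * e₂.val s < W := .rfl

theorem Expr.val_lt_of_ok (h : e.ok W s) : e.val s < W := by
  cases e with
  | lit v => exact h
  | reg r => exact h
  | load a => exact h.2
  | bin o a b => exact h.2.2

-- Truncated subtraction never exceeds its first argument, so it causes no overflow of its own.
@[simp] theorem ok_sub : (e₁ - e₂).ok W s ↔ e₁.ok W s ∧ e₂.ok W s :=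
  ⟨fun h => ⟨h.1, h.2.1⟩, fun h =>
    ⟨h.1, h.2, (Nat.sub_le _ _).trans_lt (Expr.val_lt_of_ok h.1)⟩⟩

@[simp] theorem ok_lt : (Expr.bin .lt e₁ e₂).ok W s ↔ e₁.ok W s ∧ e₂.ok W s ∧
    (if e₁.val s < e₂.val s then 1 else 0) < W := .rfl
@[simp] theorem ok_eq : (Expr.bin .eq e₁ e₂).ok W s ↔ e₁.ok W s ∧ e₂.ok W s ∧
    (if e₁.val s = e₂.val s then 1 else 0) < W := .rfl

theorem ok_addr : (Expr.addr a e).ok W s ↔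
    e.ok W s ∧ 16 < W ∧ 16 * e.val s + (s.reg 0 + a) < W := by
  simp only [Expr.addr, Expr.ok, Expr.val, BinOp.eval]
  constructor
  · rintro ⟨⟨h₁, h₂, h₃⟩, h₄, h₅⟩
    exact ⟨h₂, h₁, h₅⟩
  · rintro ⟨h₁, h₂, h₃⟩
    refine ⟨⟨h₂, h₁, ?_⟩, ⟨?_, ?_, ?_⟩, h₃⟩ <;> omega

@[simp] theorem ok_get : (Expr.get a e).ok W s ↔
    e.ok W s ∧ (16 < W ∧ 16 * e.val s + (s.reg 0 + a) < W) ∧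
      s.arr (s.reg 0) a (e.val s) < W := by
  rw [Expr.get, ok_load, ok_addr, and_assoc, and_assoc, and_assoc]
  rfl

@[simp] theorem wp_skip : Prog.skip.wp W s Q ↔ Q s := .rfl
@[simp] theorem wp_assign : (Prog.assign r e).wp W s Q ↔ e.ok W s ∧ Q (s.setReg r (e.val s)) := .rfl
@[simp] theorem wp_store : (Prog.store e₁ e₂).wp W s Q ↔
    e₁.ok W s ∧ e₂.ok W s ∧ Q (s.setMem (e₁.val s) (e₂.val s)) := .rfl
@[simp] theorem wp_seq : (Prog.seq p q).wp W s Q ↔ p.wp W s fun s' => q.wp W s' Q := .rfl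
@[simp] theorem wp_ite : (Prog.ite e p q).wp W s Q ↔
    e.ok W s ∧ (e.val s ≠ 0 → p.wp W s Q) ∧ (e.val s = 0 → q.wp W s Q) := .rfl

theorem wp_ite_pos (h : e.ok W s ∧ e.val s ≠ 0) (hp : p.wp W s Q) : (Prog.ite e p q).wp W s Q :=
  ⟨h.1, fun _ => hp, fun h₀ => absurd h₀ h.2⟩

theorem wp_ite_neg (h : e.ok W s ∧ e.val s = 0) (hq : q.wp W s Q) : (Prog.ite e p q).wp W s Q :=
  ⟨h.1, fun h₀ => absurd h.2 h₀, fun _ => hq⟩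

@[simp] theorem wp_put : (Prog.put a i e).wp W s Q ↔
    i.ok W s ∧ (16 < W ∧ 16 * i.val s + (s.reg 0 + a) < W) ∧ e.ok W s ∧
      Q (s.setArr (s.reg 0) a (i.val s) (e.val s)) := by
  rw [Prog.put, wp_store, ok_addr, and_assoc]
  rfl

end

end WordRAM

/-! ### Rooted trees with increasing labels -/

namespace PebbleMotion

/-- Every label below `n - 1` has a larger parent below `n`. -/
def IncPar (n : ℕ) (par : ℕ → ℕ) : Prop := ∀ i, i + 1 < n → i < par i ∧ par i < n

/-- The first ancestor of `a` that is at least `c`. -/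
def up (par : ℕ → ℕ) : ℕ → ℕ → ℕ
  | 0, a => a
  | c + 1, a => if up par c a = c then par c else up par c a

section Up
variable {n : ℕ} {par : ℕ → ℕ}

theorem up_lt (h : IncPar n par) {a c : ℕ} (ha : a < n) (hc : c < n) : up par c a < n := by
  induction c with
  | zero => exact ha
  | succ c ih =>
    have := h c hc
    have := ih (by omega)
    simp only [up]
    split <;> omega

theorem le_up (h : IncPar n par) {a c : ℕ} (hc : c < n) : c ≤ up par c a := by
  induction c with
  | zero => exact Nat.zero_le _
  | succ c ih =>
    have := h c hc
    have := ih (by omega)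
    simp only [up]
    split <;> omega

theorem up_of_le {a c : ℕ} (hc : c ≤ a) : up par c a = a := by
  induction c with
  | zero => rfl
  | succ c ih =>
    rw [up, ih (by omega), if_neg (by omega)]

/-- The equation `up par m a = m` expresses that m is an ancestor of a; from m on, the two chains of
ancestors coincide. -/
theorem up_trans {a m t : ℕ} (h : up par m a = m) (ht : m ≤ t) : up par t a = up par t m := by
  induction t, ht using Nat.le_induction with
  | base => rw [h, up_of_le le_rfl]
  | succ t _ ih => rw [up, up, ih]

theorem up_par_of_le {a c : ℕ} (h : a < par a) (hc : c ≤ a) : up par c (par a) = par a :=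
  up_of_le (by omega)

theorem up_par {a c : ℕ} (h : a < par a) (hc : a < c) : up par c (par a) = up par c a := by
  induction c, hc using Nat.le_induction with
  | base => rw [up_of_le (by omega), up, up_of_le le_rfl, if_pos rfl]
  | succ t _ ih => rw [up, up, ih]

/-- The ancestors of a are a itself and those of its parent; all arguments about `labelDist` rest on
this recursion. -/
theorem up_eq_iff {a c : ℕ} (h : a < par a) :
    up par c a = c ↔ c = a ∨ up par c (par a) = c := by
  rcases lt_trichotomy c a with hc | rfl | hc
  · rw [up_of_le hc.le, up_par_of_le h hc.le]
    omega
  · simp [up_of_le]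
  · rw [up_par h hc]
    constructor
    · exact Or.inr
    · rintro (rfl | h)
      · omega
      · exact h

theorem up_par_ne {a : ℕ} (h : a < par a) : up par a (par a) ≠ a := by
  rw [up_par_of_le h le_rfl]
  omega

end Up

/-! ### Distance as the number of separating edges -/

/-- The number of labels that are ancestors of exactly one of `a` and `b`, the distance of `a` and
`b` in the tree. -/
def labelDist (n : ℕ) (par : ℕ → ℕ) (a b : ℕ) : ℕ :=
  ∑ c ∈ Finset.range (n - 1), if (up par c a = c ↔ up par c b = c) then 0 else 1

section LabelDist
variable {n : ℕ} {par : ℕ → ℕ}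

theorem labelDist_self (a : ℕ) : labelDist n par a a = 0 := by simp [labelDist]

theorem labelDist_comm (a b : ℕ) : labelDist n par a b = labelDist n par b a := by
  simp only [labelDist]
  refine Finset.sum_congr rfl fun c _ => ?_
  simp only [iff_comm]

theorem labelDist_triangle (a b c : ℕ) :
    labelDist n par a c ≤ labelDist n par a b + labelDist n par b c := by
  simp only [labelDist, ← Finset.sum_add_distrib]
  refine Finset.sum_le_sum fun i _ => ?_
  split_ifs <;> omega

/-- Only the label a itself can separate a from its parent. -/
theorem labelDist_par_le (h : IncPar n par) {a : ℕ} (ha : a + 1 < n) :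
    labelDist n par a (par a) ≤ 1 := by
  have hp := (h a ha).1
  calc labelDist n par a (par a)
      ≤ ∑ c ∈ Finset.range (n - 1), if c = a then 1 else 0 := by
        refine Finset.sum_le_sum fun c _ => ?_
        have := up_eq_iff (c := c) hp
        split_ifs <;> omega
    _ ≤ 1 := by
        rw [Finset.sum_ite_eq']
        split <;> omega

/-- Moving an end label to its parent saves a step unless the start is below that label. -/
theorem labelDist_par_add_one (h : IncPar n par) {a m : ℕ} (hm : m + 1 < n)
    (ha : up par m a ≠ m) : labelDist n par a (par m) + 1 = labelDist n par a m := by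
  have hp := (h m hm).1
  have key : ∀ c, (if (up par c a = c ↔ up par c (par m) = c) then 0 else 1)
      + (if c = m then 1 else 0) = if (up par c a = c ↔ up par c m = c) then 0 else 1 := by
    intro c
    have h₁ := up_eq_iff (c := c) hp
    have h₂ := up_par_ne hp
    by_cases hc : c = m
    · subst hc
      simp [ha, h₂, h₁]
    · have : up par c m = c ↔ up par c (par m) = c := by tauto
      simp [hc, this]
  simp only [labelDist, ← key, Finset.sum_add_distrib]
  simp only [Finset.sum_ite_eq', Finset.mem_range]
  rw [if_pos (by omega)]

end LabelDist

/-! ### Subtree weights and the movement across edges -/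

/-- The number of pebbles at `i`. -/
def count {k : ℕ} (a : Fin k → ℕ) (i : ℕ) : ℕ := ∑ p, if a p = i then 1 else 0

/-- The weights after the labels below `c` have passed their weights to their parents. -/
def acc (par s : ℕ → ℕ) : ℕ → ℕ → ℕ
  | 0 => s
  | c + 1 => Function.update (acc par s c) (par c) (acc par s c (par c) + acc par s c c)

/-- The sum of `h` over the children of `i` below `c`. -/
def childSum (par h : ℕ → ℕ) (c i : ℕ) : ℕ := ∑ l ∈ Finset.range c, if par l = i then h l else 0

section Acc
variable {n k : ℕ} {par : ℕ → ℕ}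

/-- Passing weights upwards amounts to lifting each pebble to its first ancestor that is at least c.
For i = c this shows that `acc par (count a) c c` is the number of pebbles below c. -/
theorem acc_count (h : IncPar n par) {a : Fin k → ℕ} {c i : ℕ} (hc : c < n) (hi : c ≤ i) :
    acc par (count a) c i = ∑ p, if up par c (a p) = i then 1 else 0 := by
  induction c generalizing i with
  | zero => rfl
  | succ c ih =>
    have hp := h c hc
    simp only [acc, up, Function.update_apply]
    rw [ih (i := par c) (by omega) (by omega), ih (i := c) (by omega) le_rfl,
      ih (i := i) (by omega) (by omega)]
    split_ifs with hi'
    · rw [← Finset.sum_add_distrib]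
      refine Finset.sum_congr rfl fun p _ => ?_
      split_ifs <;> omega
    · refine Finset.sum_congr rfl fun p _ => ?_
      split_ifs <;> omega

theorem acc_eq_childSum (s : ℕ → ℕ) (c i : ℕ) :
    acc par s c i = s i + childSum par (fun l => acc par s l l) c i := by
  induction c with
  | zero => simp [acc, childSum]
  | succ c ih =>
    rw [childSum, Finset.sum_range_succ, ← childSum, ← add_assoc, ← ih, acc,
      Function.update_apply]
    by_cases hi : i = par c
    · rw [if_pos hi, if_pos hi.symm, hi]
    · rw [if_neg hi, if_neg (Ne.symm hi), add_zero]

theorem acc_congr {s s' : ℕ → ℕ} (h : IncPar n par) (hs : ∀ i < n, s i = s' i) {c i : ℕ}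
    (hc : c < n) (hi : i < n) : acc par s c i = acc par s' c i := by
  induction c generalizing i with
  | zero => exact hs i hi
  | succ c ih =>
    have hp := h c hc
    rw [acc, acc, Function.update_apply, Function.update_apply, ih (by omega) hi,
      ih (by omega) hp.2, ih (by omega) (by omega)]

/-- Children have smaller labels than their parent, so a sum up to c ≥ i already covers all children
of i. -/
theorem childSum_eq (h : IncPar n par) (f : ℕ → ℕ) {c i : ℕ} (hi : i ≤ c) (hc : c < n) :
    childSum par f c i = childSum par f (n - 1) i := by
  refine Finset.sum_subset (Finset.range_mono (by omega)) fun l hl hl' => if_neg ?_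
  simp only [Finset.mem_range] at hl hl'
  have := h l (by omega)
  omega

theorem acc_balance (h : IncPar n par) (s : ℕ → ℕ) {i : ℕ} (hi : i < n) :
    acc par s i i = s i + childSum par (fun l => acc par s l l) (n - 1) i := by
  rw [acc_eq_childSum, childSum_eq h _ le_rfl hi]

theorem acc_count_root (h : IncPar n par) {a : Fin k → ℕ} (hn : 0 < n) (ha : ∀ p, a p < n) :
    acc par (count a) (n - 1) (n - 1) = k := by
  rw [acc_count h (by omega) le_rfl]
  calc _ = ∑ _p : Fin k, 1 := Finset.sum_congr rfl fun p _ => by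
        have := up_lt h (ha p) (c := n - 1) (by omega)
        have := le_up h (a := a p) (c := n - 1) (by omega)
        rw [if_pos (by omega)]
    _ = k := by simp

end Acc

/-- The absolute value of the difference. -/
def absDiff (x y : ℕ) : ℕ := (x - y) + (y - x)

theorem absDiff_sum_le {ι : Type*} (t : Finset ι) (P Q : ι → Prop) [DecidablePred P]
    [DecidablePred Q] :
    absDiff (∑ p ∈ t, if P p then 1 else 0) (∑ p ∈ t, if Q p then 1 else 0) ≤
      ∑ p ∈ t, if (P p ↔ Q p) then 0 else 1 := by
  have h₁ : (∑ p ∈ t, if P p then 1 else 0) ≤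
      (∑ p ∈ t, if Q p then 1 else 0) + ∑ p ∈ t, if (P p ↔ Q p) then 0 else 1 := by
    rw [← Finset.sum_add_distrib]
    refine Finset.sum_le_sum fun p _ => ?_
    split_ifs <;> first | omega | (exfalso; tauto)
  have h₂ : (∑ p ∈ t, if Q p then 1 else 0) ≤
      (∑ p ∈ t, if P p then 1 else 0) + ∑ p ∈ t, if (P p ↔ Q p) then 0 else 1 := by
    rw [← Finset.sum_add_distrib]
    refine Finset.sum_le_sum fun p _ => ?_
    split_ifs <;> first | omega | (exfalso; tauto)
  rw [absDiff]
  omega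

/-- The movement across the edges is at most the sum of the distances. -/
theorem sum_absDiff_le {n k : ℕ} {par : ℕ → ℕ} (h : IncPar n par) (a m : Fin k → ℕ) :
    ∑ c ∈ Finset.range (n - 1), absDiff (acc par (count a) c c) (acc par (count m) c c) ≤
      ∑ p, labelDist n par (a p) (m p) := by
  simp only [labelDist]
  rw [Finset.sum_comm]
  refine Finset.sum_le_sum fun c hc => ?_
  rw [Finset.mem_range] at hc
  rw [acc_count h (by omega) le_rfl, acc_count h (by omega) le_rfl]
  exact absDiff_sum_le _ _ _

/-! ### The dynamic program -/

/-- The first place among `0, …, m` where `f` is smallest. -/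
def argmin (f : ℕ → ℕ) : ℕ → ℕ
  | 0 => 0
  | m + 1 => if f (m + 1) < f (argmin f m) then m + 1 else argmin f m

theorem argmin_le (f : ℕ → ℕ) (m : ℕ) : argmin f m ≤ m := by
  induction m with
  | zero => exact le_rfl
  | succ m ih =>
    rw [argmin]
    split <;> omega

theorem apply_argmin_le (f : ℕ → ℕ) {m x : ℕ} (hx : x ≤ m) : f (argmin f m) ≤ f x := by
  induction m with
  | zero => rw [argmin, Nat.le_zero.1 hx]
  | succ m ih =>
    rw [argmin]
    rcases Nat.lt_or_eq_of_le hx with h | rfl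
    · have := ih (by omega)
      split <;> omega
    · split <;> omega

/-- The cost of placing `x` of `j` pebbles below `c` and the others below the parent of `c`. -/
def candidate (par S : ℕ → ℕ) (T : ℕ → ℕ → ℕ) (c j x : ℕ) : ℕ :=
  T (par c) (j - x) + (T c x + absDiff (S c) x)

/-- `table par S c i j` is the least movement below `i`, if `j` pebbles end there, one of them at
`i` unless `j = 0`, and only the descendants through children below `c` are considered. -/
def table (par S : ℕ → ℕ) : ℕ → ℕ → ℕ → ℕ
  | 0 => fun _ _ => 0
  | c + 1 => Function.update (table par S c) (par c) fun j =>
      candidate par S (table par S c) c j (argmin (candidate par S (table par S c) c j) (j - 1))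

/-- The number of pebbles below `c`, if `j` pebbles end below the parent of `c`. -/
def choice (par S : ℕ → ℕ) (c j : ℕ) : ℕ :=
  argmin (candidate par S (table par S c) c j) (j - 1)

/-- Changing one summand, stated additively to avoid truncated subtraction. -/
theorem sum_update_add {t : Finset ℕ} {h h' : ℕ → ℕ} {p : ℕ} (hp : p ∈ t)
    (hh : ∀ i ∈ t, i ≠ p → h' i = h i) :
    ∑ i ∈ t, h' i + h p = ∑ i ∈ t, h i + h' p := by
  rw [← Finset.add_sum_erase t h hp, ← Finset.add_sum_erase t h' hp,
    Finset.sum_congr (g := h) rfl fun i hi =>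
      hh i (Finset.mem_of_mem_erase hi) (Finset.ne_of_mem_erase hi)]
  ring

section Table
variable {n k : ℕ} {par S : ℕ → ℕ}

theorem table_succ_of_ne {c i : ℕ} (hi : i ≠ par c) :
    table par S (c + 1) i = table par S c i := Function.update_of_ne hi _ _

theorem table_succ_par (c j : ℕ) : table par S (c + 1) (par c) j =
    candidate par S (table par S c) c j (choice par S c j) := by
  rw [table, Function.update_self, choice]

/-- Merging c into its parent affects only the summands of these two labels. The identity is used in
both directions: upwards for the lower bound, downwards in the backtracking. -/
theorem sum_table_step (h : IncPar n par) {c : ℕ} (hc : c + 1 < n) {g g' : ℕ → ℕ}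
    (hg : ∀ i, i ≠ c → i ≠ par c → g' i = g i) :
    ∑ i ∈ Finset.Ico (c + 1) n, table par S (c + 1) i (g' i) +
        (table par S c (par c) (g (par c)) + table par S c c (g c)) =
      ∑ i ∈ Finset.Ico c n, table par S c i (g i) +
        table par S (c + 1) (par c) (g' (par c)) := by
  have hp := h c hc
  have := sum_update_add (t := Finset.Ico (c + 1) n) (p := par c)
    (h := fun i => table par S c i (g i)) (h' := fun i => table par S (c + 1) i (g' i))
    (by simp only [Finset.mem_Ico]; omega) (fun i hi hip => by
      simp only [Finset.mem_Ico] at hi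
      simp only [table_succ_of_ne hip, hg i (by omega) hip])
  rw [Finset.sum_eq_sum_Ico_succ_bot (by omega : c < n)]
  omega

/-- The sum of the current row entries is a potential that grows at step c by at most |S c - F c|.
The second part, that weight accumulates only at labels in the support of f, is carried along
because it makes the split prescribed by f admissible for the minimum. -/
theorem sum_table_le (h : IncPar n par) {f : ℕ → ℕ}
    (hf : ∀ i, i + 1 < n → 0 < f i → 0 < f (par i)) {c : ℕ} (hc : c < n) :
    ∑ i ∈ Finset.Ico c n, table par S c i (acc par f c i) ≤
        ∑ i ∈ Finset.range c, absDiff (S i) (acc par f i i) ∧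
      ∀ i, c ≤ i → i < n → 0 < acc par f c i → 0 < f i := by
  induction c with
  | zero =>
    refine ⟨?_, fun i _ _ hi => hi⟩
    simp [table]
  | succ c ih =>
    obtain ⟨ih₁, ih₂⟩ := ih (by omega)
    have hp := h c hc
    refine ⟨?_, fun i hi hin h₀ => ?_⟩
    · have step := sum_table_step (S := S) h hc (g := acc par f c) (g' := acc par f (c + 1))
        (fun i _ hi => Function.update_of_ne hi _ _)
      have hle : table par S (c + 1) (par c) (acc par f (c + 1) (par c)) ≤
          table par S c (par c) (acc par f c (par c)) +
            (table par S c c (acc par f c c) + absDiff (S c) (acc par f c c)) := by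
        rw [table_succ_par, acc, Function.update_self]
        -- If pebbles end below c, then f is positive at c and hence at its parent, so at least one
        -- pebble stays on the parent side.
        have hx : acc par f c c ≤ acc par f c (par c) + acc par f c c - 1 := by
          rcases Nat.eq_zero_or_pos (acc par f c c) with h₀ | h₀
          · omega
          · have h₁ := hf c hc (ih₂ c le_rfl (by omega) h₀)
            have h₂ : f (par c) ≤ acc par f c (par c) := by
              rw [acc_eq_childSum]
              omega
            omega
        refine (apply_argmin_le _ hx).trans ?_
        rw [candidate, Nat.add_sub_cancel]
      rw [Finset.sum_range_succ]
      omega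
    · rw [acc, Function.update_apply] at h₀
      split_ifs at h₀ with hi'
      · rcases Nat.eq_zero_or_pos (acc par f c c) with h₁ | h₁
        · exact hi' ▸ ih₂ (par c) (by omega) (by omega) (by omega)
        · exact hi' ▸ hf c hc (ih₂ c le_rfl (by omega) h₁)
      · exact ih₂ i (by omega) hin h₀

/-- The last entry of the table is a lower bound for the movement of every solution that uses the
root. -/
theorem table_le (h : IncPar n par) (hn : 0 < n) {a m : Fin k → ℕ} (hm : ∀ p, m p < n)
    (hf : ∀ i, i + 1 < n → 0 < count m i → 0 < count m (par i)) :
    table par (fun c => acc par (count a) c c) (n - 1) (n - 1) k ≤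
      ∑ p, labelDist n par (a p) (m p) := by
  have := (sum_table_le (S := fun c => acc par (count a) c c) h hf (c := n - 1) (by omega)).1
  have hs : Finset.Ico (n - 1) n = {n - 1} := by
    ext
    simp only [Finset.mem_Ico, Finset.mem_singleton]
    omega
  rw [hs, Finset.sum_singleton, acc_count_root h hn hm] at this
  exact this.trans (sum_absDiff_le h a m)

/-- Needed to exclude overflow. Bounding rows separately would allow doubling at each merge; instead
the row bounds w are merged like the rows themselves, and their total grows by at most B per step.
-/
theorem table_bound (h : IncPar n par) {B : ℕ} (hS : ∀ c, c + 1 < n → S c ≤ B) {c : ℕ}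
    (hc : c < n) : ∀ i j, c ≤ i → i < n → table par S c i j ≤ c * B := by
  suffices ∃ w : ℕ → ℕ, (∀ i j, table par S c i j ≤ w i) ∧
      ∑ i ∈ Finset.Ico c n, w i ≤ c * B by
    obtain ⟨w, hw, hs⟩ := this
    intro i j hi hin
    exact (hw i j).trans (le_trans (Finset.single_le_sum (f := w) (fun _ _ => Nat.zero_le _)
      (Finset.mem_Ico.2 ⟨hi, hin⟩)) hs)
  induction c with
  | zero => exact ⟨fun _ => 0, fun _ _ => le_rfl, by simp⟩
  | succ c ih =>
    obtain ⟨w, hw, hs⟩ := ih (by omega)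
    have hp := h c hc
    refine ⟨Function.update w (par c) (w (par c) + w c + B), fun i j => ?_, ?_⟩
    · rw [Function.update_apply]
      split_ifs with hi
      · rw [hi, table_succ_par]
        -- Compare with the candidate that sends no pebble below c; it costs S c at the edge.
        refine (apply_argmin_le _ (Nat.zero_le _)).trans ?_
        have h₁ := hw (par c) (j - 0)
        have h₂ := hw c 0
        have h₃ := hS c hc
        rw [candidate, absDiff]
        omega
      · rw [table_succ_of_ne hi]
        exact hw i j
    · have := sum_update_add (t := Finset.Ico (c + 1) n) (p := par c)
        (h := w) (h' := Function.update w (par c) (w (par c) + w c + B))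
        (by simp only [Finset.mem_Ico]; omega)
        (fun i hi hip => Function.update_of_ne hip _ _)
      rw [Function.update_self] at this
      rw [Finset.sum_eq_sum_Ico_succ_bot (by omega : c < n)] at hs
      rw [add_mul, one_mul]
      omega

/-- The state of the backtracking after the labels from `c` on have been treated: `F l` pebbles
end below `l`, and `g l` of them do not end below the children of `l` treated so far. -/
structure Backtrack (n k : ℕ) (par S : ℕ → ℕ) (c : ℕ) (g F : ℕ → ℕ) : Prop where
  cost : table par S (n - 1) (n - 1) k = ∑ i ∈ Finset.Ico c n, table par S c i (g i) +
    ∑ i ∈ Finset.Ico c (n - 1), absDiff (S i) (F i)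
  root : 0 < g (n - 1)
  closed : ∀ i, c ≤ i → i + 1 < n → 0 < g i → 0 < g (par i)
  root_eq : F (n - 1) = k
  balance : ∀ i, c ≤ i → i < n →
    g i + ∑ l ∈ Finset.Ico c (n - 1), (if par l = i then F l else 0) = F i
  le : ∀ i, i < n → g i ≤ k

theorem Backtrack.init (hn : 0 < n) (hk : 0 < k) {g F : ℕ → ℕ}
    (hg : g = fun i => if i = n - 1 then k else 0) (hF : F (n - 1) = k) :
    Backtrack n k par S (n - 1) g F := by
  subst hg
  have hs : Finset.Ico (n - 1) n = {n - 1} := by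
    ext
    simp only [Finset.mem_Ico, Finset.mem_singleton]
    omega
  refine ⟨by simp [hs], by simpa using hk, fun i _ _ => by omega, hF, fun i hi hin => ?_,
    fun i _ => ?_⟩
  · obtain rfl : i = n - 1 := by omega
    simp [hF]
  · split <;> omega

/-- Undoing the merge of c splits g (par c) as the stored minimiser prescribes. The minimiser is at
most g (par c) - 1, so an occupied parent stays occupied, and this keeps the support closed under
parents. -/
theorem Backtrack.step (h : IncPar n par) {c : ℕ} (hc : c + 1 < n) {g F g' F' : ℕ → ℕ}
    (H : Backtrack n k par S (c + 1) g F)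
    (hgc : g' c = choice par S c (g (par c)))
    (hgp : g' (par c) = g (par c) - choice par S c (g (par c)))
    (hg : ∀ i, i ≠ c → i ≠ par c → g' i = g i)
    (hFc : F' c = choice par S c (g (par c))) (hF : ∀ i, i ≠ c → F' i = F i) :
    Backtrack n k par S c g' F' := by
  have hp := h c hc
  have hx : choice par S c (g (par c)) ≤ g (par c) - 1 := argmin_le _ _
  set x := choice par S c (g (par c)) with hxd
  have hsum : ∀ i, ∑ l ∈ Finset.Ico c (n - 1), (if par l = i then F' l else 0) =
      (if par c = i then x else 0) +
        ∑ l ∈ Finset.Ico (c + 1) (n - 1), (if par l = i then F l else 0) := by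
    intro i
    rw [Finset.sum_eq_sum_Ico_succ_bot (by omega : c < n - 1), hFc]
    congr 1
    refine Finset.sum_congr rfl fun l hl => ?_
    rw [Finset.mem_Ico] at hl
    rw [hF l (by omega)]
  have hmono : ∀ i, c + 1 ≤ i → (0 < g i ↔ 0 < g' i) := by
    intro i hi
    by_cases hip : i = par c
    · subst hip
      omega
    · rw [hg i (by omega) hip]
  refine ⟨?_, ?_, fun i hi hin h₀ => ?_, ?_, fun i hi hin => ?_, fun i hin => ?_⟩
  · have step := sum_table_step (S := S) h hc (g := g') (g' := g)
      (fun i h₁ h₂ => (hg i h₁ h₂).symm)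
    rw [table_succ_par, ← hxd, candidate, hgc, hgp] at step
    rw [H.cost, Finset.sum_eq_sum_Ico_succ_bot (by omega : c < n - 1), hFc]
    have hs : ∑ i ∈ Finset.Ico (c + 1) (n - 1), absDiff (S i) (F' i) =
        ∑ i ∈ Finset.Ico (c + 1) (n - 1), absDiff (S i) (F i) :=
      Finset.sum_congr rfl fun l hl => by
        rw [Finset.mem_Ico] at hl
        rw [hF l (by omega)]
    omega
  · exact (hmono _ (by omega)).1 H.root
  · rcases eq_or_lt_of_le hi with rfl | hi
    · omega
    · have := h i hin
      exact (hmono _ (by omega)).1 (H.closed i hi hin ((hmono i hi).2 h₀))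
  · rw [hF _ (by omega), H.root_eq]
  · rw [hsum]
    rcases eq_or_lt_of_le hi with rfl | hi
    · rw [if_neg (by omega), Finset.sum_eq_zero, hgc, hFc]
      · omega
      · intro l hl
        rw [Finset.mem_Ico] at hl
        have := h l (by omega)
        rw [if_neg (by omega)]
    · have hb := H.balance i hi hin
      by_cases hip : i = par c
      · subst hip
        rw [if_pos rfl, hF _ (by omega)]
        omega
      · rw [if_neg (Ne.symm hip), hF _ (by omega), hg i (by omega) hip]
        omega
  · have hb := H.le
    by_cases hic : i = c
    · have := hb _ hp.2
      subst hic
      omega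
    · by_cases hip : i = par c
      · subst hip
        have := hb _ hp.2
        omega
      · rw [hg i hic hip]
        exact hb i hin

end Table

/-! ### Moving the pebbles -/

/-- Exactly `x` pebbles move, all of them from `src` to `dst`. -/
def Moves {k : ℕ} (src dst x : ℕ) (a a' : Fin k → ℕ) : Prop :=
  (∀ p, a' p = a p ∨ (a p = src ∧ a' p = dst)) ∧ (∑ p, if a' p ≠ a p then 1 else 0) = x

section Moves
variable {n k src dst x : ℕ} {a a' : Fin k → ℕ} {par : ℕ → ℕ}

/-- Pebbles leaving and arriving are put on opposite sides so that no subtraction occurs. -/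
theorem Moves.count (h : Moves src dst x a a') (i : ℕ) :
    count a' i + (if i = src then x else 0) = count a i + (if i = dst then x else 0) := by
  have hx : ∀ j, (if i = j then x else 0) = ∑ p, if i = j ∧ a' p ≠ a p then 1 else 0 := by
    intro j
    split_ifs with hij
    · simp only [hij, true_and, h.2]
    · simp [hij]
  rw [hx, hx, PebbleMotion.count, PebbleMotion.count, ← Finset.sum_add_distrib,
    ← Finset.sum_add_distrib]
  refine Finset.sum_congr rfl fun p _ => ?_
  rcases h.1 p with h | ⟨h₁, h₂⟩
  · simp [h]
  · simp only [h₁, h₂]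
    split_ifs <;> omega

theorem Moves.lt (h : Moves src dst x a a') (ha : ∀ p, a p < n) (hd : dst < n) (p : Fin k) :
    a' p < n := by
  rcases h.1 p with h | ⟨-, h⟩ <;> rw [h]
  · exact ha p
  · exact hd

theorem Moves.cost (h : Moves src dst x a a') {δ : Fin k → ℕ → ℕ}
    (hδ : ∀ p, δ p dst ≤ δ p src + 1) : ∑ p, δ p (a' p) ≤ ∑ p, δ p (a p) + x := by
  rw [← h.2, ← Finset.sum_add_distrib]
  refine Finset.sum_le_sum fun p _ => ?_
  by_cases hp : a' p = a p
  · simp [hp]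
  · rcases h.1 p with h | ⟨h₁, h₂⟩
    · exact absurd h hp
    · rw [if_pos hp, h₁, h₂]
      exact hδ p

/-- The sum of `h` over the children of `i` from `c` on. -/
def childSumFrom (n : ℕ) (par h : ℕ → ℕ) (c i : ℕ) : ℕ :=
  ∑ l ∈ Finset.Ico c (n - 1), if par l = i then h l else 0

theorem childSumFrom_zero (h : ℕ → ℕ) (i : ℕ) :
    childSumFrom n par h 0 i = childSum par h (n - 1) i := by
  rw [childSumFrom, childSum, Finset.range_eq_Ico]

theorem childSumFrom_eq {c : ℕ} (hc : c + 1 < n) (h : ℕ → ℕ) (i : ℕ) :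
    childSumFrom n par h c i = (if par c = i then h c else 0) + childSumFrom n par h (c + 1) i := by
  rw [childSumFrom, Finset.sum_eq_sum_Ico_succ_bot (by omega : c < n - 1), childSumFrom]

theorem childSumFrom_anti {c d : ℕ} (hc : c ≤ d) (h : ℕ → ℕ) (i : ℕ) :
    childSumFrom n par h d i ≤ childSumFrom n par h c i :=
  Finset.sum_le_sum_of_subset (Finset.Ico_subset_Ico_left hc)

theorem childSum_add (h h' : ℕ → ℕ) (c i : ℕ) :
    childSum par h c i + childSum par h' c i = childSum par (fun l => h l + h' l) c i := by
  rw [childSum, childSum, childSum, ← Finset.sum_add_distrib]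
  refine Finset.sum_congr rfl fun l _ => ?_
  split <;> rfl

theorem childSum_mono {h h' : ℕ → ℕ} (hh : ∀ l, h l ≤ h' l) (c i : ℕ) :
    childSum par h c i ≤ childSum par h' c i := by
  refine Finset.sum_le_sum fun l _ => ?_
  split
  · exact hh l
  · exact le_rfl

/-- The pebbles `a` after the labels below `c` have passed their surplus to their parents. -/
structure UpPass (n : ℕ) (par s S F : ℕ → ℕ) (δ : Fin k → ℕ → ℕ) (c : ℕ)
    (a : Fin k → ℕ) : Prop where
  lt : ∀ p, a p < n
  count : ∀ i, i < n → count a i + (if i < c then S i - F i else 0) =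
    s i + childSum par (fun l => S l - F l) c i
  cost : ∑ p, δ p (a p) ≤ ∑ l ∈ Finset.range c, (S l - F l)

/-- The pebbles `a` after the labels from `c` on have received their deficit from their parents. -/
structure DownPass (n : ℕ) (par s S F : ℕ → ℕ) (δ : Fin k → ℕ → ℕ) (c : ℕ)
    (a : Fin k → ℕ) : Prop where
  lt : ∀ p, a p < n
  count : ∀ i, i < n → count a i + (S i - F i) + childSumFrom n par (fun l => F l - S l) c i =
    s i + childSum par (fun l => S l - F l) (n - 1) i + (if c ≤ i then F i - S i else 0)
  cost : ∑ p, δ p (a p) ≤ ∑ l ∈ Finset.range (n - 1), (S l - F l) +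
    ∑ l ∈ Finset.Ico c (n - 1), (F l - S l)

variable {s S F f : ℕ → ℕ} {δ : Fin k → ℕ → ℕ} {c : ℕ}

theorem UpPass.init (ha : ∀ p, a p < n) (hs : s = PebbleMotion.count a)
    (hδ : ∀ p, δ p (a p) = 0) : UpPass n par s S F δ 0 a :=
  ⟨ha, fun i _ => by simp [hs, childSum], by simp [hδ]⟩

/-- The surplus is available: the children have already sent theirs, and S ≤ (S - F) + F summed over
the children bounds S c by the pebbles now at c plus F c. -/
theorem UpPass.le_count (h : IncPar n par) (H : UpPass n par s S F δ c a) (hc : c < n)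
    (hS : ∀ i, i < n → S i = s i + childSum par S (n - 1) i)
    (hF : ∀ i, i < n → F i = f i + childSum par F (n - 1) i) :
    S c - F c ≤ PebbleMotion.count a c := by
  have h₁ := H.count c hc
  have h₂ := childSum_add (par := par) (fun l => S l - F l) F (n - 1) c
  have h₃ : childSum par S (n - 1) c ≤ childSum par (fun l => (S l - F l) + F l) (n - 1) c :=
    childSum_mono (fun l => by omega) _ _
  rw [childSum_eq h _ le_rfl hc] at h₁
  have h₄ := hS c hc
  have h₅ := hF c hc
  simp only [lt_irrefl, if_false] at h₁
  omega

theorem UpPass.step (h : IncPar n par) (hc : c + 1 < n) (H : UpPass n par s S F δ c a)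
    (hδ : ∀ p, δ p (par c) ≤ δ p c + 1) (hm : Moves c (par c) (S c - F c) a a') :
    UpPass n par s S F δ (c + 1) a' := by
  have hp := h c hc
  refine ⟨hm.lt H.lt hp.2, fun i hi => ?_, ?_⟩
  · have h₁ := H.count i hi
    have h₂ := hm.count i
    rw [childSum, Finset.sum_range_succ, ← childSum]
    by_cases hic : i = c
    · subst hic
      simp only [lt_irrefl, if_false, if_true, Nat.lt_succ_self] at *
      rw [if_neg (by omega)] at h₂
      rw [if_neg (by omega)]
      omega
    · simp only [eq_comm (a := par c), if_neg hic] at *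
      have : i < c + 1 ↔ i < c := by omega
      simp only [this]
      omega
  · have := hm.cost hδ
    have := H.cost
    rw [Finset.sum_range_succ]
    omega

/-- The root has neither surplus nor deficit, so the end of the upward pass is the start of the
downward one. -/
theorem UpPass.down (H : UpPass n par s S F δ (n - 1) a) (hr : S (n - 1) = F (n - 1)) :
    DownPass n par s S F δ (n - 1) a := by
  refine ⟨H.lt, fun i hi => ?_, by simpa using H.cost⟩
  have := H.count i hi
  rw [childSumFrom, Finset.Ico_self, Finset.sum_empty]
  by_cases hi' : i < n - 1
  · rw [if_pos hi'] at this
    rw [if_neg (by omega)]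
    omega
  · obtain rfl : i = n - 1 := by omega
    rw [if_neg hi'] at this
    simp only [hr] at *
    simpa using this

/-- Once its own deficit is filled, a label holds its final count plus the deficits still owed to
its children below c. At c = 0 nothing is owed, and the count is f. -/
theorem DownPass.count_eq (H : DownPass n par s S F δ c a) {i : ℕ} (hi : i < n) (hc : c ≤ i)
    (hS : S i = s i + childSum par S (n - 1) i) (hF : F i = f i + childSum par F (n - 1) i) :
    PebbleMotion.count a i + childSumFrom n par (fun l => F l - S l) c i =
      f i + childSumFrom n par (fun l => F l - S l) 0 i := by
  have h₁ := H.count i hi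
  have h₂ := childSum_add (par := par) (fun l => S l - F l) F (n - 1) i
  have h₃ := childSum_add (par := par) (fun l => F l - S l) S (n - 1) i
  -- With truncated subtraction both sides are the maximum of S l and F l.
  have h₄ : (fun l => (S l - F l) + F l) = fun l => (F l - S l) + S l := by
    funext l
    omega
  rw [childSumFrom_zero]
  rw [if_pos hc] at h₁
  rw [h₄] at h₂
  omega

theorem DownPass.le_count (h : IncPar n par) (hc : c + 1 < n)
    (H : DownPass n par s S F δ (c + 1) a)
    (hS : ∀ i, i < n → S i = s i + childSum par S (n - 1) i)
    (hF : ∀ i, i < n → F i = f i + childSum par F (n - 1) i) :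
    F c - S c ≤ PebbleMotion.count a (par c) := by
  have hp := h c hc
  have h₁ := H.count_eq hp.2 (by omega) (hS _ hp.2) (hF _ hp.2)
  have h₂ := childSumFrom_anti (n := n) (par := par) (Nat.zero_le c) (fun l => F l - S l) (par c)
  rw [childSumFrom_eq hc, if_pos rfl] at h₂
  omega

theorem DownPass.step (h : IncPar n par) (hc : c + 1 < n) (H : DownPass n par s S F δ (c + 1) a)
    (hδ : ∀ p, δ p c ≤ δ p (par c) + 1) (hm : Moves (par c) c (F c - S c) a a') :
    DownPass n par s S F δ c a' := by
  have hp := h c hc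
  refine ⟨hm.lt H.lt (by omega), fun i hi => ?_, ?_⟩
  · have h₁ := H.count i hi
    have h₂ := hm.count i
    rw [childSumFrom_eq hc]
    by_cases hic : i = c
    · subst hic
      rw [if_neg (by omega), if_pos rfl] at h₂
      rw [if_neg (by omega)] at h₁
      rw [if_neg (by omega), if_pos le_rfl]
      omega
    · have : c + 1 ≤ i ↔ c ≤ i := by omega
      simp only [eq_comm (a := par c), if_neg hic, this] at *
      omega
  · have := hm.cost hδ
    have := H.cost
    rw [Finset.sum_eq_sum_Ico_succ_bot (by omega : c < n - 1)]
    omega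

end Moves

/-! ### Optimal solutions in labelled trees -/

/-- Every label in the range of `m` except for `t` has its parent in the range of `m`. -/
def TopClosed {k : ℕ} (n : ℕ) (par : ℕ → ℕ) (m : Fin k → ℕ) (t : ℕ) : Prop :=
  (∃ p, m p = t) ∧ ∀ p, m p ≠ t → m p + 1 < n ∧ ∃ q, m q = par (m p)

section TopClosed
variable {n k : ℕ} {par : ℕ → ℕ} {a m : Fin k → ℕ} {t : ℕ}

theorem count_pos {i : ℕ} : 0 < count m i ↔ ∃ p, m p = i := by
  rw [count, Finset.sum_pos_iff]
  simp only [Finset.mem_univ, true_and]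
  refine exists_congr fun p => ?_
  split <;> simp_all

/-- Climbing from an end label through occupied parents can stop only at t. -/
theorem TopClosed.le_and_up (h : IncPar n par) (H : TopClosed n par m t) (p : Fin k) :
    m p ≤ t ∧ up par t (m p) = t := by
  by_cases hp : m p = t
  · rw [hp, up_of_le le_rfl]
    exact ⟨le_rfl, rfl⟩
  · obtain ⟨h₁, q, hq⟩ := H.2 p hp
    have h₂ := (h _ h₁).1
    obtain ⟨h₃, h₄⟩ := TopClosed.le_and_up h H q
    refine ⟨by omega, ?_⟩
    rw [← up_par h₂ (by omega), ← hq, h₄]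
termination_by n - m p
decreasing_by omega

/-- The centroid argument: at least as many pebbles start outside the subtree of t as inside it, and
a step towards the root helps the former as much as it can hurt the latter. -/
theorem TopClosed.shift (h : IncPar n par) (H : TopClosed n par m t) (ht : t + 1 < n)
    (hk : 2 * acc par (count a) t t ≤ k) :
    TopClosed n par (fun p => par (m p)) (par t) ∧
      ∑ p, labelDist n par (a p) (par (m p)) ≤ ∑ p, labelDist n par (a p) (m p) := by
  have hlt : ∀ p, m p + 1 < n := fun p => by
    have := (H.le_and_up h p).1
    omega
  refine ⟨⟨H.1.imp fun p hp => by simp only [hp], fun p hp => ?_⟩, ?_⟩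
  · have hne : m p ≠ t := fun hp' => hp (by simp only [hp'])
    obtain ⟨-, q, hq⟩ := H.2 p hne
    exact ⟨by simpa only [hq] using hlt q, q, by simp only [hq]⟩
  · rw [acc_count h (by omega) le_rfl] at hk
    have hone : (∑ p, if up par t (a p) = t then 1 else 0) +
        (∑ p, if up par t (a p) = t then 0 else 1) = k := by
      rw [← Finset.sum_add_distrib]
      calc _ = ∑ _p : Fin k, 1 := Finset.sum_congr rfl fun p _ => by split <;> rfl
        _ = k := by simp
    have hsum : ∑ p, (labelDist n par (a p) (par (m p)) + if up par t (a p) = t then 0 else 1) ≤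
        ∑ p, (labelDist n par (a p) (m p) + if up par t (a p) = t then 1 else 0) := by
      refine Finset.sum_le_sum fun p _ => ?_
      by_cases hp : up par t (a p) = t
      · have h₁ := labelDist_triangle (n := n) (par := par) (a p) (m p) (par (m p))
        have h₂ := labelDist_par_le h (hlt p)
        rw [if_pos hp, if_pos hp]
        omega
      · rw [if_neg hp, if_neg hp]
        refine (labelDist_par_add_one h (hlt p) fun hp' => hp ?_).le
        obtain ⟨h₁, h₂⟩ := H.le_and_up h p
        -- A start below m p would also be below t, since m p is; so starts outside the subtree of t
        -- do save a step.
        rw [up_trans hp' h₁, h₂]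
    rw [Finset.sum_add_distrib, Finset.sum_add_distrib] at hsum
    omega

/-- Shift until the top is the root; then the bound for solutions that use the root applies. -/
theorem TopClosed.table_le (h : IncPar n par) (hm : ∀ p, m p < n) (H : TopClosed n par m t)
    (hk : ∀ c, c + 1 < n → 2 * acc par (count a) c c ≤ k) :
    table par (fun c => acc par (count a) c c) (n - 1) (n - 1) k ≤
      ∑ p, labelDist n par (a p) (m p) := by
  induction hd : n - t using Nat.strong_induction_on generalizing m t with
  | _ d ih =>
  obtain ⟨p₀, hp₀⟩ := H.1
  have hp₁ := hm p₀
  by_cases ht : t + 1 < n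
  · obtain ⟨h₁, h₂⟩ := H.shift h ht (hk t ht)
    have := (h t ht).1
    refine (ih _ (by omega) (fun p => ?_) h₁ rfl).trans h₂
    have := (H.le_and_up h p).1
    exact (h _ (by omega)).2
  · refine PebbleMotion.table_le h (by omega) hm fun i hi h₀ => ?_
    obtain ⟨p, hp⟩ := count_pos.1 h₀
    obtain ⟨-, q, hq⟩ := H.2 p (by omega)
    exact count_pos.2 ⟨q, hp ▸ hq⟩

end TopClosed

/-! ### From labels to the graph: optimality of the computed solution -/

/-- The vertices are labelled by `0, …, n - 1` so that the edges are the pairs of a label below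
`n - 1` and its parent, and parents have larger labels. -/
structure Labelling {n : ℕ} (G : SimpleGraph (Fin n)) (pos : Fin n → ℕ) (par : ℕ → ℕ) :
    Prop where
  inc : IncPar n par
  lt : ∀ v, pos v < n
  inj : Function.Injective pos
  adj_iff : ∀ u v, G.Adj u v ↔
    (pos u + 1 < n ∧ pos v = par (pos u)) ∨ (pos v + 1 < n ∧ pos u = par (pos v))

namespace Labelling
variable {n k : ℕ} {G : SimpleGraph (Fin n)} {pos : Fin n → ℕ} {par : ℕ → ℕ}

theorem exists_pos (L : Labelling G pos par) {i : ℕ} (hi : i < n) : ∃ v, pos v = i := by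
  have hinj : Function.Injective fun v => (⟨pos v, L.lt v⟩ : Fin n) := fun u v huv =>
    L.inj (by simpa using huv)
  obtain ⟨v, hv⟩ := Finite.injective_iff_surjective.1 hinj ⟨i, hi⟩
  exact ⟨v, by simpa using hv⟩

theorem labelDist_le_dist (L : Labelling G pos par) (hG : G.Connected) (u v : Fin n) :
    labelDist n par (pos u) (pos v) ≤ G.dist u v := by
  obtain ⟨w, hw⟩ := hG.exists_walk_length_eq_dist u v
  rw [← hw]
  clear hw
  induction w with
  | nil => simp [labelDist_self]
  | @cons u v w huv q ih =>
    have h₁ := labelDist_triangle (n := n) (par := par) (pos u) (pos v) (pos w)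
    have h₂ : labelDist n par (pos u) (pos v) ≤ 1 := by
      rcases (L.adj_iff u v).1 huv with ⟨h, h'⟩ | ⟨h, h'⟩
      · rw [h']
        exact labelDist_par_le L.inc h
      · rw [h', labelDist_comm]
        exact labelDist_par_le L.inc h
    rw [SimpleGraph.Walk.length_cons]
    omega

/-- Take for t the largest occupied label. A path to it inside the end set must leave the subtree of
any other occupied label, and the only edge out of that subtree leads to the parent of its top. -/
theorem topClosed_of_con (L : Labelling G pos par) {ν : Fin k → Fin n}
    (h : Con G (Set.range ν)) : ∃ t, TopClosed n par (fun p => pos (ν p)) t := by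
  have hne : (Finset.univ : Finset (Fin k)).Nonempty := by
    obtain ⟨_, p, -⟩ := h.nonempty.some
    exact ⟨p, Finset.mem_univ p⟩
  obtain ⟨q, -, hq⟩ := Finset.exists_max_image Finset.univ (fun p => pos (ν p)) hne
  refine ⟨pos (ν q), ⟨q, rfl⟩, fun p hp => ?_⟩
  dsimp only at hp
  have h₁ := hq p (Finset.mem_univ p)
  have h₂ := L.lt (ν q)
  refine ⟨by dsimp only; omega, ?_⟩
  obtain ⟨w⟩ := h.preconnected ⟨ν p, p, rfl⟩ ⟨ν q, q, rfl⟩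
  obtain ⟨d, -, hd₁, hd₂⟩ := w.exists_boundary_dart
    {x | up par (pos (ν p)) (pos x.1) = pos (ν p)}
    (by rw [Set.mem_ofPred_eq, up_of_le le_rfl])
    (by rw [Set.mem_ofPred_eq, up_of_le h₁]; omega)
  rw [Set.mem_ofPred_eq] at hd₁ hd₂
  have had : G.Adj d.fst.1 d.snd.1 := d.adj
  rcases (L.adj_iff _ _).1 had with ⟨h₃, h₄⟩ | ⟨h₃, h₄⟩
  · rw [up_eq_iff (L.inc _ h₃).1, ← h₄] at hd₁
    rcases hd₁ with hd₁ | hd₁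
    · obtain ⟨r, hr⟩ := d.snd.2
      exact ⟨r, by simp only [hr, hd₁, h₄]⟩
    · exact absurd hd₁ hd₂
  · rw [up_eq_iff (L.inc _ h₃).1, ← h₄] at hd₂
    exact absurd (Or.inr hd₁) hd₂

theorem con_of_topClosed (L : Labelling G pos par) {ν : Fin k → Fin n} {t : ℕ}
    (h : TopClosed n par (fun p => pos (ν p)) t) : Con G (Set.range ν) := by
  obtain ⟨⟨q, hq⟩, h⟩ := h
  rw [Con, SimpleGraph.connected_iff_exists_forall_reachable]
  refine ⟨⟨ν q, q, rfl⟩, ?_⟩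
  suffices ∀ d p, n - pos (ν p) = d →
      (G.induce (Set.range ν)).Reachable ⟨ν q, q, rfl⟩ ⟨ν p, p, rfl⟩ by
    rintro ⟨_, p, rfl⟩
    exact this _ p rfl
  intro d
  induction d using Nat.strong_induction_on with
  | _ d ih =>
    intro p hd
    by_cases hp : pos (ν p) = t
    · have : ν q = ν p := L.inj (hq.trans hp.symm)
      simp only [this]
      exact .rfl
    · obtain ⟨h₁, r, hr⟩ := h p hp
      dsimp only at h₁ hr
      have h₂ := (L.inc _ h₁).1
      refine (ih _ (by omega) r rfl).trans (SimpleGraph.Adj.reachable ?_)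
      exact (L.adj_iff _ _).2 (.inr ⟨h₁, hr⟩)

/-- The pebbles that result from the dynamic program are an optimal solution. -/
theorem isOptimal (L : Labelling G pos par) (hG : G.Connected) (hn : 0 < n)
    {σ μ : Fin k → Fin n} {S g F : ℕ → ℕ} {ord : ℕ → Fin n} {a : Fin k → ℕ}
    (hS : S = fun c => acc par (count fun p => pos (σ p)) c c)
    (hk : ∀ c, c + 1 < n → 2 * S c ≤ k) (B : Backtrack n k par S 0 g F)
    (D : DownPass n par (count fun p => pos (σ p)) S F (fun p i => G.dist (σ p) (ord i)) 0 a)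
    (hμ : ∀ p, pos (μ p) = a p ∧ ord (a p) = μ p) :
    IsOptimal (Con G) (sumCost G σ) μ ∧ sumCost G σ μ = table par S (n - 1) (n - 1) k := by
  have lower : ∀ ν : Fin k → Fin n, Con G (Set.range ν) →
      table par S (n - 1) (n - 1) k ≤ sumCost G σ ν := by
    intro ν hν
    subst hS
    obtain ⟨t, ht⟩ := L.topClosed_of_con hν
    refine (ht.table_le L.inc (fun p => L.lt _) hk).trans ?_
    exact Finset.sum_le_sum fun p _ => L.labelDist_le_dist hG _ _
  have upper : sumCost G σ μ ≤ table par S (n - 1) (n - 1) k := by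
    have h₁ := D.cost
    have h₂ : sumCost G σ μ = ∑ p, G.dist (σ p) (ord (a p)) :=
      Finset.sum_congr rfl fun p _ => by rw [(hμ p).2]
    rw [B.cost, h₂]
    refine h₁.trans (le_of_eq ?_)
    -- At c = 0 the table is zero, so the optimal value has been resolved into the sum of all |S c -
    -- F c|.
    simp only [table, Finset.sum_const_zero, zero_add, absDiff, Finset.sum_add_distrib,
      ← Finset.range_eq_Ico]
  have hcount : ∀ i, i < n → count a i = g i := fun i hi => by
    have := D.count_eq (f := g) hi (Nat.zero_le i)
      (by rw [hS]; exact acc_balance L.inc _ hi)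
      (by
        have := B.balance i (Nat.zero_le i) hi
        rw [← Finset.range_eq_Ico, ← childSum] at this
        exact this.symm)
    omega
  have hmem : ∀ i, i < n → 0 < g i → ∃ p, a p = i := fun i hi h₀ =>
    count_pos.1 (by rw [hcount i hi]; exact h₀)
  have hcon : Con G (Set.range μ) := by
    refine L.con_of_topClosed (t := n - 1) ?_
    simp only [fun p => (hμ p).1]
    refine ⟨hmem _ (by omega) B.root, fun p hp => ?_⟩
    have h₁ := D.lt p
    have h₂ : 0 < g (a p) := by
      rw [← hcount _ h₁]
      exact count_pos.2 ⟨p, rfl⟩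
    dsimp only at hp ⊢
    exact ⟨by omega, hmem _ (L.inc _ (by omega)).2 (B.closed _ (Nat.zero_le _) (by omega) h₂)⟩
  exact ⟨⟨hcon, fun ν hν => upper.trans (lower ν hν)⟩, upper.antisymm (lower μ hcon)⟩

end Labelling

/-! ### The elimination of the leaves -/

/-- The contributions of the edges in `E` to the vertex `v`, where every edge at `v` contributes the
weight of its other endpoint. -/
def edgeSum {n : ℕ} (w : ℕ → ℕ) (E : List (Fin n × Fin n)) (v : ℕ) : ℕ :=
  (E.map fun e => (if v = e.1 then w e.2 else 0) + if v = e.2 then w e.1 else 0).sum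

theorem edgeSum_cons {n : ℕ} (w : ℕ → ℕ) (e : Fin n × Fin n) (E : List (Fin n × Fin n)) (v : ℕ) :
    edgeSum w (e :: E) v =
      ((if v = e.1 then w e.2 else 0) + if v = e.2 then w e.1 else 0) + edgeSum w E v := by
  rw [edgeSum, List.map_cons, List.sum_cons, edgeSum]

/-- Without repeated edges and loops, each neighbour of v is contributed by exactly one list entry
and one of its endpoints. -/
theorem edgeSum_eq_sum {n : ℕ} (w : ℕ → ℕ) {E : List (Fin n × Fin n)}
    (hE : (E.map fun e => s(e.1, e.2)).Nodup) (hd : ∀ e ∈ E, e.1 ≠ e.2) (v : Fin n) :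
    edgeSum w E v = ∑ u : Fin n, if s(v, u) ∈ E.map (fun e => s(e.1, e.2)) then w u else 0 := by
  induction E with
  | nil => simp [edgeSum]
  | cons e E ih =>
    rw [List.map_cons, List.nodup_cons] at hE
    have hne := hd e List.mem_cons_self
    rw [edgeSum_cons, ih hE.2 fun e he => hd e (List.mem_cons_of_mem _ he)]
    have h₁ : ∀ x y : Fin n, (if (v : ℕ) = x then w y else 0) =
        ∑ u : Fin n, if v = x ∧ u = y then w u else 0 := by
      intro x y
      by_cases hv : v = x
      · simp [hv]
      · simp [hv, Fin.val_inj]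
    rw [h₁, h₁, ← Finset.sum_add_distrib, ← Finset.sum_add_distrib]
    refine Finset.sum_congr rfl fun u _ => ?_
    have h₂ : s(v, u) = s(e.1, e.2) ↔ (v = e.1 ∧ u = e.2) ∨ (v = e.2 ∧ u = e.1) := by
      rw [Sym2.eq_iff]
    have h₃ : ¬ ((v = e.1 ∧ u = e.2) ∧ (v = e.2 ∧ u = e.1)) := fun h =>
      hne (h.1.1.symm.trans h.2.1)
    have h₄ : s(v, u) = s(e.1, e.2) → s(v, u) ∉ E.map (fun e => s(e.1, e.2)) := fun h => h ▸ hE.1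
    simp only [List.map_cons, List.mem_cons]
    by_cases ha : v = e.1 ∧ u = e.2
    · have hb : ¬ (v = e.2 ∧ u = e.1) := fun h => h₃ ⟨ha, h⟩
      have hc := h₂.2 (.inl ha)
      rw [if_pos ha, if_neg hb, if_neg (h₄ hc), if_pos (.inl hc)]
      omega
    · by_cases hb : v = e.2 ∧ u = e.1
      · have hc := h₂.2 (.inr hb)
        rw [if_neg ha, if_pos hb, if_neg (h₄ hc), if_pos (.inl hc)]
        omega
      · have hc : ¬ s(v, u) = s(e.1, e.2) := fun h => (h₂.1 h).elim ha hb
        rw [if_neg ha, if_neg hb]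
        simp only [hc, false_or]
        omega

open Classical in
theorem IsEdgeList.edgeSum_eq {n : ℕ} {G : SimpleGraph (Fin n)} {E : List (Fin n × Fin n)}
    (hE : IsEdgeList G E) (w : ℕ → ℕ) (v : Fin n) :
    edgeSum w E v = ∑ u : Fin n, if G.Adj v u then w u else 0 := by
  rw [edgeSum_eq_sum w hE.1 fun e he => ?_]
  · refine Finset.sum_congr rfl fun u _ => ?_
    simp only [hE.2, SimpleGraph.mem_edgeSet]
  · have h := (hE.2 s(e.1, e.2)).1 (List.mem_map.2 ⟨e, he, rfl⟩)
    exact ((SimpleGraph.mem_edgeSet G).1 h).ne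

open Classical in
theorem IsEdgeList.length_add_one {n : ℕ} {G : SimpleGraph (Fin n)} (hG : G.IsTree)
    {E : List (Fin n × Fin n)} (hE : IsEdgeList G E) : E.length + 1 = n := by
  have h₁ := hG.card_edgeFinset
  rw [Fintype.card_fin] at h₁
  have h₂ : (E.map fun e => s(e.1, e.2)).toFinset = G.edgeFinset := by
    ext x
    rw [List.mem_toFinset, hE.2, SimpleGraph.mem_edgeFinset]
  rwa [← h₂, List.toFinset_card_of_nodup hE.1, List.length_map] at h₁

/-- The contents of the arrays that are used in the elimination of the leaves. -/
structure ElimArrays where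
  deg : ℕ → ℕ
  nbr : ℕ → ℕ
  cnt : ℕ → ℕ
  ord : ℕ → ℕ
  parent : ℕ → ℕ
  pos : ℕ → ℕ
  wt : ℕ → ℕ

open Classical in
/-- The state of the elimination when the `t` vertices outside `R` have been removed: `deg` holds
the degrees in the remaining tree, `nbr` the sums of the neighbours, `cnt` the numbers of pebbles;
`ord` and `pos` hold the order in which the other vertices were removed, `parent` and `wt` hold
the neighbour and the number of pebbles at the time of the removal. -/
structure Elim {n : ℕ} (G : SimpleGraph (Fin n)) (k : ℕ) (c : ℕ → ℕ) (R : Finset (Fin n)) (t : ℕ)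
    (A : ElimArrays) : Prop where
  card : R.card + t = n
  cut : ∀ X ⊆ R, X.Nonempty → X ≠ R → ∃ x ∈ X, ∃ y ∈ R, y ∉ X ∧ G.Adj x y
  deg : ∀ v ∈ R, A.deg v = ∑ u ∈ R, if G.Adj v u then 1 else 0
  deg_zero : ∀ v ∉ R, A.deg v = 0
  deg_sum : ∑ v ∈ R, A.deg v + 2 = 2 * R.card
  nbr : ∀ v ∈ R, A.nbr v = ∑ u ∈ R, if G.Adj v u then (u : ℕ) else 0
  cnt : ∀ v ∈ R, A.cnt v = c v + ∑ l ∈ Finset.range t, if A.parent l = v then A.wt l else 0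
  cnt_sum : ∑ v ∈ R, A.cnt v ≤ k
  wt : ∀ l < t, A.wt l = c (A.ord l) + ∑ l' ∈ Finset.range l,
    if A.parent l' = A.ord l then A.wt l' else 0
  wt_le : ∀ l < t, 2 * A.wt l ≤ k
  ord : ∀ l < t, ∃ v ∉ R, A.ord l = (v : Fin n) ∧ A.pos v = l
  pos : ∀ v ∉ R, A.pos v < t ∧ A.ord (A.pos v) = v
  parent : ∀ l < t, ∃ v p : Fin n, A.ord l = v ∧ A.parent l = p ∧ G.Adj v p ∧
    (p ∈ R ∨ l < A.pos p) ∧ ∀ w, G.Adj v w → w = p ∨ (w ∉ R ∧ A.pos w < l)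

/-- The removal of the leaf `v` with the neighbour `p`. -/
def ElimArrays.remove (A : ElimArrays) (t v p : ℕ) : ElimArrays where
  deg := Function.update (Function.update A.deg v 0) p (A.deg p - 1)
  nbr := Function.update A.nbr p (A.nbr p - v)
  cnt := Function.update A.cnt p (A.cnt p + A.cnt v)
  ord := Function.update A.ord t v
  parent := Function.update A.parent t p
  pos := Function.update A.pos v t
  wt := Function.update A.wt t (A.cnt v)

namespace Elim
variable {n : ℕ} {G : SimpleGraph (Fin n)} {k : ℕ} {c : ℕ → ℕ} {R : Finset (Fin n)} {t : ℕ}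
  {A : ElimArrays}

-- Connectivity enters in the form of cuts, which is stable under deletion of leaves, and acyclicity
-- only through the handshake identity with n - 1 edges.
open Classical in
theorem init (hG : G.IsTree) (hd : ∀ v : Fin n, A.deg v = ∑ u, if G.Adj v u then 1 else 0)
    (hs : ∀ v : Fin n, A.nbr v = ∑ u : Fin n, if G.Adj v u then (u : ℕ) else 0)
    (hc : ∀ v : Fin n, A.cnt v = c v) (hck : ∑ v : Fin n, c v ≤ k) :
    Elim G k c Finset.univ 0 A where
  card := by simp
  cut X _ hX hX' := by
    obtain ⟨x, hx⟩ := hX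
    obtain ⟨y, hy⟩ : ∃ y, y ∉ X := by
      by_contra! h
      exact hX' (Finset.eq_univ_of_forall h)
    obtain ⟨w⟩ := hG.connected.preconnected x y
    obtain ⟨d, -, h₁, h₂⟩ := w.exists_boundary_dart (X : Set (Fin n)) hx hy
    exact ⟨d.fst, h₁, d.snd, Finset.mem_univ _, h₂, d.adj⟩
  deg v _ := hd v
  deg_zero v hv := absurd (Finset.mem_univ v) hv
  deg_sum := by
    have h₁ := hG.card_edgeFinset
    have h₂ := G.sum_degrees_eq_twice_card_edges
    have h₃ : ∀ v, A.deg (v : Fin n) = G.degree v := fun v => by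
      rw [hd, ← Finset.card_filter, ← SimpleGraph.card_neighborFinset_eq_degree]
      congr 1
      ext u
      simp
    rw [Finset.sum_congr rfl fun v _ => h₃ v, h₂, ← h₁.trans (Finset.card_univ).symm]
    ring
  nbr v _ := hs v
  cnt v _ := by simp [hc]
  cnt_sum := by simpa only [hc] using hck
  wt l hl := absurd hl (Nat.not_lt_zero l)
  wt_le l hl := absurd hl (Nat.not_lt_zero l)
  ord l hl := absurd hl (Nat.not_lt_zero l)
  pos v hv := absurd (Finset.mem_univ v) hv
  parent l hl := absurd hl (Nat.not_lt_zero l)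

/-- Degree 1 excludes removed vertices, whose stored degree is 0; a sum over one neighbour is that
neighbour. -/
theorem exists_parent (H : Elim G k c R t A) {v : Fin n} (hv : A.deg v = 1) :
    v ∈ R ∧ ∃ p ∈ R, A.nbr v = p ∧ G.Adj v p ∧ ∀ u ∈ R, G.Adj v u → u = p := by
  classical
  have hvR : v ∈ R := by
    by_contra h
    rw [H.deg_zero v h] at hv
    omega
  refine ⟨hvR, ?_⟩
  rw [H.deg v hvR, ← Finset.card_filter, Finset.card_eq_one] at hv
  obtain ⟨p, hp⟩ := hv
  have hmem : ∀ u, u ∈ R ∧ G.Adj v u ↔ u = p := fun u => by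
    have := Finset.ext_iff.1 hp u
    simpa using this
  obtain ⟨h₁, h₂⟩ := (hmem p).2 rfl
  refine ⟨p, h₁, ?_, h₂, fun u hu h => (hmem u).1 ⟨hu, h⟩⟩
  rw [H.nbr v hvR, ← Finset.sum_filter]
  have : R.filter (G.Adj v) = {p} := by convert hp
  rw [this, Finset.sum_singleton]

theorem cnt_add_le (H : Elim G k c R t A) {u v : Fin n} (hu : u ∈ R) (hv : v ∈ R) (h : u ≠ v) :
    A.cnt u + A.cnt v ≤ k := by
  have := H.cnt_sum
  rw [← Finset.add_sum_erase R _ hv,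
    ← Finset.add_sum_erase _ _ (Finset.mem_erase.2 ⟨h, hu⟩)] at this
  omega

theorem lt_of_mem (H : Elim G k c R t A) {v : Fin n} (hv : v ∈ R) : t < n := by
  have := H.card
  have := Finset.card_pos.2 ⟨v, hv⟩
  omega

/-- For the cut condition, apply the old one to X with v added if p is in X, and to X otherwise: in
both cases v and its only neighbour p lie on the same side, so the crossing edge avoids v. -/
theorem remove (H : Elim G k c R t A) {v p : Fin n} (hv : v ∈ R) (hk : 2 * A.cnt v ≤ k)
    (hp : p ∈ R) (hvp : G.Adj v p) (hu : ∀ u ∈ R, G.Adj v u → u = p) :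
    Elim G k c (R.erase v) (t + 1) (A.remove t v p) := by
  classical
  have hne : p ≠ v := hvp.ne'
  have hpR : p ∈ R.erase v := Finset.mem_erase.2 ⟨hne, hp⟩
  have hval : ∀ {u w : Fin n}, u ≠ w → (u : ℕ) ≠ w := fun h h' => h (Fin.ext h')
  have hdv : A.deg v = 1 := by
    rw [H.deg v hv, ← Finset.card_filter, Finset.card_eq_one]
    refine ⟨p, ?_⟩
    ext u
    simp only [Finset.mem_filter, Finset.mem_singleton]
    exact ⟨fun h => hu u h.1 h.2, fun h => h ▸ ⟨hp, hvp⟩⟩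
  have hsum : ∀ (f : Fin n → ℕ) (w : Fin n), (∑ u ∈ R, if G.Adj w u then f u else 0) =
      (if G.Adj w v then f v else 0) + ∑ u ∈ R.erase v, if G.Adj w u then f u else 0 := fun f w =>
    (Finset.add_sum_erase R _ hv).symm
  have hadj : ∀ w ∈ R, w ≠ p → ¬ G.Adj w v := fun w hw hwp h => hwp (hu w hw h.symm)
  have hmem : ∀ {w}, w ∈ R.erase v ↔ w ≠ v ∧ w ∈ R := Finset.mem_erase
  have hnmem : ∀ {w}, w ∉ R.erase v ↔ w = v ∨ w ∉ R := by
    intro w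
    rw [hmem]
    tauto
  have hpos : ∀ w ∉ R, (Function.update A.pos (v : ℕ) t) w = A.pos w := fun w hw =>
    Function.update_of_ne (hval (by rintro rfl; exact hw hv)) _ _
  have hlt : ∀ (f : ℕ → ℕ) (x : ℕ), ∀ l < t, Function.update f t x l = f l := fun f x l hl =>
    Function.update_of_ne hl.ne _ _
  have hdegp : A.deg p = 1 + ∑ u ∈ R.erase v, if G.Adj p u then 1 else 0 := by
    rw [H.deg p hp, hsum, if_pos hvp.symm]
  have hparsum : ∀ l ≤ t, ∀ i, (∑ l' ∈ Finset.range l, if (A.remove t v p).parent l' = i then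
      (A.remove t v p).wt l' else 0) =
      ∑ l' ∈ Finset.range l, if A.parent l' = i then A.wt l' else 0 := fun l hl i => by
    refine Finset.sum_congr rfl fun l' hl' => ?_
    rw [Finset.mem_range] at hl'
    simp only [ElimArrays.remove, hlt _ _ l' (by omega)]
  have hRlt := H.lt_of_mem hv
  refine ⟨?_, ?_, ?_, ?_, ?_, ?_, ?_, ?_, ?_, ?_, ?_, ?_, ?_⟩
  · have := H.card
    rw [Finset.card_erase_of_mem hv]
    have := Finset.card_pos.2 ⟨v, hv⟩
    omega
  · intro X hX hXne hXR
    by_cases hpX : p ∈ X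
    · obtain ⟨x, hx, y, hy, hyX, hxy⟩ := H.cut (insert v X)
        (Finset.insert_subset hv (hX.trans (Finset.erase_subset _ _)))
        (Finset.insert_nonempty _ _) (fun h => hXR (by
          rw [← h, Finset.erase_insert fun h' => Finset.notMem_erase v R (hX h')]))
      rw [Finset.mem_insert, not_or] at hyX
      rcases Finset.mem_insert.1 hx with rfl | hx
      · exact absurd (hu y hy hxy ▸ hpX) hyX.2
      · exact ⟨x, hx, y, hmem.2 ⟨hyX.1, hy⟩, hyX.2, hxy⟩
    · obtain ⟨x, hx, y, hy, hyX, hxy⟩ := H.cut X (hX.trans (Finset.erase_subset _ _)) hXne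
        (fun h => Finset.notMem_erase v R (hX (h ▸ hv)))
      refine ⟨x, hx, y, hmem.2 ⟨fun h => ?_, hy⟩, hyX, hxy⟩
      subst h
      exact hpX (hu x (Finset.mem_of_mem_erase (hX hx)) hxy.symm ▸ hx)
  · intro w hw
    rw [hmem] at hw
    simp only [ElimArrays.remove]
    by_cases hwp : w = p
    · rw [hwp, Function.update_self, hdegp, Nat.add_sub_cancel_left]
    · rw [Function.update_of_ne (hval hwp), Function.update_of_ne (hval hw.1), H.deg w hw.2, hsum,
        if_neg (hadj w hw.2 hwp), zero_add]
  · intro w hw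
    have hwp : w ≠ p := fun h => hw (h ▸ hpR)
    simp only [ElimArrays.remove]
    rw [Function.update_of_ne (hval hwp)]
    rcases hnmem.1 hw with rfl | hw'
    · rw [Function.update_self]
    · rw [Function.update_of_ne (hval (by rintro rfl; exact hw' hv)), H.deg_zero w hw']
  · have h₁ := H.deg_sum
    rw [← Finset.add_sum_erase R _ hv, ← Finset.add_sum_erase _ _ hpR] at h₁
    rw [← Finset.add_sum_erase _ _ hpR, Finset.card_erase_of_mem hv]
    have h₂ : ∑ w ∈ (R.erase v).erase p, (A.remove t v p).deg w =
        ∑ w ∈ (R.erase v).erase p, A.deg w := by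
      refine Finset.sum_congr rfl fun w hw => ?_
      rw [Finset.mem_erase, Finset.mem_erase] at hw
      simp only [ElimArrays.remove]
      rw [Function.update_of_ne (hval hw.1), Function.update_of_ne (hval hw.2.1)]
    have h₃ : (A.remove t v p).deg p = A.deg p - 1 := Function.update_self _ _ _
    rw [h₂, h₃]
    omega
  · intro w hw
    rw [hmem] at hw
    simp only [ElimArrays.remove]
    by_cases hwp : w = p
    · rw [hwp, Function.update_self, H.nbr p hp, hsum (fun u => (u : ℕ)), if_pos hvp.symm,
        Nat.add_sub_cancel_left]
    · rw [Function.update_of_ne (hval hwp), H.nbr w hw.2, hsum (fun u => (u : ℕ)),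
        if_neg (hadj w hw.2 hwp), zero_add]
  · intro w hw
    rw [hmem] at hw
    rw [Finset.sum_range_succ, hparsum t le_rfl]
    simp only [ElimArrays.remove, Function.update_self]
    by_cases hwp : w = p
    · rw [hwp, Function.update_self, if_pos rfl, H.cnt p hp, add_assoc]
    · rw [Function.update_of_ne (hval hwp), H.cnt w hw.2, if_neg (hval (Ne.symm hwp)), add_zero]
  · have h₁ := H.cnt_sum
    rw [← Finset.add_sum_erase R _ hv, ← Finset.add_sum_erase _ _ hpR] at h₁
    rw [← Finset.add_sum_erase _ _ hpR]
    have h₂ : ∑ w ∈ (R.erase v).erase p, (A.remove t v p).cnt w =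
        ∑ w ∈ (R.erase v).erase p, A.cnt w := by
      refine Finset.sum_congr rfl fun w hw => ?_
      rw [Finset.mem_erase, Finset.mem_erase] at hw
      exact Function.update_of_ne (hval hw.1) _ _
    have h₃ : (A.remove t v p).cnt p = A.cnt p + A.cnt v := Function.update_self _ _ _
    rw [h₂, h₃]
    omega
  · intro l hl
    rw [hparsum l (by omega)]
    simp only [ElimArrays.remove]
    rcases Nat.lt_succ_iff_lt_or_eq.1 hl with hl | rfl
    · simp only [hlt _ _ l hl, H.wt l hl]
    · simp only [Function.update_self, H.cnt v hv]
  · intro l hl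
    simp only [ElimArrays.remove]
    rcases Nat.lt_succ_iff_lt_or_eq.1 hl with hl | rfl
    · rw [hlt _ _ l hl]
      exact H.wt_le l hl
    · rwa [Function.update_self]
  · intro l hl
    simp only [ElimArrays.remove]
    rcases Nat.lt_succ_iff_lt_or_eq.1 hl with hl | rfl
    · obtain ⟨w, hw, h₁, h₂⟩ := H.ord l hl
      exact ⟨w, hnmem.2 (.inr hw), by rw [hlt _ _ l hl, h₁], by rw [hpos w hw, h₂]⟩
    · exact ⟨v, hnmem.2 (.inl rfl), Function.update_self _ _ _, Function.update_self _ _ _⟩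
  · intro w hw
    simp only [ElimArrays.remove]
    rcases hnmem.1 hw with rfl | hw
    · rw [Function.update_self, Function.update_self]
      exact ⟨by omega, rfl⟩
    · obtain ⟨h₁, h₂⟩ := H.pos w hw
      rw [hpos w hw, hlt _ _ _ h₁]
      exact ⟨by omega, h₂⟩
  · intro l hl
    simp only [ElimArrays.remove]
    rcases Nat.lt_succ_iff_lt_or_eq.1 hl with hl | rfl
    · obtain ⟨x, q, h₁, h₂, h₃, h₄, h₅⟩ := H.parent l hl
      refine ⟨x, q, by rw [hlt _ _ l hl, h₁], by rw [hlt _ _ l hl, h₂], h₃, ?_, fun w hw => ?_⟩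
      · rcases h₄ with h₄ | h₄
        · by_cases hqv : q = v
          · right
            rw [hqv, Function.update_self]
            exact hl
          · exact .inl (hmem.2 ⟨hqv, h₄⟩)
        · by_cases hqv : q = v
          · right
            rw [hqv, Function.update_self]
            exact hl
          · right
            rw [Function.update_of_ne (hval hqv)]
            exact h₄
      · refine (h₅ w hw).imp_right fun ⟨h₆, h₇⟩ => ⟨hnmem.2 (.inr h₆), ?_⟩
        rw [hpos w h₆]
        exact h₇
    · refine ⟨v, p, Function.update_self _ _ _, Function.update_self _ _ _, hvp, .inl hpR,
        fun w hw => ?_⟩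
      by_cases hwR : w ∈ R
      · exact .inl (hu w hwR hw)
      · refine .inr ⟨hnmem.2 (.inr hwR), ?_⟩
        rw [hpos w hwR]
        exact (H.pos w hwR).1

/-- If no vertex can be removed, then only one vertex remains. -/
theorem card_eq_one (H : Elim G k c R t A)
    (h : ∀ v ∈ R, ¬ (A.deg v = 1 ∧ 2 * A.cnt v ≤ k)) (hR : R.Nonempty) : R.card = 1 := by
  classical
  by_contra hcard
  have h₀ := Finset.card_pos.2 hR
  have hdeg : ∀ v ∈ R, 1 ≤ A.deg v := fun v hv => by
    obtain ⟨x, hx, y, hy, -, hxy⟩ := H.cut {v} (Finset.singleton_subset_iff.2 hv)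
      (Finset.singleton_nonempty v) (fun h => hcard (by rw [← h, Finset.card_singleton]))
    rw [Finset.mem_singleton] at hx
    subst hx
    rw [H.deg x hv]
    refine le_trans ?_ (Finset.single_le_sum (f := fun u => if G.Adj x u then 1 else 0)
      (fun _ _ => Nat.zero_le _) hy)
    rw [if_pos hxy]
  have huniq : ∀ u ∈ R, ∀ v ∈ R, A.deg u = 1 → A.deg v = 1 → u = v := by
    intro u hu v hv hdu hdv
    by_contra huv
    have h₁ := h u hu
    have h₂ := h v hv
    have h₃ := H.cnt_add_le hu hv huv
    omega
  -- With at most one leaf w, the degrees sum to at least 2|R| - 1, against 2|R| - 2 in a tree.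
  obtain ⟨w, hw, hrest⟩ : ∃ w ∈ R, ∀ v ∈ R.erase w, 2 ≤ A.deg v := by
    by_cases hex : ∃ w ∈ R, A.deg w = 1
    · obtain ⟨w, hw, hdw⟩ := hex
      refine ⟨w, hw, fun v hv => ?_⟩
      rw [Finset.mem_erase] at hv
      have h₁ := hdeg v hv.2
      have h₂ : A.deg v ≠ 1 := fun h => hv.1 (huniq v hv.2 w hw h hdw)
      omega
    · push Not at hex
      obtain ⟨w, hw⟩ := hR
      refine ⟨w, hw, fun v hv => ?_⟩
      have h₁ := hdeg v (Finset.mem_of_mem_erase hv)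
      have h₂ := hex v (Finset.mem_of_mem_erase hv)
      omega
  have h₁ := H.deg_sum
  have h₂ := Finset.card_nsmul_le_sum (R.erase w) (fun v => A.deg v) 2 hrest
  rw [← Finset.add_sum_erase R _ hw] at h₁
  rw [Finset.card_erase_of_mem hw, smul_eq_mul] at h₂
  have h₃ := hdeg w hw
  omega

/-- If only the vertex `r` remains, then the vertices can be labelled. -/
theorem labelling (H : Elim G k c {r} t A) {pos par : ℕ → ℕ}
    (hpos : ∀ i, pos i = if i = r then n - 1 else A.pos i)
    (hpar : ∀ i, i + 1 < n → par i = pos (A.parent i)) :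
    Labelling G (fun v => pos v) par ∧
      (∀ v : Fin n, (if pos v + 1 < n then A.ord (pos v) else r) = v) ∧
      ∀ i, i + 1 < n → A.wt i = acc par (fun i => c (if i + 1 < n then A.ord i else r)) i i ∧
        2 * A.wt i ≤ k := by
  have ht : t + 1 = n := by
    have := H.card
    rw [Finset.card_singleton] at this
    omega
  have hval : ∀ {u w : Fin n}, u ≠ w → (u : ℕ) ≠ w := fun h h' => h (Fin.ext h')
  have hr : pos r = n - 1 := by rw [hpos, if_pos rfl]
  have hne : ∀ v : Fin n, v ≠ r → pos v = A.pos v ∧ pos v + 1 < n ∧ A.ord (pos v) = v := by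
    intro v hv
    have h₁ : pos v = A.pos v := by rw [hpos, if_neg (hval hv)]
    obtain ⟨h₂, h₃⟩ := H.pos v (by simpa using hv)
    rw [h₁]
    exact ⟨rfl, by omega, h₃⟩
  have hord : ∀ v : Fin n, (if pos v + 1 < n then A.ord (pos v) else r) = v := by
    intro v
    by_cases hv : v = r
    · rw [hv, hr, if_neg (by omega)]
    · obtain ⟨-, h₁, h₂⟩ := hne v hv
      rw [if_pos h₁, h₂]
  have hinj : ∀ u v : Fin n, pos u = pos v → u = v := by
    intro u v huv
    by_cases hu : u = r <;> by_cases hv : v = r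
    · rw [hu, hv]
    · have := hne v hv
      rw [hu, hr] at huv
      omega
    · have := hne u hu
      rw [hv, hr] at huv
      omega
    · have h₁ := (hne u hu).2.2
      have h₂ := (hne v hv).2.2
      rw [huv, h₂] at h₁
      exact Fin.ext h₁.symm
  have hkey : ∀ i, i + 1 < n → ∃ v p : Fin n, A.ord i = v ∧ pos v = i ∧ A.parent i = p ∧
      par i = pos p ∧ G.Adj v p ∧ i < pos p ∧ ∀ w, G.Adj v w → w = p ∨ pos w < i := by
    intro i hi
    obtain ⟨v, p, h₁, h₂, h₃, h₄, h₅⟩ := H.parent i (by omega)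
    obtain ⟨v', hv', h₆, h₇⟩ := H.ord i (by omega)
    obtain rfl : v = v' := Fin.ext (h₁.symm.trans h₆)
    have hvr : v ≠ r := by simpa using hv'
    refine ⟨v, p, h₁, (hne v hvr).1.trans h₇, h₂, by rw [hpar i hi, h₂], h₃, ?_, fun w hw => ?_⟩
    · by_cases hpr : p = r
      · rw [hpr, hr]
        omega
      · rw [(hne p hpr).1]
        exact h₄.resolve_left (by simpa using hpr)
    · refine (h₅ w hw).imp_right fun h => ?_
      rw [(hne w (by simpa using h.1)).1]
      exact h.2
  have hlt : ∀ v : Fin n, pos v < n := fun v => by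
    by_cases hv : v = r
    · rw [hv, hr]
      omega
    · have := hne v hv
      omega
  -- All neighbours of u other than its recorded parent had been removed before u, so a neighbour
  -- with a larger label is that parent.
  have hdir : ∀ u v : Fin n, G.Adj u v → pos u < pos v → pos u + 1 < n ∧ pos v = par (pos u) := by
    intro u v huv h
    have h₁ := hlt v
    have hu : pos u + 1 < n := by omega
    obtain ⟨u', p, -, h₃, -, h₅, -, -, h₈⟩ := hkey (pos u) hu
    obtain rfl := hinj _ _ h₃
    rcases h₈ v huv with rfl | h₉
    · exact ⟨hu, h₅.symm⟩
    · omega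
  have hconv : ∀ u v : Fin n, pos u + 1 < n → pos v = par (pos u) → G.Adj u v := by
    intro u v hu huv
    obtain ⟨u', p, -, h₃, -, h₅, h₆, -, -⟩ := hkey (pos u) hu
    obtain rfl := hinj _ _ h₃
    obtain rfl := hinj _ _ (huv.trans h₅)
    exact h₆
  have hinc : IncPar n par := fun i hi => by
    obtain ⟨v, p, -, -, -, h₅, -, h₇, -⟩ := hkey i hi
    rw [h₅]
    exact ⟨h₇, hlt p⟩
  refine ⟨⟨hinc, hlt, fun u v h => hinj u v h, fun u v => ⟨fun h => ?_, ?_⟩⟩, hord, ?_⟩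
  · rcases lt_trichotomy (pos u) (pos v) with h' | h' | h'
    · exact .inl (hdir u v h h')
    · exact absurd (hinj u v h') h.ne
    · exact .inr (hdir v u h.symm h')
  · rintro (⟨h₁, h₂⟩ | ⟨h₁, h₂⟩)
    · exact hconv u v h₁ h₂
    · exact (hconv v u h₁ h₂).symm
  · intro i hi
    refine ⟨?_, H.wt_le i (by omega)⟩
    induction i using Nat.strong_induction_on with
    | _ i ih =>
      rw [H.wt i (by omega), acc_eq_childSum, if_pos hi, childSum]
      congr 1
      refine Finset.sum_congr rfl fun l hl => ?_
      rw [Finset.mem_range] at hl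
      rw [ih l hl (by omega)]
      obtain ⟨v, -, h₁, h₂, -⟩ := hkey i hi
      obtain ⟨-, p, -, -, h₃, h₄, -⟩ := hkey l (by omega)
      have : A.parent l = A.ord i ↔ par l = i := by
        rw [h₁, h₃, h₄]
        constructor
        · intro h
          rw [Fin.ext h, h₂]
        · intro h
          rw [hinj p v (h.trans h₂.symm)]
      simp only [this]

end Elim

end PebbleMotion

/-! ### The program -/

namespace ConSum
open WordRAM PebbleMotion

local infixr:30 " ;; " => WordRAM.Prog.seq

/-- Numbers of vertices `n` and of pebbles `k`, the address `b` of the first array, and a bound `Z`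
for all indices, which is small compared to the number `W` of words. -/
structure Sizes (W n k b Z : ℕ) : Prop where
  n_pos : 1 ≤ n
  k_pos : 1 ≤ k
  b_eq : b = 2 * n + k
  add_le : n + k ≤ Z
  mul_le : n * (n + k) ≤ Z
  idx_le : n * (k + 1) ≤ Z
  four_le : 4 ≤ Z
  word : 256 * Z ≤ W

/-- The registers `0, …, 3` hold `b`, `n`, `k` and `k + 1`, the memory cells are at most `B` and
those below `b` contain the input. -/
structure Ctx (I : ℕ → ℕ) (n k b B : ℕ) (s : State) : Prop where
  r0 : s.reg 0 = b
  r1 : s.reg 1 = n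
  r2 : s.reg 2 = k
  r3 : s.reg 3 = k + 1
  mem_le : ∀ x, s.mem x ≤ B
  input : ∀ x < b, s.mem x = I x

section Ctx
variable {I : ℕ → ℕ} {n k b B : ℕ} {s : State}

theorem Ctx.setReg (h : Ctx I n k b B s) {r v : ℕ} (hr : 4 ≤ r) :
    Ctx I n k b B (s.setReg r v) := by
  obtain ⟨h0, h1, h2, h3, h4, h5⟩ := h
  refine ⟨?_, ?_, ?_, ?_, h4, h5⟩ <;> rw [reg_setReg, if_neg (by omega)] <;> assumption

theorem Ctx.setArr (h : Ctx I n k b B s) {a i v : ℕ} (hv : v ≤ B) :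
    Ctx I n k b B (s.setArr b a i v) :=
  ⟨h.r0, h.r1, h.r2, h.r3, mem_setArr_le h.mem_le hv, fun x hx => by
    rw [mem_setArr_of_lt hx, h.input x hx]⟩

theorem Ctx.mono (h : Ctx I n k b B s) {B' : ℕ} (hB : B ≤ B') : Ctx I n k b B' s :=
  ⟨h.r0, h.r1, h.r2, h.r3, fun x => (h.mem_le x).trans hB, h.input⟩

theorem Ctx.arr_le (h : Ctx I n k b B s) (a i : ℕ) : s.arr b a i ≤ B := h.mem_le _

end Ctx

/-! ### Reading the input -/

/-- Reads the numbers of vertices and pebbles. -/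
def readSizes : Prog :=
  .assign 1 (.load 0) ;;
  .assign 2 (.load 1) ;;
  .assign 0 (2 * .reg 1 + .reg 2) ;;
  .assign 3 (.reg 2 + 1)

/-- The treatment of an edge. -/
def readEdge : Prog :=
  .assign 4 (.reg 4 - 1) ;;
  .assign 5 (.load (2 * .reg 4 + 2)) ;;
  .assign 6 (.load (2 * .reg 4 + 3)) ;;
  .put 1 (.reg 5) (.get 1 (.reg 5) + 1) ;;
  .put 1 (.reg 6) (.get 1 (.reg 6) + 1) ;;
  .put 2 (.reg 5) (.get 2 (.reg 5) + .reg 6) ;;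
  .put 2 (.reg 6) (.get 2 (.reg 6) + .reg 5)

/-- Computes the degrees in the array `1` and the sums of the neighbours in the array `2`. -/
def readEdges : Prog :=
  .assign 4 (.reg 1 - 1) ;;
  .loop (.reg 4) readEdge

theorem flatMap_getD {n : ℕ} (E : List (Fin n × Fin n)) (L : List ℕ) :
    (∀ i (hi : i < E.length),
      ((E.flatMap fun e => [(e.1 : ℕ), (e.2 : ℕ)]) ++ L).getD (2 * i) 0 = E[i].1 ∧
      ((E.flatMap fun e => [(e.1 : ℕ), (e.2 : ℕ)]) ++ L).getD (2 * i + 1) 0 = E[i].2) ∧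
    ∀ p, ((E.flatMap fun e => [(e.1 : ℕ), (e.2 : ℕ)]) ++ L).getD (2 * E.length + p) 0 =
      L.getD p 0 := by
  induction E with
  | nil => simp
  | cons e E ih =>
    refine ⟨fun i hi => ?_, fun p => ?_⟩
    · cases i with
      | zero => simp
      | succ i => simpa [mul_add] using ih.1 i (by simpa using hi)
    · have : 2 * (E.length + 1) + p = (2 * E.length + p) + 2 := by ring
      rw [List.length_cons, this]
      simpa using ih.2 p

theorem encode_getD {n k : ℕ} (E : List (Fin n × Fin n)) (σ : Fin k → Fin n)
    (hE : E.length + 1 = n) :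
    (∀ i (hi : i < E.length), (encode E σ).getD (2 * i + 2) 0 = E[i].1 ∧
      (encode E σ).getD (2 * i + 3) 0 = E[i].2) ∧
    ∀ p : Fin k, (encode E σ).getD (2 * n + p) 0 = σ p := by
  obtain ⟨h₁, h₂⟩ := flatMap_getD E (List.ofFn fun p => (σ p : ℕ))
  refine ⟨fun i hi => by simpa [encode] using h₁ i hi, fun p => ?_⟩
  have h₃ := h₂ p
  have : 2 * n + (p : ℕ) = (2 * E.length + p) + 2 := by omega
  rw [this]
  simpa [encode] using h₃

theorem encode_le {n k : ℕ} (E : List (Fin n × Fin n)) (σ : Fin k → Fin n) (x : ℕ) :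
    (encode E σ).getD x 0 ≤ n + k := by
  by_cases hx : x < (encode E σ).length
  · rw [List.getD_eq_getElem _ _ hx]
    have h := List.getElem_mem hx
    generalize (encode E σ)[x] = y at h
    simp only [encode, List.mem_cons, List.mem_append, List.mem_flatMap, List.mem_ofFn,
      List.not_mem_nil, or_false] at h
    rcases h with rfl | rfl | ⟨e, -, rfl | rfl⟩ | ⟨p, rfl⟩ <;> omega
  · rw [List.getD_eq_default _ _ (by omega)]
    omega

/-- The state after the edges from `m` on have been treated. -/
structure EdgesRead {n k : ℕ} (E : List (Fin n × Fin n)) (σ : Fin k → Fin n) (b m : ℕ)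
    (s : State) : Prop where
  ctx : Ctx (fun x => (encode E σ).getD x 0) n k b ((n - m) * (n + k)) s
  r4 : s.reg 4 = m
  m_lt : m < n
  deg : ∀ v, s.arr b 1 v = edgeSum (fun _ => 1) (E.drop m) v
  nbr : ∀ v, s.arr b 2 v = edgeSum (fun u => u) (E.drop m) v
  zero : ∀ a < 16, 3 ≤ a → ∀ i, s.arr b a i = 0

section Phases
variable {W n k b Z : ℕ} (hZ : Sizes W n k b Z) {E : List (Fin n × Fin n)} {σ : Fin k → Fin n}
include hZ

/-- Edges are read from the last to the first, so the treated ones form `E.drop m`. The endpoints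
differ, so no entry grows by more than n per edge; this keeps the memory bound (n - m)(n + k) valid.
-/
theorem run_readEdge (hE : E.length + 1 = n) (hd : ∀ e ∈ E, e.1 ≠ e.2) {m : ℕ} {s : State}
    (h : EdgesRead E σ b (m + 1) s) : Run W readEdge s readEdge.cost (EdgesRead E σ b m) := by
  obtain ⟨hc, h4, hmn, hdeg, hnbr, hz⟩ := h
  have hw := hZ.word
  have hml := hZ.mul_le
  have hb := hZ.b_eq
  have hal := hZ.add_le
  have h4Z := hZ.four_le
  have h0 := hc.r0
  have hmE : m < E.length := by omega
  obtain ⟨hin₁, hin₂⟩ := (encode_getD E σ hE).1 m hmE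
  have h5 := hc.input (2 * m + 2) (by omega)
  have h6 := hc.input (2 * m + 3) (by omega)
  simp only [hin₁, hin₂] at h5 h6
  have hne : (E[m].2 : ℕ) ≠ E[m].1 := fun h => hd _ (List.getElem_mem hmE) (Fin.ext h.symm)
  have hdrop : ∀ w x, edgeSum w (E.drop m) x = _ := fun w x => by
    rw [List.drop_eq_getElem_cons hmE, edgeSum_cons]
  have hlt₁ := E[m].1.isLt
  have hlt₂ := E[m].2.isLt
  generalize (E[m].1 : ℕ) = u at *
  generalize (E[m].2 : ℕ) = v at *
  have hB : (n - m) * (n + k) = (n - (m + 1)) * (n + k) + (n + k) := by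
    rw [show n - m = n - (m + 1) + 1 by omega, add_mul, one_mul]
  have hB' : (n - m) * (n + k) ≤ n * (n + k) := Nat.mul_le_mul_right _ (Nat.sub_le _ _)
  have hle := hc.arr_le
  have hu₁ := hle 1 u
  have hv₁ := hle 1 v
  have hu₂ := hle 2 u
  have hv₂ := hle 2 v
  refine Run.of_wp ?_
  simp only [readEdge]
  simp [h0, h4, h5, h6, hne]
  (repeat' apply And.intro) <;> try omega
  constructor
  · repeat' first | apply Ctx.setArr | apply Ctx.setReg
    · exact hc.mono (by omega)
    all_goals omega
  · simp
  · omega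
  · intro x
    by_cases hxu : x = u
    · simp [hdrop, hdeg, hxu, Ne.symm hne, add_comm]
    · by_cases hxv : x = v <;> simp [hdrop, hdeg, hxu, hxv, hne, add_comm]
  · intro x
    by_cases hxu : x = u
    · simp [hdrop, hnbr, hxu, Ne.symm hne, add_comm]
    · by_cases hxv : x = v <;> simp [hdrop, hnbr, hxu, hxv, hne, add_comm]
  · intro a ha ha' i
    simp [ha, hz a ha ha', show a ≠ 1 by omega, show a ≠ 2 by omega]

end Phases

section Phases
variable {W n k b Z : ℕ} (hZ : Sizes W n k b Z) {E : List (Fin n × Fin n)} {σ : Fin k → Fin n}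
include hZ

omit hZ in
theorem encode_length (hE : E.length + 1 = n) : (encode E σ).length = 2 * n + k := by
  have : ∀ E : List (Fin n × Fin n),
      (E.flatMap fun e => [(e.1 : ℕ), (e.2 : ℕ)]).length = 2 * E.length := fun E => by
    induction E with
    | nil => rfl
    | cons e E ih => simp [ih, mul_add]
  simp only [encode, List.length_cons, List.length_append, this, List.length_ofFn]
  omega

theorem run_readEdges (hE : E.length + 1 = n) (hd : ∀ e ∈ E, e.1 ≠ e.2) :
    Run W (readSizes ;; readEdges) (State.init (encode E σ)) (200 * n)
      (EdgesRead E σ b 0) := by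
  have hw := hZ.word
  have hml := hZ.mul_le
  have hb := hZ.b_eq
  have hal := hZ.add_le
  have h4Z := hZ.four_le
  have hn := hZ.n_pos
  have hlen := encode_length (σ := σ) hE
  have h₀ : (State.init (encode E σ)).mem 0 = n := rfl
  have h₁ : (State.init (encode E σ)).mem 1 = k := rfl
  refine (Run.seq (T₁ := readSizes.cost) (T₂ := 5 + ((n - 1) * (2 + readEdge.cost) + 2))
    (P := fun s => s.mem = (State.init (encode E σ)).mem ∧ s.reg 0 = b ∧ s.reg 1 = n ∧
      s.reg 2 = k ∧ s.reg 3 = k + 1) ?_ fun s hs => ?_).mono ?_ fun _ h => h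
  · refine Run.of_wp ?_
    simp only [readSizes]
    simp [h₀, h₁]
    (repeat' apply And.intro) <;> omega
  · obtain ⟨hs, h0, h1, h2, h3⟩ := hs
    refine Run.seq (T₁ := 5) (P := EdgesRead E σ b (n - 1)) ?_ fun s' h' => ?_
    · refine (Run.of_wp (Q := EdgesRead E σ b (n - 1)) ?_).mono (by decide) fun _ h => h
      simp [h1]
      refine ⟨by omega, ⟨Ctx.setReg ⟨h0, h1, h2, h3, fun x => ?_, fun x hx => ?_⟩ le_rfl, ?_, ?_,
        fun v => ?_, fun v => ?_, fun a ha ha' i => ?_⟩⟩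
      · rw [hs, show n - (n - 1) = 1 by omega, one_mul]
        exact encode_le E σ x
      · rw [hs]
        rfl
      · simp
      · omega
      all_goals
        rw [arr_setReg, State.arr, hs]
        simp only [State.init]
        rw [List.getD_eq_default _ _ (by omega)]
      · simp [show n - 1 = E.length by omega, edgeSum]
      · simp [show n - 1 = E.length by omega, edgeSum]
    · refine Run.countdown (I := EdgesRead E σ b) (fun m s h => ⟨h.r4, ?_⟩)
        (fun m s h => run_readEdge hZ hE hd h) h'
      have := h.m_lt
      omega
  · have h₁ : readSizes.cost ≤ 30 := by decide
    have h₂ : (n - 1) * (2 + readEdge.cost) ≤ (n - 1) * 100 :=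
      Nat.mul_le_mul_left _ (by decide)
    omega

/-- The treatment of a start vertex. -/
def readPebble : Prog :=
  .assign 4 (.reg 4 - 1) ;;
  .assign 5 (.load (2 * .reg 1 + .reg 4)) ;;
  .put 3 (.reg 5) (.get 3 (.reg 5) + 1)

/-- Computes the numbers of pebbles at the vertices in the array `3`. -/
def readPebbles : Prog :=
  .assign 4 (.reg 2) ;;
  .loop (.reg 4) readPebble

/-- The number of pebbles from `m` on that start at `v`. -/
def startSum (σ : Fin k → Fin n) (m v : ℕ) : ℕ :=
  ∑ p : Fin k, if m ≤ p ∧ v = σ p then 1 else 0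

-- Splits off the pebble m from those numbered at least m; also used when moved pebbles are counted.
omit hZ in
theorem sum_from_eq {m : ℕ} (hm : m < k) (P : Fin k → Prop) [DecidablePred P] :
    (∑ p : Fin k, if m ≤ p ∧ P p then 1 else 0) =
      (∑ p : Fin k, if m + 1 ≤ p ∧ P p then 1 else 0) + if P ⟨m, hm⟩ then 1 else 0 := by
  have : (if P ⟨m, hm⟩ then 1 else 0) =
      ∑ p : Fin k, if p = ⟨m, hm⟩ then (if P p then 1 else 0) else 0 := by
    rw [Finset.sum_ite_eq', if_pos (Finset.mem_univ _)]
  rw [this, ← Finset.sum_add_distrib]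
  refine Finset.sum_congr rfl fun p _ => ?_
  by_cases hp : p = ⟨m, hm⟩
  · simp [hp]
  · have hpm : (p : ℕ) ≠ m := fun h => hp (Fin.ext h)
    simp only [hp, if_false, add_zero, show m ≤ p ↔ m + 1 ≤ p by omega]

omit hZ in
theorem startSum_le (m v : ℕ) : startSum σ m v ≤ k := by
  calc startSum σ m v ≤ ∑ _p : Fin k, 1 := Finset.sum_le_sum fun p _ => by split <;> omega
    _ = k := by simp

/-- The state after the pebbles from `m` on have been treated. -/
structure PebblesRead {n k : ℕ} (E : List (Fin n × Fin n)) (σ : Fin k → Fin n) (b Z m : ℕ)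
    (s : State) : Prop where
  ctx : Ctx (fun x => (encode E σ).getD x 0) n k b Z s
  r4 : s.reg 4 = m
  m_le : m ≤ k
  deg : ∀ v, s.arr b 1 v = edgeSum (fun _ => 1) E v
  nbr : ∀ v, s.arr b 2 v = edgeSum (fun u => u) E v
  cnt : ∀ v, s.arr b 3 v = startSum σ m v
  zero : ∀ a < 16, 4 ≤ a → ∀ i, s.arr b a i = 0

theorem run_readPebble (hE : E.length + 1 = n) {m : ℕ} {s : State}
    (h : PebblesRead E σ b Z (m + 1) s) :
    Run W readPebble s readPebble.cost (PebblesRead E σ b Z m) := by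
  obtain ⟨hc, h4, hmn, hdeg, hnbr, hcnt, hz⟩ := h
  have hw := hZ.word
  have hb := hZ.b_eq
  have hal := hZ.add_le
  have h4Z := hZ.four_le
  have h0 := hc.r0
  have h1 := hc.r1
  have hk : m < k := by omega
  have hin := (encode_getD E σ hE).2 ⟨m, hk⟩
  have h5 := hc.input (2 * n + m) (by omega)
  simp only [hin] at h5
  have hlt := (σ ⟨m, hk⟩).isLt
  have hsum : ∀ v, startSum σ m v = startSum σ (m + 1) v + if v = σ ⟨m, hk⟩ then 1 else 0 :=
    fun v => sum_from_eq hk fun p => v = σ p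
  generalize (σ ⟨m, hk⟩ : ℕ) = u at *
  have hu := hsum u
  have hu' := startSum_le (σ := σ) m u
  rw [if_pos rfl] at hu
  refine Run.of_wp ?_
  simp only [readPebble]
  simp [h0, h1, h4, h5, hcnt]
  (repeat' apply And.intro) <;> try omega
  constructor
  · repeat' first | apply Ctx.setArr | apply Ctx.setReg
    · exact hc
    all_goals omega
  · simp
  · omega
  · intro x
    simp [hdeg]
  · intro x
    simp [hnbr]
  · intro x
    by_cases hxu : x = u <;> simp [hsum, hcnt, hxu]
  · intro a ha ha' i
    simp [ha, hz a ha ha', show a ≠ 3 by omega]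

theorem run_readPebbles (hE : E.length + 1 = n) {s : State} (h : EdgesRead E σ b 0 s) :
    Run W readPebbles s (60 * k) (PebblesRead E σ b Z 0) := by
  have hw := hZ.word
  have hal := hZ.add_le
  have hml := hZ.mul_le
  have h4Z := hZ.four_le
  have hk := hZ.k_pos
  have h2 := h.ctx.r2
  refine (Run.seq (T₁ := 2) (T₂ := k * (2 + readPebble.cost) + 2)
    (P := PebblesRead E σ b Z k) ?_ fun s' h' => ?_).mono ?_ fun _ h => h
  · refine (Run.of_wp (Q := PebblesRead E σ b Z k) ?_).mono (by decide) fun _ h => h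
    simp [h2]
    refine ⟨by omega, ⟨(h.ctx.mono ?_).setReg le_rfl, ?_, le_rfl, ?_, ?_, fun v => ?_,
      fun a ha ha' i => ?_⟩⟩
    · simpa using hml
    · simp
    · simpa using h.deg
    · simpa using h.nbr
    · rw [arr_setReg, h.zero 3 (by omega) le_rfl, startSum, eq_comm, Finset.sum_eq_zero]
      intro p _
      rw [if_neg (by omega)]
    · rw [arr_setReg, h.zero a ha (by omega)]
  · refine Run.countdown (I := PebblesRead E σ b Z) (fun m s h => ⟨h.r4, ?_⟩)
      (fun m s h => run_readPebble hZ hE h) h'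
    have := h.m_le
    omega
  · have h₂ : k * (2 + readPebble.cost) ≤ k * 50 := Nat.mul_le_mul_left _ (by decide)
    omega

end Phases

/-! ### Running the elimination of the leaves -/

/-- The contents of the arrays for the elimination. -/
def arrays (b : ℕ) (s : State) : ElimArrays where
  deg := s.arr b 1
  nbr := s.arr b 2
  cnt := s.arr b 3
  ord := s.arr b 4
  parent := s.arr b 5
  pos := s.arr b 6
  wt := s.arr b 7

/-- A step of the elimination of the leaves: remove the vertex in the register `5` and proceed with
its neighbour, if possible, and proceed with the next vertex otherwise. -/
def eliminateStep : Prog :=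
  .ite (.bin .eq (.get 1 (.reg 5)) 1 * .bin .lt (2 * .get 3 (.reg 5)) (.reg 3))
    (.assign 7 (.get 2 (.reg 5)) ;;
      .put 6 (.reg 5) (.reg 6) ;;
      .put 4 (.reg 6) (.reg 5) ;;
      .put 5 (.reg 6) (.reg 7) ;;
      .put 7 (.reg 6) (.get 3 (.reg 5)) ;;
      .put 1 (.reg 5) 0 ;;
      .put 1 (.reg 7) (.get 1 (.reg 7) - 1) ;;
      .put 2 (.reg 7) (.get 2 (.reg 7) - .reg 5) ;;
      .put 3 (.reg 7) (.get 3 (.reg 7) + .get 3 (.reg 5)) ;;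
      .assign 6 (.reg 6 + 1) ;;
      .assign 5 (.reg 7))
    (.assign 4 (.reg 4 + 1) ;;
      .assign 5 (.reg 4))

/-- The elimination of the leaves. -/
def eliminate : Prog :=
  .assign 4 0 ;;
  .assign 5 0 ;;
  .assign 6 0 ;;
  .assign 7 0 ;;
  .loop (.bin .lt (.reg 4) (.reg 1)) eliminateStep

/-- A state of the elimination in which all vertices below `i` have been treated, except that `v`
may be smaller. -/
structure Eliminating {n k : ℕ} (G : SimpleGraph (Fin n)) (E : List (Fin n × Fin n))
    (σ : Fin k → Fin n) (b Z : ℕ) (R : Finset (Fin n)) (t i v : ℕ) (s : State) : Prop where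
  ctx : Ctx (fun x => (encode E σ).getD x 0) n k b Z s
  r4 : s.reg 4 = i
  r5 : s.reg 5 = v
  r6 : s.reg 6 = t
  elim : Elim G k (fun u => startSum σ 0 u) R t (arrays b s)
  root : ∃ r ∈ R, s.reg 7 = (r : Fin n)
  i_le : i ≤ n
  v_lt : i < n → v < n
  v_eq : i = n → v = n
  fresh : v = i ∨ ∀ u ∈ R, (u : ℕ) ≠ i
  done : ∀ u ∈ R, (u : ℕ) < i → (u : ℕ) ≠ v → ¬ (s.arr b 1 u = 1 ∧ 2 * s.arr b 3 u ≤ k)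
  zero : ∀ a < 16, 8 ≤ a → ∀ j, s.arr b a j = 0

section Phases
variable {W n k b Z : ℕ} (hZ : Sizes W n k b Z) {E : List (Fin n × Fin n)} {σ : Fin k → Fin n}
  {G : SimpleGraph (Fin n)}
include hZ

/-- Among the remaining vertices only the neighbour p changes its degree and weight, so only p can
become removable. Making p the next current vertex thus preserves the statement about finished
vertices, even if the scan has already passed p. -/
theorem run_eliminateStep_of_leaf {R : Finset (Fin n)} {t i v : ℕ} {s : State}
    (h : Eliminating G E σ b Z R t i v s) (hi : i < n)
    (hcond : s.arr b 1 v = 1 ∧ 2 * s.arr b 3 v ≤ k) :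
    ∃ R' t' v', R'.card + 1 = R.card ∧
      Run W eliminateStep s eliminateStep.cost (Eliminating G E σ b Z R' t' i v') := by
  obtain ⟨hc, h4, h5, h6, H, hr, hin, hv, hv', hf, hd, hz⟩ := h
  have hw := hZ.word
  have hb := hZ.b_eq
  have hal := hZ.add_le
  have h4Z := hZ.four_le
  have h0 := hc.r0
  have h3 := hc.r3
  have hvn := hv hi
  obtain ⟨hdeg, hcnt⟩ := hcond
  obtain ⟨hvR, p, hp, hnbr, hvp, hu⟩ := H.exists_parent (v := ⟨v, hvn⟩) hdeg
  replace hnbr : s.arr b 2 v = p := hnbr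
  have hpk := H.cnt_add_le hp hvR hvp.ne'
  simp only [arrays] at hpk
  have hne : (p : ℕ) ≠ v := fun h => hvp.ne' (Fin.ext h)
  have hpn := p.isLt
  have ht := H.lt_of_mem hvR
  have hp₁ := hc.arr_le 1 p
  have hp₂ := hc.arr_le 2 p
  have H' := H.remove hvR hcnt hp hvp hu
  refine ⟨R.erase ⟨v, hvn⟩, t + 1, p, Finset.card_erase_add_one hvR, Run.of_wp ?_⟩
  rw [eliminateStep]
  refine wp_ite_pos ?_ ?_
  · simp [h0, h3, h5, hdeg, hcnt]
    omega
  simp [h0, h5, h6, hnbr, hne]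
  (repeat' apply And.intro) <;> try omega
  constructor
  · repeat' first | apply Ctx.setArr | apply Ctx.setReg
    · exact hc
    all_goals omega
  · simp [h4]
  · simp
  · simp
  · convert H' using 1
    simp only [arrays, ElimArrays.remove]
    congr 1 <;> funext x <;> simp [Function.update_apply]
  · exact ⟨p, Finset.mem_erase.2 ⟨hvp.ne', hp⟩, by simp⟩
  · exact hin
  · exact fun _ => hpn
  · exact fun h => absurd h hi.ne
  -- Either the removed vertex is i, or i had been removed earlier; so the scan may go on to i + 1
  -- once the chain of removals ends.
  · right
    intro u hu'
    rw [Finset.mem_erase, ne_eq, Fin.ext_iff] at hu'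
    rcases hf with rfl | hf
    · exact hu'.1
    · exact hf u hu'.2
  · intro u hu' hui hup
    rw [Finset.mem_erase, ne_eq, Fin.ext_iff] at hu'
    dsimp only at hu'
    simpa [hup, hu'.1] using hd u hu'.2 hui hu'.1
  · intro a ha ha' j
    simp [ha, hz a ha ha', show a ≠ 1 by omega, show a ≠ 2 by omega, show a ≠ 3 by omega,
      show a ≠ 4 by omega, show a ≠ 5 by omega, show a ≠ 6 by omega, show a ≠ 7 by omega]

theorem run_eliminateStep_of_not_leaf {R : Finset (Fin n)} {t i v : ℕ} {s : State}
    (h : Eliminating G E σ b Z R t i v s) (hi : i < n)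
    (hcond : ¬ (s.arr b 1 v = 1 ∧ 2 * s.arr b 3 v ≤ k)) :
    Run W eliminateStep s eliminateStep.cost (Eliminating G E σ b Z R t (i + 1) (i + 1)) := by
  obtain ⟨hc, h4, h5, h6, H, hr, hin, hv, hv', hf, hd, hz⟩ := h
  have hw := hZ.word
  have hb := hZ.b_eq
  have hal := hZ.add_le
  have h4Z := hZ.four_le
  have h0 := hc.r0
  have h3 := hc.r3
  have hvn := hv hi
  have hv₁ := hc.arr_le 1 v
  have hv₃ := hc.arr_le 3 v
  refine Run.of_wp ?_
  rw [eliminateStep]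
  refine wp_ite_neg ?_ ?_
  · simp [h0, h3, h5]
    (repeat' apply And.intro) <;> try (first | omega | (split_ifs <;> omega))
  simp [h4]
  (repeat' apply And.intro) <;> try omega
  constructor
  · exact (hc.setReg (by omega)).setReg (by omega)
  · simp
  · simp
  · simpa using h6
  · exact H
  · simpa using hr
  · exact hi
  · exact fun h => h
  · exact fun h => h
  · exact .inl rfl
  · intro u hu hui _
    simp only [arr_setReg]
    by_cases huv : (u : ℕ) = v
    · rw [huv]
      exact hcond
    · refine hd u hu ?_ huv
      rcases hf with rfl | hf
      · omega
      · have := hf u hu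
        omega
  · exact hz

/-- The state after the elimination, when only the vertex `r` remains. -/
structure Eliminated {n k : ℕ} (G : SimpleGraph (Fin n)) (E : List (Fin n × Fin n))
    (σ : Fin k → Fin n) (b Z : ℕ) (r : Fin n) (t : ℕ) (s : State) : Prop where
  ctx : Ctx (fun x => (encode E σ).getD x 0) n k b Z s
  elim : Elim G k (fun u => startSum σ 0 u) {r} t (arrays b s)
  r7 : s.reg 7 = r
  zero : ∀ a < 16, 8 ≤ a → ∀ j, s.arr b a j = 0

theorem run_eliminate (hG : G.IsTree) (hE : IsEdgeList G E) {s : State}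
    (h : PebblesRead E σ b Z 0 s) :
    Run W eliminate s (700 * n) fun s' => ∃ r t, Eliminated G E σ b Z r t s' := by
  classical
  have hw := hZ.word
  have h4Z := hZ.four_le
  have hal := hZ.add_le
  have hn := hZ.n_pos
  have hinit : ((((s.setReg 4 0).setReg 5 0).setReg 6 0).setReg 7 0).arr = s.arr := rfl
  have key : Eliminating G E σ b Z Finset.univ 0 0 0
      ((((s.setReg 4 0).setReg 5 0).setReg 6 0).setReg 7 0) := by
    constructor
    · repeat' apply Ctx.setReg
      · exact h.ctx
      all_goals omega
    · simp
    · simp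
    · simp
    · refine Elim.init hG (fun v => ?_) (fun v => ?_) (fun v => ?_) ?_
      · simp only [arrays, hinit, h.deg, hE.edgeSum_eq]
      · simp only [arrays, hinit, h.nbr, hE.edgeSum_eq]
      · simp only [arrays, hinit, h.cnt]
      · simp only [startSum]
        rw [Finset.sum_comm]
        simp [Fin.val_inj]
    · exact ⟨⟨0, hn⟩, Finset.mem_univ _, by simp⟩
    · omega
    · exact fun h => h
    · exact fun h => h
    · exact .inl rfl
    · exact fun u _ hu => absurd hu (Nat.not_lt_zero _)
    · exact fun a ha ha' j => h.zero a ha (by omega) j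
  -- Each step either advances the scan or removes a vertex, so (n - i) + |R| bounds the remaining
  -- iterations; initially it is 2n.
  have hloop := Run.loop (W := W) (e := .bin .lt (.reg 4) (.reg 1)) (p := eliminateStep)
    (T := eliminateStep.cost)
    (I := fun m s => ∃ R t i v, m = (n - i) + R.card ∧ Eliminating G E σ b Z R t i v s)
    (Q := fun s' => ∃ r t, Eliminated G E σ b Z r t s') (m := 2 * n) ?_
    ⟨_, _, _, _, by simp; ring, key⟩
  · rw [eliminate]
    refine (Run.assign_seq ?_ <| Run.assign_seq ?_ <| Run.assign_seq ?_ <| Run.assign_seq ?_ <|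
      hloop).mono ?_ fun _ h => h
    iterate 4
      · simp
        omega
    have h₂ : 2 * n * (1 + 1 + 1 + 1 + eliminateStep.cost) ≤ 2 * n * 300 :=
      Nat.mul_le_mul_left _ (by decide)
    simp only [Expr.cost]
    omega
  · rintro m s ⟨R, t, i, v, rfl, h⟩
    have h1 := h.ctx.r1
    have h4 := h.r4
    have hin := h.i_le
    refine ⟨?_, fun hv => ?_, fun hv => ?_⟩
    · simp [h1, h4]
      refine ⟨by omega, by omega, ?_⟩
      split_ifs <;> omega
    · simp [h1, h4] at hv
      obtain rfl : i = n := by omega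
      obtain ⟨r, hr, h7⟩ := h.root
      have hcard := h.elim.card_eq_one (fun u hu => h.done u hu u.isLt (by
        have := h.v_eq rfl
        omega)) ⟨r, hr⟩
      obtain ⟨r', rfl⟩ := Finset.card_eq_one.1 hcard
      obtain rfl := Finset.mem_singleton.1 hr
      exact ⟨r, t, h.ctx, h.elim, h7, h.zero⟩
    · simp [h1, h4] at hv
      by_cases hcond : s.arr b 1 v = 1 ∧ 2 * s.arr b 3 v ≤ k
      · obtain ⟨R', t', v', hR', hrun⟩ := run_eliminateStep_of_leaf hZ h hv hcond
        exact ⟨(n - i) + R'.card, by omega, hrun.mono le_rfl fun s' h' =>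
          ⟨_, _, _, _, rfl, h'⟩⟩
      · exact ⟨(n - (i + 1)) + R.card, by omega,
          (run_eliminateStep_of_not_leaf hZ h hv hcond).mono le_rfl fun s' h' =>
            ⟨_, _, _, _, rfl, h'⟩⟩

end Phases

/-! ### Passing from vertices to labels -/

/-- Computes the parent of a label. -/
def labelParent : Prog :=
  .assign 4 (.reg 4 - 1) ;;
  .put 8 (.reg 4) (.get 6 (.get 5 (.reg 4)))

/-- Computes the label of a start vertex. -/
def labelPebble : Prog :=
  .assign 4 (.reg 4 - 1) ;;
  .put 13 (.reg 4) (.get 6 (.load (2 * .reg 1 + .reg 4)))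

/-- Gives the last label to the remaining vertex. -/
def labelRoot : Prog :=
  .put 4 (.reg 1 - 1) (.reg 7) ;;
  .put 6 (.reg 7) (.reg 1 - 1)

/-- Computes the parents and the start vertices in terms of labels. -/
def relabel : Prog :=
  labelRoot ;;
  .assign 4 (.reg 1 - 1) ;;
  .seq (.loop (.reg 4) labelParent) (
  .assign 4 (.reg 2) ;;
  .loop (.reg 4) labelPebble)

/-- The parents of the labels from `m` on and the labels of the pebbles from `l` on are known. -/
structure Relabelling {n k : ℕ} (E : List (Fin n × Fin n)) (σ : Fin k → Fin n) (b Z : ℕ)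
    (A : ElimArrays) (m l : ℕ) (s : State) : Prop where
  ctx : Ctx (fun x => (encode E σ).getD x 0) n k b Z s
  ord : ∀ j, s.arr b 4 j = A.ord j
  parent : ∀ j, s.arr b 5 j = A.parent j
  pos : ∀ j, s.arr b 6 j = A.pos j
  wt : ∀ j, s.arr b 7 j = A.wt j
  m_lt : m < n
  l_le : l ≤ k
  par : ∀ i, m ≤ i → i + 1 < n → s.arr b 8 i = A.pos (A.parent i)
  cur : ∀ p : Fin k, l ≤ p → s.arr b 13 p = A.pos (σ p)
  zero : ∀ a < 13, 9 ≤ a → ∀ j, s.arr b a j = 0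

/-- The data that do not change after the labelling. -/
structure Labelled (I : ℕ → ℕ) (n k b Z : ℕ) (par S ord : ℕ → ℕ) (s : State) : Prop where
  ctx : Ctx I n k b Z s
  ord : ∀ i, i < n → s.arr b 4 i = ord i
  wt : ∀ i, i + 1 < n → s.arr b 7 i = S i
  par : ∀ i, i + 1 < n → s.arr b 8 i = par i

theorem Relabelling.setReg {n k : ℕ} {E : List (Fin n × Fin n)} {σ : Fin k → Fin n} {b Z : ℕ}
    {A : ElimArrays} {m l : ℕ} {s : State} (h : Relabelling E σ b Z A m l s) {r v : ℕ}
    (hr : 4 ≤ r) : Relabelling E σ b Z A m l (s.setReg r v) :=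
  ⟨h.ctx.setReg hr, h.ord, h.parent, h.pos, h.wt, h.m_lt, h.l_le, h.par, h.cur, h.zero⟩

section Phases
variable {W n k b Z : ℕ} (hZ : Sizes W n k b Z) {E : List (Fin n × Fin n)} {σ : Fin k → Fin n}
  {G : SimpleGraph (Fin n)}
include hZ

theorem run_labelParent {A : ElimArrays} {m l : ℕ} {s : State}
    (h : Relabelling E σ b Z A (m + 1) l s) (h4 : s.reg 4 = m + 1) :
    Run W labelParent s labelParent.cost fun s' =>
      Relabelling E σ b Z A m l s' ∧ s'.reg 4 = m := by
  obtain ⟨hc, hord, hparent, hpos, hwt, hm, hl, hpar, hcur, hz⟩ := h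
  have hw := hZ.word
  have hb := hZ.b_eq
  have hal := hZ.add_le
  have h4Z := hZ.four_le
  have h0 := hc.r0
  have hp₁ := hc.arr_le 5 m
  have hp₂ := hc.arr_le 6 (s.arr b 5 m)
  rw [hparent] at hp₁ hp₂
  rw [hpos] at hp₂
  refine Run.of_wp ?_
  rw [labelParent]
  simp [h0, h4, hparent, hpos]
  (repeat' apply And.intro) <;> try omega
  constructor
  · exact (hc.setReg (by omega)).setArr hp₂
  · simpa using hord
  · simpa using hparent
  · simpa using hpos
  · simpa using hwt
  · omega
  · exact hl
  · intro i hi hin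
    by_cases him : i = m
    · simp [him]
    · simpa [him] using hpar i (by omega) hin
  · simpa using hcur
  · intro a ha ha' j
    simp [hz a ha ha', show a < 16 by omega, show a ≠ 8 by omega]

theorem run_labelPebble (hE : E.length + 1 = n) {A : ElimArrays} {m l : ℕ} {s : State}
    (h : Relabelling E σ b Z A m (l + 1) s) (h4 : s.reg 4 = l + 1) :
    Run W labelPebble s labelPebble.cost fun s' =>
      Relabelling E σ b Z A m l s' ∧ s'.reg 4 = l := by
  obtain ⟨hc, hord, hparent, hpos, hwt, hm, hl, hpar, hcur, hz⟩ := h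
  have hw := hZ.word
  have hb := hZ.b_eq
  have hal := hZ.add_le
  have h4Z := hZ.four_le
  have h0 := hc.r0
  have h1 := hc.r1
  have hin := (encode_getD E σ hE).2 ⟨l, hl⟩
  have h5 := hc.input (2 * n + l) (by omega)
  simp only [hin] at h5
  have hlt := (σ ⟨l, hl⟩).isLt
  have hp := hc.arr_le 6 (σ ⟨l, hl⟩)
  rw [hpos] at hp
  refine Run.of_wp ?_
  rw [labelPebble]
  simp [h0, h1, h4, h5, hpos]
  (repeat' apply And.intro) <;> try omega
  constructor
  · exact (hc.setReg (by omega)).setArr hp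
  · simpa using hord
  · simpa using hparent
  · simpa using hpos
  · simpa using hwt
  · exact hm
  · omega
  · simpa using hpar
  · intro p hp'
    by_cases hpl : (p : ℕ) = l
    · obtain rfl : p = ⟨l, hl⟩ := Fin.ext hpl
      simp
    · simpa [hpl] using hcur p (by omega)
  · intro a ha ha' j
    simp [hz a ha ha', show a < 16 by omega, show a ≠ 13 by omega]

theorem run_labelRoot {r : Fin n} {t : ℕ} {s : State} (h : Eliminated G E σ b Z r t s) :
    Run W labelRoot s labelRoot.cost (Relabelling E σ b Z
      { arrays b s with
        ord := Function.update (s.arr b 4) (n - 1) r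
        pos := Function.update (s.arr b 6) r (n - 1) } (n - 1) k) := by
  obtain ⟨hc, H, h7, hz⟩ := h
  have hw := hZ.word
  have hb := hZ.b_eq
  have hal := hZ.add_le
  have h4Z := hZ.four_le
  have h0 := hc.r0
  have h1 := hc.r1
  have hn := hZ.n_pos
  have hr := r.isLt
  refine Run.of_wp ?_
  rw [labelRoot]
  simp [h0, h1, h7]
  (repeat' apply And.intro) <;> try omega
  constructor
  · exact (hc.setArr (by omega)).setArr (by omega)
  · simp [Function.update_apply]
  · simp [arrays]
  · simp [Function.update_apply]
  · simp [arrays]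
  · omega
  · exact le_rfl
  · omega
  · intro p hp
    omega
  · intro a ha ha' j
    simp [hz a (by omega) (by omega), show a < 16 by omega, show a ≠ 4 by omega,
      show a ≠ 6 by omega]

/-- The result of the labelling. -/
structure Prepared {n k : ℕ} (G : SimpleGraph (Fin n)) (E : List (Fin n × Fin n))
    (σ : Fin k → Fin n) (b Z : ℕ) (pos par ord S : ℕ → ℕ) (s : State) : Prop where
  labelled : Labelled (fun x => (encode E σ).getD x 0) n k b Z par S ord s
  labelling : Labelling G (fun v => pos v) par
  S_eq : S = fun c => acc par (count fun p => pos (σ p)) c c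
  S_le : ∀ c, c + 1 < n → 2 * S c ≤ k
  ord_pos : ∀ v : Fin n, ord (pos v) = v
  cur : ∀ p : Fin k, s.arr b 13 p = pos (σ p)
  zero : ∀ a < 13, 9 ≤ a → ∀ j, s.arr b a j = 0

theorem run_relabel (hE : E.length + 1 = n) {r : Fin n} {t : ℕ} {s : State}
    (h : Eliminated G E σ b Z r t s) :
    Run W relabel s (200 * n + 100 * k) fun s' =>
      ∃ pos par ord S, Prepared G E σ b Z pos par ord S s' := by
  have hw := hZ.word
  have hb := hZ.b_eq
  have hal := hZ.add_le
  have h4Z := hZ.four_le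
  have hn := hZ.n_pos
  have hk := hZ.k_pos
  have hr := r.isLt
  obtain ⟨t, ht⟩ : ∃ A : ElimArrays, A = { arrays b s with
    ord := Function.update (s.arr b 4) (n - 1) r
    pos := Function.update (s.arr b 6) r (n - 1) } := ⟨_, rfl⟩
  have hroot := run_labelRoot hZ h
  rw [← ht] at hroot
  have key : Run W relabel s (labelRoot.cost + (Expr.cost (.reg 1 - 1) + 1 +
      (((n - 1) * (2 + labelParent.cost) + 2) + (Expr.cost (.reg 2) + 1 +
        (k * (2 + labelPebble.cost) + 2))))) (Relabelling E σ b Z t 0 0) := by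
    refine hroot.seq fun s₁ h₁ => Run.assign_seq ?_ (Run.seq
      (P := fun s' => Relabelling E σ b Z t 0 k s' ∧ s'.reg 4 = 0) ?_ fun s₂ h₂ =>
      Run.assign_seq ?_ ?_)
    · simp [h₁.ctx.r1]
      omega
    · refine Run.countdown (I := fun m s' => Relabelling E σ b Z t m k s' ∧ s'.reg 4 = m)
        (fun m s' h' => ⟨h'.2, ?_⟩) (fun m s' h' => run_labelParent hZ h'.1 h'.2) ⟨?_, ?_⟩
      · have := h'.1.m_lt
        omega
      · exact h₁.setReg le_rfl
      · simp [h₁.ctx.r1]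
    · simp [h₂.1.ctx.r2]
      omega
    · refine (Run.countdown (I := fun l s' => Relabelling E σ b Z t 0 l s' ∧ s'.reg 4 = l)
        (fun l s' h' => ⟨h'.2, ?_⟩) (fun l s' h' => run_labelPebble hZ hE h'.1 h'.2)
        ⟨?_, ?_⟩).mono le_rfl fun _ h => h.1
      · have := h'.1.l_le
        omega
      · exact h₂.1.setReg le_rfl
      · simp [h₂.1.ctx.r2]
  refine key.mono ?_ fun s' h' => ?_
  · have h₁ : (n - 1) * (2 + labelParent.cost) ≤ (n - 1) * 100 :=
      Nat.mul_le_mul_left _ (by decide)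
    have h₂ : k * (2 + labelPebble.cost) ≤ k * 50 := Nat.mul_le_mul_left _ (by decide)
    have h₃ : labelRoot.cost + Expr.cost (.reg 1 - 1) + Expr.cost (.reg 2) ≤ 50 := by decide
    omega
  · obtain ⟨L, hord, hS⟩ := h.elim.labelling (pos := t.pos) (par := fun i => t.pos (t.parent i))
      (fun i => by rw [ht]; simp [Function.update_apply, arrays])
      (fun i _ => by rw [show t.parent = (arrays b s).parent by rw [ht]])
    -- The elimination counts pebbles by vertices. Via the inverse labelling these are counts by
    -- labels, so its weights become the subtree weights S.
    have hcount : ∀ i < n, startSum σ 0 (if i + 1 < n then (arrays b s).ord i else r) =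
        count (fun p => t.pos (σ p)) i := by
      intro i hi
      obtain ⟨v, rfl⟩ := L.exists_pos hi
      rw [hord, startSum, count]
      refine Finset.sum_congr rfl fun p _ => ?_
      have : (v : ℕ) = σ p ↔ t.pos (σ p) = t.pos v := by
        rw [Fin.val_inj]
        exact ⟨fun h => by rw [h], fun h => (L.inj h).symm⟩
      simp only [Nat.zero_le, true_and, this]
    have hacc : ∀ i, i + 1 < n → (arrays b s).wt i =
        acc (fun i => t.pos (t.parent i)) (count fun p => t.pos (σ p)) i i ∧
        2 * (arrays b s).wt i ≤ k := fun i hi => by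
      obtain ⟨h₁, h₂⟩ := hS i hi
      exact ⟨h₁.trans (acc_congr L.inc hcount (by omega) (by omega)), h₂⟩
    refine ⟨t.pos, fun i => t.pos (t.parent i),
      fun i => if i + 1 < n then (arrays b s).ord i else r, _,
      ⟨h'.ctx, fun i hi => ?_, fun i hi => ?_, fun i hi => h'.par i (Nat.zero_le _) hi⟩, L, rfl,
      fun c hc => ?_, hord, fun p => h'.cur p (Nat.zero_le _), h'.zero⟩
    · rw [h'.ord, ht]
      dsimp only
      split_ifs with hi'
      · rw [Function.update_of_ne (by omega)]
        rfl
      · rw [show i = n - 1 by omega, Function.update_self]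
    · rw [h'.wt, show t.wt = (arrays b s).wt by rw [ht]]
      exact (hacc i hi).1
    · rw [← (hacc c hc).1]
      exact (hacc c hc).2

end Phases

/-! ### Filling the table -/

theorem Labelled.setReg {I : ℕ → ℕ} {n k b Z : ℕ} {par S ord : ℕ → ℕ} {s : State}
    (h : Labelled I n k b Z par S ord s) {r v : ℕ} (hr : 4 ≤ r) :
    Labelled I n k b Z par S ord (s.setReg r v) :=
  ⟨h.ctx.setReg hr, h.ord, h.wt, h.par⟩

theorem Labelled.setArr {I : ℕ → ℕ} {n k b Z : ℕ} {par S ord : ℕ → ℕ} {s : State}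
    (h : Labelled I n k b Z par S ord s) {a i v : ℕ} (ha : 9 ≤ a) (ha' : a < 16) (hv : v ≤ Z) :
    Labelled I n k b Z par S ord (s.setArr b a i v) := by
  refine ⟨h.ctx.setArr hv, fun j hj => ?_, fun j hj => ?_, fun j hj => ?_⟩ <;>
    rw [arr_setArr ha' (by omega), if_neg (by omega)]
  · exact h.ord j hj
  · exact h.wt j hj
  · exact h.par j hj

theorem index_lt {n k i y : ℕ} (hi : i < n) (hy : y ≤ k) : i * (k + 1) + y < n * (k + 1) := by
  have : (i + 1) * (k + 1) ≤ n * (k + 1) := Nat.mul_le_mul_right _ hi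
  rw [add_mul, one_mul] at this
  omega

/-- Row-major addresses with rows of length k + 1: the row is recovered as the quotient. -/
theorem index_inj {k i i' y y' : ℕ} (hy : y ≤ k) (hy' : y' ≤ k) :
    i * (k + 1) + y = i' * (k + 1) + y' ↔ i = i' ∧ y = y' := by
  constructor
  · intro h
    have hi : i = i' := by
      have h₁ : (i * (k + 1) + y) / (k + 1) = i := by
        rw [mul_comm, Nat.mul_add_div (by omega), Nat.div_eq_of_lt (by omega), add_zero]
      have h₂ : (i' * (k + 1) + y') / (k + 1) = i' := by
        rw [mul_comm, Nat.mul_add_div (by omega), Nat.div_eq_of_lt (by omega), add_zero]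
      rw [← h₁, h, h₂]
    subst hi
    omega
  · rintro ⟨rfl, rfl⟩
    rfl

/-- The cost of placing `x` of the `reg 6` pebbles below the child in the register `4`, and the
others below its parent in the register `5`. -/
def candidateExpr (x : Expr) : Expr :=
  .get 9 (.reg 5 * .reg 3 + (.reg 6 - x)) +
    (.get 9 (.reg 4 * .reg 3 + x) + ((.get 7 (.reg 4) - x) + (x - .get 7 (.reg 4))))

/-- A step of the search for the best candidate. -/
def scanStep : Prog :=
  .seq (.ite (.bin .lt (candidateExpr (.reg 8)) (candidateExpr (.reg 7)))
    (.assign 7 (.reg 8)) .skip) (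
  .assign 8 (.reg 8 + 1))

/-- Computes an entry of the table. -/
def mergeEntry : Prog :=
  .assign 6 (.reg 6 - 1) ;;
  .assign 7 0 ;;
  .assign 8 1 ;;
  .seq (.loop (.bin .lt (.reg 8) (.reg 6)) scanStep) (
  .put 10 (.reg 4 * .reg 3 + .reg 6) (.reg 7) ;;
  .put 9 (.reg 5 * .reg 3 + .reg 6) (candidateExpr (.reg 7)))

/-- Updates the row of the parent of the label in the register `4`. -/
def mergeChild : Prog :=
  .assign 5 (.get 8 (.reg 4)) ;;
  .assign 6 (.reg 3) ;;
  .seq (.loop (.reg 6) mergeEntry) (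
  .assign 4 (.reg 4 + 1))

/-- Computes the table. -/
def fillTable : Prog :=
  .assign 4 0 ;;
  .loop (.bin .lt (.reg 4 + 1) (.reg 1)) mergeChild

/-- The state after the entries from `j` on have been updated for the child `c`. -/
structure Merging (I : ℕ → ℕ) (n k b Z : ℕ) (par S ord : ℕ → ℕ) (A : ℕ → ℕ → ℕ) (c j : ℕ)
    (s : State) : Prop where
  labelled : Labelled I n k b Z par S ord s
  r4 : s.reg 4 = c
  r5 : s.reg 5 = par c
  c_lt : c + 1 < n
  table : ∀ i < n, ∀ y ≤ k, s.arr b 9 (i * (k + 1) + y) =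
    if i = par c ∧ j ≤ y then table par S (c + 1) i y else table par S c i y
  choice : ∀ i < n, ∀ y ≤ k, i < c ∨ (i = c ∧ j ≤ y) →
    s.arr b 10 (i * (k + 1) + y) = choice par S i y
  frame : ∀ a < 16, 11 ≤ a → ∀ i, s.arr b a i = A a i

theorem Merging.setReg {I : ℕ → ℕ} {n k b Z : ℕ} {par S ord : ℕ → ℕ} {A : ℕ → ℕ → ℕ} {c j : ℕ}
    {s : State} (h : Merging I n k b Z par S ord A c j s) {r v : ℕ} (hr : 6 ≤ r) :
    Merging I n k b Z par S ord A c j (s.setReg r v) :=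
  ⟨h.labelled.setReg (by omega), by rw [reg_setReg, if_neg (by omega), h.r4],
    by rw [reg_setReg, if_neg (by omega), h.r5], h.c_lt, h.table, h.choice, h.frame⟩

section Phases
variable {W n k b Z : ℕ} (hZ : Sizes W n k b Z) {I : ℕ → ℕ} {par S ord : ℕ → ℕ} {A : ℕ → ℕ → ℕ}
  {c j : ℕ} {s : State} (hpar : IncPar n par) (hS : ∀ c, c + 1 < n → 2 * S c ≤ k)
include hZ hpar

theorem candidateExpr_ok (h : Merging I n k b Z par S ord A c (j + 1) s) (h6 : s.reg 6 = j)
    (hj : j ≤ k) {e : Expr} (he : e.ok W s) (hx : e.val s ≤ j) :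
    (candidateExpr e).ok W s ∧
      (candidateExpr e).val s = candidate par S (table par S c) c j (e.val s) := by
  obtain ⟨hl, h4, h5, hc, ht, hch, hf⟩ := h
  have hw := hZ.word
  have hb := hZ.b_eq
  have hal := hZ.add_le
  have h4Z := hZ.four_le
  have hidx := hZ.idx_le
  have h0 := hl.ctx.r0
  have h3 := hl.ctx.r3
  have hp := hpar c hc
  have h₁ := index_lt (y := j - e.val s) hp.2 (by omega : _ ≤ k)
  have h₂ := index_lt (y := e.val s) (by omega : c < n) (by omega : _ ≤ k)
  have h₃ := hl.ctx.arr_le 9 (par c * (k + 1) + (j - e.val s))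
  have h₄ := hl.ctx.arr_le 9 (c * (k + 1) + e.val s)
  have h₅ := hl.ctx.arr_le 7 c
  have hW := Expr.val_lt_of_ok he
  constructor
  · simp [candidateExpr, h0, h3, h4, h5, h6, he]
    (repeat' apply And.intro) <;> omega
  · simp only [candidateExpr, val_add, val_sub, val_mul, val_get, val_reg, h0, h3, h4, h5, h6,
      candidate, absDiff, hl.wt c hc]
    rw [ht _ hp.2 _ (by omega), ht _ (by omega) _ (by omega), if_neg (by omega),
      if_neg (by omega)]

theorem run_scanStep {y : ℕ} (h : Merging I n k b Z par S ord A c (j + 1) s) (h6 : s.reg 6 = j)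
    (hj : j ≤ k) (hy : y + 1 < j)
    (h7 : s.reg 7 = argmin (candidate par S (table par S c) c j) y) (h8 : s.reg 8 = y + 1) :
    Run W scanStep s scanStep.cost fun s' => Merging I n k b Z par S ord A c (j + 1) s' ∧
      s'.reg 6 = j ∧ s'.reg 7 = argmin (candidate par S (table par S c) c j) (y + 1) ∧
      s'.reg 8 = y + 2 := by
  have hw := hZ.word
  have hal := hZ.add_le
  have h4Z := hZ.four_le
  have hle := argmin_le (candidate par S (table par S c) c j) y
  obtain ⟨ho₇, hv₇⟩ := candidateExpr_ok hZ hpar h h6 hj (e := .reg 7)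
    (by rw [ok_reg]; omega) (by rw [val_reg]; omega)
  obtain ⟨ho₈, hv₈⟩ := candidateExpr_ok hZ hpar h h6 hj (e := .reg 8)
    (by rw [ok_reg]; omega) (by rw [val_reg]; omega)
  rw [val_reg, h7] at hv₇
  rw [val_reg, h8] at hv₈
  refine Run.of_wp ?_
  rw [scanStep, wp_seq, wp_ite]
  simp only [ok_lt, val_lt, ho₇, ho₈, hv₇, hv₈, true_and]
  refine ⟨by split_ifs <;> omega, fun hv => ?_, fun hv => ?_⟩
  · have hlt : candidate par S (table par S c) c j (y + 1) <
        candidate par S (table par S c) c j (argmin (candidate par S (table par S c) c j) y) := by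
      by_contra h
      exact hv (if_neg h)
    simp only [wp_assign, ok_reg, ok_add, val_reg, val_add, reg_setReg]
    refine ⟨by omega, ?_, (h.setReg (by omega)).setReg (by omega), by simpa using h6, ?_, ?_⟩
    · simp [h8]
      omega
    · simp [h8, argmin, hlt]
    · simp [h8]
  · have hlt : ¬ candidate par S (table par S c) c j (y + 1) <
        candidate par S (table par S c) c j (argmin (candidate par S (table par S c) c j) y) := by
      intro h
      rw [if_pos h] at hv
      omega
    simp only [wp_skip, wp_assign, ok_reg, ok_add, val_reg, val_add, reg_setReg]
    refine ⟨?_, h.setReg (by omega), by simpa using h6, ?_, ?_⟩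
    · simp [h8]
      omega
    · simp [h7, argmin, hlt]
    · simp [h8]

-- Entries are updated in place with j descending. The new entry j reads the parent row only at
-- indices at most j, which still hold old values, and the row of c is not written at all.
include hS in
theorem run_mergeEntry (h : Merging I n k b Z par S ord A c (j + 1) s) (h6 : s.reg 6 = j + 1)
    (hj : j ≤ k) : Run W mergeEntry s (400 * k) fun s' =>
      Merging I n k b Z par S ord A c j s' ∧ s'.reg 6 = j := by
  have hw := hZ.word
  have hal := hZ.add_le
  have h4Z := hZ.four_le
  have hk := hZ.k_pos
  have hb := hZ.b_eq
  have hidx := hZ.idx_le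
  have hmul := hZ.mul_le
  have key : Run W mergeEntry s (Expr.cost (.reg 6 - 1) + 1 + (Expr.cost 0 + 1 + (Expr.cost 1 + 1 +
      (((j - 1) * (Expr.cost (.bin .lt (.reg 8) (.reg 6)) + 1 + scanStep.cost) +
        (Expr.cost (.bin .lt (.reg 8) (.reg 6)) + 1)) +
      Prog.cost (.put 10 (.reg 4 * .reg 3 + .reg 6) (.reg 7) ;;
        .put 9 (.reg 5 * .reg 3 + .reg 6) (candidateExpr (.reg 7)))))))
      fun s' => Merging I n k b Z par S ord A c j s' ∧ s'.reg 6 = j := by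
    refine Run.assign_seq ?_ <| Run.assign_seq ?_ <| Run.assign_seq ?_ <| Run.seq
      (P := fun s' => Merging I n k b Z par S ord A c (j + 1) s' ∧ s'.reg 6 = j ∧
        s'.reg 7 = choice par S c j) ?_ fun s' h' => Run.of_wp ?_
    · simp [h6]
      omega
    · simp
      omega
    · simp
      omega
    · refine Run.loop (I := fun m s' => ∃ y, m = j - 1 - y ∧ y ≤ j - 1 ∧
        Merging I n k b Z par S ord A c (j + 1) s' ∧ s'.reg 6 = j ∧
        s'.reg 7 = argmin (candidate par S (table par S c) c j) y ∧ s'.reg 8 = y + 1)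
        (fun m s' h' => ?_) ⟨0, rfl, Nat.zero_le _,
          ((h.setReg (by omega)).setReg (by omega)).setReg (by omega), ?_, ?_, ?_⟩
      · obtain ⟨y, rfl, hy, hM, h6, h7, h8⟩ := h'
        refine ⟨?_, fun hv => ?_, fun hv => ?_⟩
        · simp only [ok_lt, ok_reg, val_reg, h6, h8]
          refine ⟨by omega, by omega, by split_ifs <;> omega⟩
        · simp [h6, h8] at hv
          refine ⟨hM, h6, ?_⟩
          rw [h7, choice, show y = j - 1 by omega]
        · simp [h6, h8] at hv
          exact ⟨j - 1 - (y + 1), by omega,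
            (run_scanStep hZ hpar hM h6 hj hv h7 h8).mono le_rfl fun s' h' =>
              ⟨y + 1, rfl, by omega, h'⟩⟩
      · simp [h6]
      · simp [argmin]
      · simp
    · obtain ⟨hM, h6, h7⟩ := h'
      have hch : choice par S c j ≤ j - 1 := argmin_le _ _
      -- The minimiser is stored before the cost is evaluated, so the expression is evaluated in the
      -- state after that store, which leaves the table untouched.
      obtain ⟨ho, hv⟩ := candidateExpr_ok hZ hpar
        (s := s'.setArr b 10 (c * (k + 1) + j) (choice par S c j)) (I := I) (ord := ord)
        (A := A) (c := c) (e := .reg 7) ⟨hM.labelled.setArr (by omega) (by omega) (by omega),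
          hM.r4, hM.r5, hM.c_lt, by simpa using hM.table, fun i hi y hy hiy => by
            rw [arr_setArr (by omega) (by omega), if_neg (by rw [index_inj hy hj]; omega)]
            exact hM.choice i hi y hy hiy,
          fun a ha ha' i => by
            rw [arr_setArr (by omega) ha, if_neg (by omega)]
            exact hM.frame a ha ha' i⟩ h6 hj (by rw [ok_reg, reg_setArr]; omega)
        (by rw [val_reg, reg_setArr]; omega)
      rw [val_reg, reg_setArr, h7, ← table_succ_par] at hv
      have hc := hM.c_lt
      have hp := hpar c hc
      have h₁ := index_lt hp.2 hj
      have h₂ := index_lt (by omega : c < n) hj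
      have h₃ : table par S (c + 1) (par c) j ≤ Z :=
        (table_bound hpar (B := k) (fun c hc => by have := hS c hc; omega) hc _ _
          (by omega) hp.2).trans ((Nat.mul_le_mul hc.le (Nat.le_add_left k n)).trans hmul)
      simp [hM.r4, hM.r5, h6, h7, hM.labelled.ctx.r0, hM.labelled.ctx.r3, ho, hv]
      (repeat' apply And.intro) <;> try omega
      constructor
      · exact (hM.labelled.setArr (by omega) (by omega) (by omega)).setArr (by omega) (by omega) h₃
      · exact hM.r4
      · exact hM.r5
      · exact hc
      · intro i hi y hy
        simp only [arr_setArr (a := 9) (a' := 9) (by omega) (by omega),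
          arr_setArr (a := 10) (a' := 9) (by omega) (by omega), index_inj hy hj]
        rw [hM.table i hi y hy]
        by_cases hiy : i = par c ∧ y = j
        · simp [hiy]
        · simp [hiy, show i = par c ∧ j < y ↔ i = par c ∧ j ≤ y by omega]
      · intro i hi y hy hiy
        simp only [arr_setArr (a := 9) (a' := 10) (by omega) (by omega),
          arr_setArr (a := 10) (a' := 10) (by omega) (by omega), index_inj hy hj]
        by_cases hiy' : i = c ∧ y = j
        · simp [hiy']
        · simpa [hiy'] using hM.choice i hi y hy (by omega)
      · intro a ha ha' i
        simpa [ha, show a ≠ 9 by omega, show a ≠ 10 by omega] using hM.frame a ha ha' i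
  refine key.mono ?_ fun _ h => h
  have h₁ : (j - 1) * (Expr.cost (.bin .lt (.reg 8) (.reg 6)) + 1 + scanStep.cost) ≤
    (j - 1) * 200 := Nat.mul_le_mul_left _ (by decide)
  have h₂ : Expr.cost (.reg 6 - 1) + Expr.cost 0 + Expr.cost 1 +
    Expr.cost (.bin .lt (.reg 8) (.reg 6)) +
      Prog.cost (.put 10 (.reg 4 * .reg 3 + .reg 6) (.reg 7) ;;
        .put 9 (.reg 5 * .reg 3 + .reg 6) (candidateExpr (.reg 7))) ≤ 300 := by decide
  omega

omit hZ hpar in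
/-- The state after the children below `c` have been treated. -/
structure TableRows (I : ℕ → ℕ) (n k b Z : ℕ) (par S ord : ℕ → ℕ) (A : ℕ → ℕ → ℕ) (c : ℕ)
    (s : State) : Prop where
  labelled : Labelled I n k b Z par S ord s
  r4 : s.reg 4 = c
  c_lt : c < n
  table : ∀ i < n, ∀ y ≤ k, s.arr b 9 (i * (k + 1) + y) = table par S c i y
  choice : ∀ i < c, ∀ y ≤ k, s.arr b 10 (i * (k + 1) + y) = choice par S i y
  frame : ∀ a < 16, 11 ≤ a → ∀ i, s.arr b a i = A a i

-- There are k + 1 entries with O(k) steps each; this double loop dominates the running time.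
include hS in
theorem run_mergeChild (h : TableRows I n k b Z par S ord A c s) (hc : c + 1 < n) :
    Run W mergeChild s (1000 * (k * k)) (TableRows I n k b Z par S ord A (c + 1)) := by
  have hw := hZ.word
  have hal := hZ.add_le
  have h4Z := hZ.four_le
  have hk := hZ.k_pos
  have hb := hZ.b_eq
  have hp := hpar c hc
  have hkk : k ≤ k * k := Nat.le_mul_of_pos_left k hk
  have h8 := h.labelled.par c hc
  have key : Run W mergeChild s (Expr.cost (.get 8 (.reg 4)) + 1 + (Expr.cost (.reg 3) + 1 +
      (((k + 1) * (2 + 400 * k) + 2) + Prog.cost (.assign 4 (.reg 4 + 1)))))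
      (TableRows I n k b Z par S ord A (c + 1)) := by
    refine Run.assign_seq ?_ <| Run.assign_seq ?_ <| Run.seq
      (P := fun s' => Merging I n k b Z par S ord A c 0 s' ∧ s'.reg 6 = 0) ?_
        fun s' h' => Run.of_wp ?_
    · simp [h.r4, h.labelled.ctx.r0, h8]
      omega
    · simp [h.labelled.ctx.r3]
      omega
    · refine Run.countdown (I := fun j s' => Merging I n k b Z par S ord A c j s' ∧
        s'.reg 6 = j ∧ j ≤ k + 1) (fun j s' h' => ⟨h'.2.1, by omega⟩)
        (fun j s' h' => (run_mergeEntry hZ hpar hS h'.1 h'.2.1 (by omega)).mono le_rfl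
          fun s₁ h₁ => ⟨h₁.1, h₁.2, by omega⟩) (m := k + 1) ⟨Merging.setReg ?_ le_rfl, ?_, le_rfl⟩
        |>.mono le_rfl fun s' h' => ⟨h'.1, h'.2.1⟩
      · refine ⟨h.labelled.setReg (by omega), ?_, ?_, hc, fun i hi y hy => ?_,
          fun i hi y hy hiy => ?_, h.frame⟩
        · simpa using h.r4
        · simp [h.r4, h.labelled.ctx.r0, h8]
        · rw [arr_setReg, if_neg (by omega), h.table i hi y hy]
        · exact h.choice i (by omega) y hy
      · simp [h.labelled.ctx.r3]
    · obtain ⟨hM, h6⟩ := h'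
      simp [hM.r4]
      refine ⟨by omega, hM.labelled.setReg le_rfl, by simp, hc, fun i hi y hy => ?_,
        fun i hi y hy => ?_, hM.frame⟩
      · rw [arr_setReg, hM.table i hi y hy]
        by_cases hip : i = par c
        · simp [hip]
        · simp [hip, table_succ_of_ne hip]
      · exact hM.choice i (by omega) y hy (by omega)
  refine key.mono ?_ fun _ h => h
  have h₁ : (k + 1) * (2 + 400 * k) = 400 * (k * k) + 402 * k + 2 := by ring
  have h₂ : Expr.cost (.get 8 (.reg 4)) + Expr.cost (.reg 3) +
    Prog.cost (.assign 4 (.reg 4 + 1)) ≤ 50 := by decide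
  omega

include hS in
theorem run_fillTable (hl : Labelled I n k b Z par S ord s)
    (h9 : ∀ a < 11, 9 ≤ a → ∀ i, s.arr b a i = 0)
    (hA : ∀ a < 16, 11 ≤ a → ∀ i, s.arr b a i = A a i) :
    Run W fillTable s (2000 * (n * (k * k))) (TableRows I n k b Z par S ord A (n - 1)) := by
  have hw := hZ.word
  have hal := hZ.add_le
  have h4Z := hZ.four_le
  have hn := hZ.n_pos
  have hk := hZ.k_pos
  have key : Run W fillTable s (Expr.cost 0 + 1 +
      ((n - 1) * (Expr.cost (.bin .lt (.reg 4 + 1) (.reg 1)) + 1 + 1000 * (k * k)) +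
        (Expr.cost (.bin .lt (.reg 4 + 1) (.reg 1)) + 1)))
      (TableRows I n k b Z par S ord A (n - 1)) := by
    refine Run.assign_seq ?_ <| Run.loop (I := fun m s' => ∃ c, m = n - 1 - c ∧
      TableRows I n k b Z par S ord A c s') (fun m s' h' => ?_)
      ⟨0, rfl, hl.setReg le_rfl, by simp, hn, fun i hi y hy => ?_, fun i hi => ?_, hA⟩
    · simp
      omega
    · obtain ⟨c, rfl, h⟩ := h'
      have hc := h.c_lt
      refine ⟨?_, fun hv => ?_, fun hv => ?_⟩
      · simp only [ok_lt, ok_add, ok_ofNat, ok_reg, val_reg, val_add, val_ofNat, h.r4,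
          h.labelled.ctx.r1]
        refine ⟨?_, ?_, by split_ifs <;> omega⟩ <;> omega
      · simp [h.r4, h.labelled.ctx.r1] at hv
        rwa [show n - 1 = c by omega]
      · simp [h.r4, h.labelled.ctx.r1] at hv
        exact ⟨n - 1 - (c + 1), by omega, (run_mergeChild hZ hpar hS h hv).mono le_rfl
          fun s' h' => ⟨_, rfl, h'⟩⟩
    · rw [arr_setReg, h9 9 (by omega) le_rfl]
      rfl
    · omega
  refine key.mono ?_ fun _ h => h
  have hkk : 1 ≤ k * k := Nat.mul_pos hk hk
  have h₁ : (n - 1) * (Expr.cost (.bin .lt (.reg 4 + 1) (.reg 1)) + 1 + 1000 * (k * k)) ≤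
      n * (1100 * (k * k)) := by
    have : Expr.cost (.bin .lt (.reg 4 + 1) (.reg 1)) ≤ 50 := by decide
    exact Nat.mul_le_mul (by omega) (by omega)
  have h₂ : Expr.cost 0 + Expr.cost (.bin .lt (.reg 4 + 1) (.reg 1)) ≤ 50 := by decide
  have h₃ : 1 ≤ n * (k * k) := Nat.mul_pos hn hkk
  have h₄ : n * (1100 * (k * k)) = 1100 * (n * (k * k)) := by ring
  omega

end Phases

/-! ### Backtracking, moving the pebbles and output -/

/-- A step of the backtracking. -/
def backtrackStep : Prog :=
  .assign 4 (.reg 4 - 1) ;;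
  .assign 5 (.get 8 (.reg 4)) ;;
  .assign 6 (.get 10 (.reg 4 * .reg 3 + .get 11 (.reg 5))) ;;
  .put 11 (.reg 4) (.reg 6) ;;
  .put 12 (.reg 4) (.reg 6) ;;
  .put 11 (.reg 5) (.get 11 (.reg 5) - .reg 6)

/-- Computes the numbers of pebbles that end at the labels in the array `11`, and below the labels
in the array `12`. -/
def backtrack : Prog :=
  .seq (.put 11 (.reg 1 - 1) (.reg 2) ;; .put 12 (.reg 1 - 1) (.reg 2)) (
  .assign 4 (.reg 1 - 1) ;;
  .loop (.reg 4) backtrackStep)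

/-- Moves the pebble in the register `7`, if it should move. -/
def movePebble : Prog :=
  .assign 7 (.reg 7 - 1) ;;
  .ite (.bin .eq (.get 13 (.reg 7)) (.reg 8) * .bin .lt 0 (.reg 6))
    (.put 13 (.reg 7) (.reg 5) ;; .assign 6 (.reg 6 - 1)) .skip

/-- Moves `reg 6` pebbles from `reg 8` to `reg 5`. -/
def movePebbles : Prog :=
  .assign 7 (.reg 2) ;;
  .loop (.reg 7) movePebble

/-- Moves the surplus of a label to its parent. -/
def upStep : Prog :=
  .assign 5 (.get 8 (.reg 4)) ;;
  .assign 8 (.reg 4) ;;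
  .assign 6 (.get 7 (.reg 4) - .get 12 (.reg 4)) ;;
  .seq movePebbles (.assign 4 (.reg 4 + 1))

/-- Moves the deficit of a label from its parent. -/
def downStep : Prog :=
  .assign 4 (.reg 4 - 1) ;;
  .assign 5 (.reg 4) ;;
  .assign 8 (.get 8 (.reg 4)) ;;
  .assign 6 (.get 12 (.reg 4) - .get 7 (.reg 4)) ;;
  movePebbles

/-- Moves all pebbles to their end labels. -/
def moveAll : Prog :=
  .assign 4 0 ;;
  .seq (.loop (.bin .lt (.reg 4 + 1) (.reg 1)) upStep)
    (.loop (.reg 4) downStep)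

/-- Writes the end vertex of a pebble. -/
def writePebble : Prog :=
  .assign 4 (.reg 4 - 1) ;;
  .store (.reg 4 + 1) (.get 4 (.get 13 (.reg 4)))

/-- Writes the overall movement and the end vertices. -/
def writeOutput : Prog :=
  .seq (.store 0 (.get 9 ((.reg 1 - 1) * .reg 3 + .reg 2))) (
  .assign 4 (.reg 2) ;;
  .loop (.reg 4) writePebble)

/-- The state of the backtracking after the labels from `c` on have been treated. -/
structure Backtracking {k : ℕ} (I : ℕ → ℕ) (n b Z : ℕ) (par S ord : ℕ → ℕ) (a : Fin k → ℕ) (c : ℕ)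
    (s : State) : Prop where
  labelled : Labelled I n k b Z par S ord s
  c_lt : c < n
  value : s.arr b 9 ((n - 1) * (k + 1) + k) = table par S (n - 1) (n - 1) k
  choice : ∀ i, i + 1 < n → ∀ y ≤ k, s.arr b 10 (i * (k + 1) + y) = choice par S i y
  back : Backtrack n k par S c (s.arr b 11) (s.arr b 12)
  cur : ∀ p : Fin k, s.arr b 13 p = a p

theorem Backtracking.setReg {k : ℕ} {I : ℕ → ℕ} {n b Z : ℕ} {par S ord : ℕ → ℕ} {a : Fin k → ℕ}
    {c : ℕ} {s : State} (h : Backtracking I n b Z par S ord a c s) {r v : ℕ} (hr : 4 ≤ r) :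
    Backtracking I n b Z par S ord a c (s.setReg r v) :=
  ⟨h.labelled.setReg hr, h.c_lt, h.value, h.choice, h.back, h.cur⟩

/-- The state while the pebbles move; `F l` pebbles end below `l` and the overall movement is
`V`. -/
structure Placing (I : ℕ → ℕ) (n k b Z : ℕ) (par S ord F : ℕ → ℕ) (V c : ℕ) (s : State) :
    Prop where
  labelled : Labelled I n k b Z par S ord s
  r4 : s.reg 4 = c
  value : s.arr b 9 ((n - 1) * (k + 1) + k) = V
  target : ∀ i, s.arr b 12 i = F i

theorem Placing.setReg {I : ℕ → ℕ} {n k b Z : ℕ} {par S ord F : ℕ → ℕ} {V c : ℕ} {s : State}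
    (h : Placing I n k b Z par S ord F V c s) {r v : ℕ} (hr : 5 ≤ r) :
    Placing I n k b Z par S ord F V c (s.setReg r v) :=
  ⟨h.labelled.setReg (by omega), by rw [reg_setReg, if_neg (by omega), h.r4], h.value, h.target⟩

theorem Placing.setReg_four {I : ℕ → ℕ} {n k b Z : ℕ} {par S ord F : ℕ → ℕ} {V c : ℕ} {s : State}
    (h : Placing I n k b Z par S ord F V c s) (v : ℕ) :
    Placing I n k b Z par S ord F V v (s.setReg 4 v) :=
  ⟨h.labelled.setReg le_rfl, by rw [reg_setReg, if_pos rfl], h.value, h.target⟩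

section Phases
variable {W n k b Z : ℕ} (hZ : Sizes W n k b Z) {I : ℕ → ℕ} {par S ord : ℕ → ℕ}
  {a : Fin k → ℕ} {c : ℕ} {s : State} (hpar : IncPar n par)
include hZ

-- The bound g ≤ k from `Backtrack.le` keeps the lookup of the minimiser inside its row.
include hpar in
theorem run_backtrackStep (h : Backtracking I n b Z par S ord a (c + 1) s)
    (h4 : s.reg 4 = c + 1) : Run W backtrackStep s backtrackStep.cost fun s' =>
      Backtracking I n b Z par S ord a c s' ∧ s'.reg 4 = c := by
  obtain ⟨hl, hc, hv, hch, hB, hcur⟩ := h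
  have hw := hZ.word
  have hb := hZ.b_eq
  have hal := hZ.add_le
  have h4Z := hZ.four_le
  have hidx := hZ.idx_le
  have h0 := hl.ctx.r0
  have h3 := hl.ctx.r3
  have hp := hpar c hc
  have h8 := hl.par c hc
  have hg := hB.le _ hp.2
  have h10 := hch c hc _ hg
  have hx : choice par S c (s.arr b 11 (par c)) ≤ s.arr b 11 (par c) - 1 := argmin_le _ _
  have hlt := index_lt (by omega : c < n) hg
  have hne : par c ≠ c := by omega
  refine Run.of_wp ?_
  rw [backtrackStep]
  simp [h0, h3, h4, h8, h10, hne]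
  (repeat' apply And.intro) <;> try omega
  constructor
  · repeat' first | apply Labelled.setArr | apply Labelled.setReg
    · exact hl
    all_goals omega
  · omega
  · simpa using hv
  · simpa using hch
  · refine hB.step hpar hc ?_ ?_ (fun i hi hip => ?_) ?_ (fun i hi => ?_)
    · simp [Ne.symm hne]
    · simp
    · simp [hi, hip]
    · simp
    · simp [hi]
  · simpa using hcur

include hpar in
theorem run_backtrack (hl : Labelled I n k b Z par S ord s)
    (hv : s.arr b 9 ((n - 1) * (k + 1) + k) = table par S (n - 1) (n - 1) k)
    (hch : ∀ i, i + 1 < n → ∀ y ≤ k, s.arr b 10 (i * (k + 1) + y) = choice par S i y)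
    (h11 : ∀ i, s.arr b 11 i = 0) (hcur : ∀ p : Fin k, s.arr b 13 p = a p) :
    Run W backtrack s (200 * n) (Backtracking I n b Z par S ord a 0) := by
  have hw := hZ.word
  have hb := hZ.b_eq
  have hal := hZ.add_le
  have h4Z := hZ.four_le
  have hn := hZ.n_pos
  have key : Run W backtrack s (Prog.cost (.put 11 (.reg 1 - 1) (.reg 2) ;;
      .put 12 (.reg 1 - 1) (.reg 2)) + (Expr.cost (.reg 1 - 1) + 1 +
      ((n - 1) * (2 + backtrackStep.cost) + 2))) (Backtracking I n b Z par S ord a 0) := by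
    refine (Run.of_wp (Q := Backtracking I n b Z par S ord a (n - 1)) ?_).seq fun s₁ h₁ =>
      Run.assign_seq ?_ <| (Run.countdown (I := fun c s' =>
        Backtracking I n b Z par S ord a c s' ∧ s'.reg 4 = c) (fun c s' h' => ⟨h'.2, ?_⟩)
        (fun c s' h' => run_backtrackStep hZ hpar h'.1 h'.2) ⟨h₁.setReg le_rfl, ?_⟩).mono
        le_rfl fun s' h' => h'.1
    · simp [hl.ctx.r0, hl.ctx.r1, hl.ctx.r2]
      (repeat' apply And.intro) <;> try omega
      refine ⟨(hl.setArr (by omega) (by omega) (by omega)).setArr (by omega) (by omega) (by omega),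
        by omega, by simpa using hv, by simpa using hch, Backtrack.init hn hZ.k_pos ?_ ?_,
        by simpa using hcur⟩
      · funext i
        simp [h11]
      · simp
    · simp [h₁.labelled.ctx.r1]
      omega
    · have := h'.1.c_lt
      omega
    · simp [h₁.labelled.ctx.r1]
  refine key.mono ?_ fun _ h => h
  have h₁ : (n - 1) * (2 + backtrackStep.cost) ≤ (n - 1) * 150 :=
    Nat.mul_le_mul_left _ (by decide)
  have h₂ : Prog.cost (.put 11 (.reg 1 - 1) (.reg 2) ;; .put 12 (.reg 1 - 1) (.reg 2)) +
    Expr.cost (.reg 1 - 1) ≤ 100 := by decide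
  omega

omit hZ in
/-- The state after the pebbles from `m` on have been considered for a move. -/
structure Moving (I : ℕ → ℕ) (n k b Z : ℕ) (par S ord F : ℕ → ℕ) (V c : ℕ) (a : Fin k → ℕ)
    (src dst x m : ℕ) (s : State) : Prop where
  placing : Placing I n k b Z par S ord F V c s
  r5 : s.reg 5 = dst
  r7 : s.reg 7 = m
  r8 : s.reg 8 = src
  m_le : m ≤ k
  same : ∀ p : Fin k, p < m → s.arr b 13 p = a p
  moved : ∀ p : Fin k, s.arr b 13 p = a p ∨ (a p = src ∧ s.arr b 13 p = dst)
  count : (∑ p : Fin k, if m ≤ p ∧ s.arr b 13 p ≠ a p then 1 else 0) + s.reg 6 = x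
  done : s.reg 6 = 0 ∨ ∀ p : Fin k, m ≤ p → a p = src → s.arr b 13 p ≠ a p

variable {F : ℕ → ℕ} {V src dst x m : ℕ}

theorem run_movePebble (hne : src ≠ dst) (hs : src ≤ Z) (hd : dst ≤ Z) (hx : x ≤ Z)
    (h : Moving I n k b Z par S ord F V c a src dst x (m + 1) s) :
    Run W movePebble s movePebble.cost (Moving I n k b Z par S ord F V c a src dst x m) := by
  obtain ⟨hP, h5, h7, h8, hm, hsame, hmv, hcount, hdone⟩ := h
  have hw := hZ.word
  have hb := hZ.b_eq
  have hal := hZ.add_le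
  have h4Z := hZ.four_le
  have h0 := hP.labelled.ctx.r0
  have hmk : m < k := by omega
  have h13 := hsame ⟨m, hmk⟩ (Nat.lt_succ_self m)
  have h13' := hP.labelled.ctx.arr_le 13 m
  dsimp only at h13
  refine Run.of_wp ?_
  rw [movePebble, wp_seq, wp_assign]
  refine ⟨by simp [h7]; omega, ?_⟩
  by_cases hcond : s.arr b 13 m = src ∧ 0 < s.reg 6
  · refine wp_ite_pos ?_ ?_
    · simp [h0, h7, h8, hcond]
      omega
    simp [h0, h7, h5]
    (repeat' apply And.intro) <;> try omega
    constructor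
    · refine ((?_ : Placing I n k b Z par S ord F V c (s.setReg 7 m)).labelled.setArr
        (by omega) (by omega) hd |> fun h' => ⟨h', ?_, ?_, ?_⟩ : Placing I n k b Z par S ord F V c
          ((s.setReg 7 m).setArr b 13 m dst)).setReg (by omega)
      · exact hP.setReg (by omega)
      · simpa using hP.r4
      · simpa using hP.value
      · simpa using hP.target
    · simpa using h5
    · simp
    · simpa using h8
    · omega
    · intro p hp
      simpa [show (p : ℕ) ≠ m by omega] using hsame p (by omega)
    · intro p
      by_cases hpm : (p : ℕ) = m
      · obtain rfl : p = ⟨m, hmk⟩ := Fin.ext hpm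
        right
        simp [← h13, hcond.1]
      · simpa [hpm] using hmv p
    · rw [sum_from_eq hmk]
      have : (∑ p : Fin k, if m + 1 ≤ p ∧ ((((s.setReg 7 m).setArr b 13 m dst).setReg 6
          (s.reg 6 - 1)).arr b 13 p ≠ a p) then 1 else 0) =
          ∑ p : Fin k, if m + 1 ≤ p ∧ s.arr b 13 p ≠ a p then 1 else 0 := by
        refine Finset.sum_congr rfl fun p _ => ?_
        by_cases hpm : (p : ℕ) = m
        · simp [hpm]
        · simp [hpm]
      -- Since src ≠ dst, a moved pebble is recognised by its changed label; it adds one to the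
      -- count as the register loses one.
      rw [this, if_pos (by simp [← h13, hcond.1, Ne.symm hne]), reg_setReg, if_pos rfl]
      omega
    · rcases hdone with hdone | hdone
      · omega
      · right
        intro p hp hps
        by_cases hpm : (p : ℕ) = m
        · simpa [hpm, hps] using Ne.symm hne
        · simpa [hpm] using hdone p (by omega) hps
  · refine wp_ite_neg ?_ ?_
    · simp [h0, h7, h8]
      (repeat' apply And.intro) <;> try (first | omega | (split_ifs <;> omega))
    rw [wp_skip]
    simp only [val_sub, val_reg, val_ofNat, h7, Nat.add_sub_cancel]
    refine ⟨hP.setReg (by omega), by simpa using h5, by simp, by simpa using h8, by omega,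
      fun p hp => hsame p (by omega), hmv, ?_, ?_⟩
    · rw [sum_from_eq hmk]
      simp only [arr_setReg, h13]
      simpa using hcount
    · rcases hdone with hdone | hdone
      · left
        simpa using hdone
      · by_cases h6 : s.reg 6 = 0
        · left
          simpa using h6
        · right
          intro p hp hps
          by_cases hpm : (p : ℕ) = m
          · obtain rfl : p = ⟨m, hmk⟩ := Fin.ext hpm
            exact absurd ⟨h13.trans hps, by omega⟩ hcond
          · exact hdone p (by omega) hps

/-- The scan ends with the quota x used up or with every pebble at src moved; as src holds at least
x pebbles, exactly x move in either case. -/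
theorem run_movePebbles (hne : src ≠ dst) (hs : src ≤ Z) (hd : dst ≤ Z)
    (h : Placing I n k b Z par S ord F V c s) (h5 : s.reg 5 = dst) (h8 : s.reg 8 = src)
    (h6 : s.reg 6 = x) (ha : ∀ p : Fin k, s.arr b 13 p = a p) (hx : x ≤ count a src) :
    Run W movePebbles s (60 * k) fun s' => Placing I n k b Z par S ord F V c s' ∧
      ∃ a' : Fin k → ℕ, Moves src dst x a a' ∧ ∀ p : Fin k, s'.arr b 13 p = a' p := by
  have hw := hZ.word
  have hal := hZ.add_le
  have h4Z := hZ.four_le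
  have hk := hZ.k_pos
  have hck : count a src ≤ k := by
    calc count a src ≤ ∑ _p : Fin k, 1 := Finset.sum_le_sum fun p _ => by split <;> omega
      _ = k := by simp
  have key : Run W movePebbles s (Expr.cost (.reg 2) + 1 + (k * (2 + movePebble.cost) + 2))
      (Moving I n k b Z par S ord F V c a src dst x 0) := by
    refine Run.assign_seq ?_ (Run.countdown
      (I := Moving I n k b Z par S ord F V c a src dst x) (fun m s' h' => ⟨h'.r7, ?_⟩)
      (fun m s' h' => run_movePebble hZ hne hs hd (by omega) h')
      ⟨h.setReg (by omega), ?_, ?_, ?_, le_rfl, fun p _ => ha p, fun p => .inl (ha p), ?_, ?_⟩)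
    · simp [h.labelled.ctx.r2]
      omega
    · have := h'.m_le
      omega
    · simpa using h5
    · simp [h.labelled.ctx.r2]
    · simpa using h8
    · simpa [ha] using h6
    · right
      intro p hp
      omega
  refine key.mono ?_ fun s' h' => ⟨h'.placing, fun p => s'.arr b 13 p, ⟨h'.moved, ?_⟩,
    fun p => rfl⟩
  · have h₁ : k * (2 + movePebble.cost) ≤ k * 50 := Nat.mul_le_mul_left _ (by decide)
    have h₂ : Expr.cost (.reg 2) ≤ 1 := by decide
    omega
  · have h₁ := h'.count
    simp only [Nat.zero_le, true_and] at h₁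
    dsimp only
    rcases h'.done with h₂ | h₂
    · omega
    · have h₃ : count a src ≤ ∑ p : Fin k, if s'.arr b 13 p ≠ a p then 1 else 0 := by
        refine Finset.sum_le_sum fun p _ => ?_
        split_ifs with h₄ h₅
        · exact le_rfl
        · exact absurd (h₂ p (Nat.zero_le _) h₄) h₅
        · exact Nat.zero_le _
        · exact le_rfl
      omega

end Phases

section Phases
variable {W n k b Z : ℕ} (hZ : Sizes W n k b Z) {I : ℕ → ℕ} {par S ord F s₀ f : ℕ → ℕ}
  {δ : Fin k → ℕ → ℕ} {V c : ℕ} {s : State} (hpar : IncPar n par)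
include hZ hpar

/-- The state after the labels below `c` have moved their surplus. -/
structure MovedUp (I : ℕ → ℕ) (n k b Z : ℕ) (par S ord F : ℕ → ℕ) (V : ℕ) (s₀ : ℕ → ℕ)
    (δ : Fin k → ℕ → ℕ) (c : ℕ) (s : State) : Prop where
  placing : Placing I n k b Z par S ord F V c s
  c_lt : c < n
  pass : UpPass n par s₀ S F δ c fun p => s.arr b 13 p

/-- The state after the labels from `c` on have received their deficit. -/
structure MovedDown (I : ℕ → ℕ) (n k b Z : ℕ) (par S ord F : ℕ → ℕ) (V : ℕ) (s₀ : ℕ → ℕ)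
    (δ : Fin k → ℕ → ℕ) (c : ℕ) (s : State) : Prop where
  placing : Placing I n k b Z par S ord F V c s
  c_lt : c < n
  pass : DownPass n par s₀ S F δ c fun p => s.arr b 13 p

variable (hS : ∀ i, i < n → S i = s₀ i + childSum par S (n - 1) i)
  (hF : ∀ i, i < n → F i = f i + childSum par F (n - 1) i)
include hS hF

theorem run_upStep (hδ : ∀ p i, i + 1 < n → δ p (par i) ≤ δ p i + 1)
    (h : MovedUp I n k b Z par S ord F V s₀ δ c s) (hc : c + 1 < n) :
    Run W upStep s (120 * k) (MovedUp I n k b Z par S ord F V s₀ δ (c + 1)) := by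
  obtain ⟨hP, -, hU⟩ := h
  have hw := hZ.word
  have hb := hZ.b_eq
  have hal := hZ.add_le
  have h4Z := hZ.four_le
  have hk := hZ.k_pos
  have hl := hP.labelled
  have h0 := hl.ctx.r0
  have h4 := hP.r4
  have hp := hpar c hc
  have h7 := hl.wt c hc
  have h8 := hl.par c hc
  have h7' := hl.ctx.arr_le 7 c
  have h12 := hP.target c
  have h12' := hl.ctx.arr_le 12 c
  have key : Run W upStep s (Expr.cost (.get 8 (.reg 4)) + 1 + (Expr.cost (.reg 4) + 1 +
      (Expr.cost (.get 7 (.reg 4) - .get 12 (.reg 4)) + 1 +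
        (60 * k + Prog.cost (.assign 4 (.reg 4 + 1))))))
      (MovedUp I n k b Z par S ord F V s₀ δ (c + 1)) := by
    refine Run.assign_seq ?_ <| Run.assign_seq ?_ <| Run.assign_seq ?_ <|
      (run_movePebbles (F := F) (V := V) (c := c) (src := c) (dst := par c) (x := S c - F c)
        hZ (by omega) (by omega) (by omega) (((hP.setReg le_rfl).setReg (by omega)).setReg
        (by omega)) ?_ ?_ ?_ (fun p => rfl) (hU.le_count hpar (by omega) hS hF)).seq ?_
    · simp [h0, h4, h8]
      omega
    · simp [h4]
      omega
    · simp [h0, h4, h7, h12]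
      omega
    · simp [h0, h4, h8]
    · simp [h4]
    · simp [h0, h4, h7, h12]
    · rintro s' ⟨hP', a', hm, ha'⟩
      refine Run.of_wp ?_
      simp only [wp_assign, val_add, val_reg, val_ofNat, hP'.r4]
      refine ⟨by simp [hP'.r4]; omega, hP'.setReg_four _, hc, ?_⟩
      have : (fun p : Fin k => (s'.setReg 4 (c + 1)).arr b 13 p) = a' := funext ha'
      rw [this]
      exact hU.step hpar hc (fun p => hδ p c hc) hm
  refine key.mono ?_ fun _ h => h
  have h₂ : Expr.cost (.get 8 (.reg 4)) + Expr.cost (.reg 4) +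
    Expr.cost (.get 7 (.reg 4) - .get 12 (.reg 4)) + Prog.cost (.assign 4 (.reg 4 + 1)) ≤ 40 := by
      decide
  omega

theorem run_downStep (hδ : ∀ p i, i + 1 < n → δ p i ≤ δ p (par i) + 1)
    (h : MovedDown I n k b Z par S ord F V s₀ δ (c + 1) s) :
    Run W downStep s (120 * k) (MovedDown I n k b Z par S ord F V s₀ δ c) := by
  obtain ⟨hP, hc, hU⟩ := h
  have hw := hZ.word
  have hb := hZ.b_eq
  have hal := hZ.add_le
  have h4Z := hZ.four_le
  have hk := hZ.k_pos
  have hl := hP.labelled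
  have h0 := hl.ctx.r0
  have h4 := hP.r4
  have hp := hpar c hc
  have h7 := hl.wt c hc
  have h8 := hl.par c hc
  have h7' := hl.ctx.arr_le 7 c
  have h12 := hP.target c
  have h12' := hl.ctx.arr_le 12 c
  have hP₄ : Placing I n k b Z par S ord F V c (s.setReg 4 (Expr.val s (.reg 4 - 1))) := by
    simpa [h4] using hP.setReg_four c
  have key : Run W downStep s (Expr.cost (.reg 4 - 1) + 1 + (Expr.cost (.reg 4) + 1 +
      (Expr.cost (.get 8 (.reg 4)) + 1 + (Expr.cost (.get 12 (.reg 4) - .get 7 (.reg 4)) + 1 +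
        60 * k)))) (MovedDown I n k b Z par S ord F V s₀ δ c) := by
    refine Run.assign_seq ?_ <| Run.assign_seq ?_ <| Run.assign_seq ?_ <| Run.assign_seq ?_ <|
      (run_movePebbles (F := F) (V := V) (c := c) (src := par c) (dst := c) (x := F c - S c)
        hZ (by omega) (by omega) (by omega) (((hP₄.setReg le_rfl).setReg (by omega)).setReg
        (by omega)) ?_ ?_ ?_ (fun p => rfl)
        (hU.le_count hpar hc hS hF)).mono le_rfl ?_
    · simp [h4]
      omega
    · simp [h4]
      omega
    · simp [h0, h4, h8]
      omega
    · simp [h0, h4, h7, h12]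
      omega
    · simp [h4]
    · simp [h0, h4, h8]
    · simp [h0, h4, h7, h12]
    · rintro s' ⟨hP', a', hm, ha'⟩
      have : (fun p : Fin k => s'.arr b 13 p) = a' := funext ha'
      refine ⟨hP', by omega, ?_⟩
      rw [this]
      exact hU.step hpar hc (fun p => hδ p c hc) hm
  refine key.mono ?_ fun _ h => h
  have h₂ : Expr.cost (.reg 4 - 1) + Expr.cost (.reg 4) + Expr.cost (.get 8 (.reg 4)) +
    Expr.cost (.get 12 (.reg 4) - .get 7 (.reg 4)) ≤ 40 := by decide
  omega

/-- Both passes scan all pebbles once per edge, which costs only O(nk). -/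
theorem run_moveAll (hδ : ∀ p i, i + 1 < n → δ p (par i) ≤ δ p i + 1 ∧ δ p i ≤ δ p (par i) + 1)
    (hr : S (n - 1) = F (n - 1)) (hP : Placing I n k b Z par S ord F V c s)
    (hU : UpPass n par s₀ S F δ 0 fun p => s.arr b 13 p) :
    Run W moveAll s (400 * (n * k)) (MovedDown I n k b Z par S ord F V s₀ δ 0) := by
  have hw := hZ.word
  have hal := hZ.add_le
  have h4Z := hZ.four_le
  have hn := hZ.n_pos
  have hk := hZ.k_pos
  have key : Run W moveAll s (Expr.cost 0 + 1 +
      ((n - 1) * (Expr.cost (.bin .lt (.reg 4 + 1) (.reg 1)) + 1 + 120 * k) +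
        (Expr.cost (.bin .lt (.reg 4 + 1) (.reg 1)) + 1) + ((n - 1) * (2 + 120 * k) + 2)))
      (MovedDown I n k b Z par S ord F V s₀ δ 0) := by
    refine Run.assign_seq ?_ <| (Run.loop (I := fun m s' => ∃ c, m = n - 1 - c ∧
      MovedUp I n k b Z par S ord F V s₀ δ c s')
      (Q := MovedDown I n k b Z par S ord F V s₀ δ (n - 1)) (fun m s' h' => ?_)
      ⟨0, rfl, hP.setReg_four 0, by omega, hU⟩).seq fun s' h' =>
      Run.countdown (I := MovedDown I n k b Z par S ord F V s₀ δ)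
        (fun m s' h' => ⟨h'.placing.r4, ?_⟩)
        (fun m s' h' => run_downStep hZ hpar hS hF (fun p i hi => (hδ p i hi).2) h') h'
    · simp
      omega
    · obtain ⟨c, rfl, h'⟩ := h'
      have h4 := h'.placing.r4
      have h1 := h'.placing.labelled.ctx.r1
      have hc := h'.c_lt
      refine ⟨?_, fun h₀ => ?_, fun h₀ => ?_⟩
      · simp [h4, h1]
        (repeat' apply And.intro) <;> try (first | omega | (split_ifs <;> omega))
      · simp [h4, h1] at h₀
        obtain rfl : c = n - 1 := by omega
        exact ⟨h'.placing, hc, h'.pass.down hr⟩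
      · simp [h4, h1] at h₀
        exact ⟨n - 1 - (c + 1), by omega, (run_upStep hZ hpar hS hF
          (fun p i hi => (hδ p i hi).1) h' h₀).mono le_rfl fun s' h' => ⟨c + 1, rfl, h'⟩⟩
    · have := h'.c_lt
      omega
  refine key.mono ?_ fun _ h => h
  have h₁ : Expr.cost (.bin .lt (.reg 4 + 1) (.reg 1)) ≤ 10 := by decide
  have h₂ : Expr.cost 0 = 1 := rfl
  obtain ⟨m, rfl⟩ : ∃ m, n = m + 1 := ⟨n - 1, by omega⟩
  have h₃ : m * 1 ≤ m * k := Nat.mul_le_mul_left _ hk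
  have h₄ : m * (Expr.cost (.bin .lt (.reg 4 + 1) (.reg 1)) + 1 + 120 * k) ≤
    m * (11 + 120 * k) := Nat.mul_le_mul_left _ (by omega)
  rw [Nat.add_sub_cancel]
  nlinarith

omit hpar hS hF in
/-- The state after the end vertices of the pebbles from `m` on have been written. -/
structure Writing (n k b : ℕ) (ord : ℕ → ℕ) (a : Fin k → ℕ) (V m : ℕ) (s : State) :
    Prop where
  r0 : s.reg 0 = b
  r4 : s.reg 4 = m
  m_le : m ≤ k
  vertex : ∀ i, i < n → s.arr b 4 i = ord i
  cur : ∀ p : Fin k, s.arr b 13 p = a p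
  cost : s.mem 0 = V
  written : ∀ p : Fin k, m ≤ p → s.mem (1 + p) = ord (a p)

-- The output occupies the cells 0, …, k, all below b, so it overwrites only the input, which is no
-- longer needed.
omit hpar hS hF in
theorem run_writeOutput {a : Fin k → ℕ} (hP : Placing I n k b Z par S ord F V c s)
    (ha : ∀ p, a p < n) (hord : ∀ i, i < n → ord i < n) (hcur : ∀ p : Fin k, s.arr b 13 p = a p) :
    Run W writeOutput s (100 * k) (Writing n k b ord a V 0) := by
  have hw := hZ.word
  have hb := hZ.b_eq
  have hal := hZ.add_le
  have h4Z := hZ.four_le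
  have hn := hZ.n_pos
  have hk := hZ.k_pos
  have hidx := hZ.idx_le
  have hl := hP.labelled
  have h0 := hl.ctx.r0
  have h1 := hl.ctx.r1
  have h2 := hl.ctx.r2
  have h3 := hl.ctx.r3
  have hV := hl.ctx.arr_le 9 ((n - 1) * (k + 1) + k)
  have hlt := index_lt (by omega : n - 1 < n) (le_refl k)
  have key : Run W writeOutput s
      (Prog.cost (.store 0 (.get 9 ((.reg 1 - 1) * .reg 3 + .reg 2))) +
        (Expr.cost (.reg 2) + 1 + (k * (2 + writePebble.cost) + 2)))
      (Writing n k b ord a V 0) := by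
    refine (Run.of_wp (Q := fun s' => s' = s.setMem 0 V) ?_).seq ?_
    · simp [h0, h1, h2, h3, hP.value]
      rw [hP.value] at hV
      omega
    rintro _ rfl
    refine Run.assign_seq ?_ (Run.countdown (I := Writing n k b ord a V)
      (fun m s' h' => ⟨h'.r4, ?_⟩) (fun m s' h' => Run.of_wp ?_) ?_)
    · simp [h2]
      omega
    · have := h'.m_le
      omega
    · obtain ⟨h0, h4, hm, ho, hc, hv, hwr⟩ := h'
      have hmk : m < k := by omega
      have h13 := hc ⟨m, hmk⟩
      have ham := ha ⟨m, hmk⟩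
      have hom := hord _ ham
      have hoa := ho _ ham
      dsimp only at h13
      rw [writePebble]
      simp [h0, h4, h13, hoa]
      (repeat' apply And.intro) <;> try omega
      refine ⟨h0, by simp, by omega, fun i hi => ?_, fun p => ?_, ?_, fun p hp => ?_⟩
      · rw [arr_setMem_of_lt (by omega)]
        exact ho i hi
      · rw [arr_setMem_of_lt (by omega)]
        exact hc p
      · rw [mem_setMem, if_neg (by omega)]
        exact hv
      · rw [mem_setMem]
        split_ifs with hpm
        · obtain rfl : p = ⟨m, hmk⟩ := Fin.ext (show (p : ℕ) = m by omega)
          rfl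
        · exact hwr p (by omega)
    · refine ⟨h0, by simp [h2], le_rfl, fun i hi => ?_, fun p => ?_, ?_, fun p hp => ?_⟩
      · rw [arr_setReg, arr_setMem_of_lt (by omega)]
        exact hl.ord i hi
      · rw [arr_setReg, arr_setMem_of_lt (by omega)]
        exact hcur p
      · simp [mem_setMem]
      · omega
  refine key.mono ?_ fun _ h => h
  have h₁ : k * (2 + writePebble.cost) ≤ k * 50 := Nat.mul_le_mul_left _ (by decide)
  have h₂ : Prog.cost (.store 0 (.get 9 ((.reg 1 - 1) * .reg 3 + .reg 2))) +
    Expr.cost (.reg 2) ≤ 40 := by decide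
  omega

end Phases

/-! ### Assembly of the phases and the final bounds -/

/-- The program for Con-Sum on trees. -/
def solve : Prog :=
  .seq (readSizes ;; readEdges)
    (readPebbles ;; eliminate ;; relabel ;; fillTable ;; backtrack ;; moveAll ;; writeOutput)

/-- The memory contains an optimal solution. -/
def Solved {n k : ℕ} (G : SimpleGraph (Fin n)) (σ : Fin k → Fin n) (s : State) : Prop :=
  ∃ μ : Fin k → Fin n, IsOptimal (Con G) (sumCost G σ) μ ∧ s.mem 0 = sumCost G σ μ ∧
    ∀ p : Fin k, s.mem (1 + p) = μ p

section Phases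
variable {W n k b Z : ℕ} (hZ : Sizes W n k b Z) {G : SimpleGraph (Fin n)}
  {E : List (Fin n × Fin n)} {σ : Fin k → Fin n}
include hZ

theorem run_place (hG : G.Connected) {pos par ord S : ℕ → ℕ} {s : State}
    (h : Prepared G E σ b Z pos par ord S s) :
    Run W (fillTable ;; backtrack ;; moveAll ;; writeOutput) s
      (2000 * (n * (k * k)) + (200 * n + (400 * (n * k) + 100 * k))) (Solved G σ) := by
  obtain ⟨hl, L, hS, hSk, hord, hcur, hz⟩ := h
  have hn := hZ.n_pos
  have hpar := L.inc
  refine (run_fillTable (A := fun a i => s.arr b a i) hZ hpar hSk hl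
    (fun a ha ha' i => hz a (by omega) ha' i) (fun a _ _ i => rfl)).seq fun s₁ h₁ => ?_
  refine (run_backtrack (a := fun p => pos (σ p)) hZ hpar h₁.labelled
    (h₁.table _ (by omega) _ le_rfl) (fun i hi => h₁.choice i (by omega))
    (fun i => by rw [h₁.frame 11 (by omega) le_rfl, hz 11 (by omega) (by omega)])
    (fun p => by rw [h₁.frame 13 (by omega) (by omega), hcur])).seq fun s₂ h₂ => ?_
  -- A typed inverse of the labelling; its default value 0 is never used at an actual label.
  obtain ⟨vertex, hvertex⟩ : ∃ vertex : ℕ → Fin n, ∀ v : Fin n, vertex (pos v) = v :=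
    ⟨fun i => if h : ord i < n then ⟨ord i, h⟩ else ⟨0, by omega⟩, fun v => by simp [hord]⟩
  have hB := h₂.back
  have hS' : ∀ i, i < n → S i = count (fun p => pos (σ p)) i + childSum par S (n - 1) i := by
    rw [hS]
    exact fun i hi => acc_balance hpar _ hi
  have hF' : ∀ i, i < n → s₂.arr b 12 i = s₂.arr b 11 i +
      childSum par (s₂.arr b 12) (n - 1) i := fun i hi => by
    rw [childSum, Finset.range_eq_Ico, hB.balance i (Nat.zero_le i) hi]
  have hδ : ∀ (p : Fin k) i, i + 1 < n →
      G.dist (σ p) (vertex (par i)) ≤ G.dist (σ p) (vertex i) + 1 ∧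
        G.dist (σ p) (vertex i) ≤ G.dist (σ p) (vertex (par i)) + 1 := fun p i hi => by
    obtain ⟨u, rfl⟩ := L.exists_pos (i := i) (by omega)
    obtain ⟨v, hv⟩ := L.exists_pos (hpar _ hi).2
    have huv : G.Adj u v := (L.adj_iff u v).2 (.inl ⟨hi, hv⟩)
    rw [← hv, hvertex, hvertex]
    have h₁ := hG.dist_triangle (u := σ p) (v := u) (w := v)
    have h₂ := hG.dist_triangle (u := σ p) (v := v) (w := u)
    rw [SimpleGraph.dist_eq_one_iff_adj.2 huv] at h₁
    rw [SimpleGraph.dist_eq_one_iff_adj.2 huv.symm] at h₂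
    exact ⟨h₁, h₂⟩
  have hroot : S (n - 1) = s₂.arr b 12 (n - 1) := by
    rw [hB.root_eq, hS]
    exact acc_count_root hpar hn fun p => L.lt _
  have hcur₂ : (fun p : Fin k => s₂.arr b 13 p) = fun p => pos (σ p) := funext h₂.cur
  refine (run_moveAll (F := s₂.arr b 12) (f := s₂.arr b 11)
    (δ := fun p i => G.dist (σ p) (vertex i)) hZ hpar hS' hF' hδ hroot
    ⟨h₂.labelled, rfl, h₂.value, fun i => rfl⟩ ?_).seq fun s₃ h₃ => ?_
  · rw [hcur₂]
    exact UpPass.init (fun p => L.lt _) rfl fun p => by rw [hvertex, SimpleGraph.dist_self]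
  refine (run_writeOutput (a := fun p => s₃.arr b 13 p) hZ h₃.placing h₃.pass.lt (fun i hi => ?_)
    fun p => rfl).mono le_rfl fun s₄ h₄ => ?_
  · obtain ⟨v, rfl⟩ := L.exists_pos hi
    rw [hord]
    exact v.isLt
  choose μ hμ using fun p => L.exists_pos (h₃.pass.lt p)
  obtain ⟨hopt, hcost⟩ := L.isOptimal hG hn hS hSk hB h₃.pass
    (μ := μ) fun p => ⟨hμ p, by rw [← hμ p, hvertex]⟩
  refine ⟨μ, hopt, h₄.cost.trans hcost.symm, fun p => ?_⟩
  rw [h₄.written p (Nat.zero_le _), ← hμ p, hord]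

theorem run_solve (hG : G.IsTree) (hE : IsEdgeList G E) :
    Run W solve (State.init (encode E σ)) (4000 * (n * (k * k))) (Solved G σ) := by
  have hn := hZ.n_pos
  have hk := hZ.k_pos
  have hlen := hE.length_add_one hG
  have hd : ∀ e ∈ E, e.1 ≠ e.2 := fun e he =>
    ((hE.2 s(e.1, e.2)).1 (List.mem_map_of_mem he) : G.Adj e.1 e.2).ne
  have key : Run W solve (State.init (encode E σ)) (200 * n + (60 * k + (700 * n +
      (200 * n + 100 * k + (2000 * (n * (k * k)) + (200 * n + (400 * (n * k) + 100 * k)))))))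
      (Solved G σ) :=
    (run_readEdges hZ hlen hd).seq fun s₁ h₁ => (run_readPebbles hZ hlen h₁).seq fun s₂ h₂ =>
      (run_eliminate hZ hG hE h₂).seq fun s₃ ⟨r, t, h₃⟩ => (run_relabel hZ hlen h₃).seq
        fun s₄ ⟨pos, par, ord, S, h₄⟩ => run_place hZ hG.connected h₄
  refine key.mono ?_ fun _ h => h
  have h₁ : n * 1 ≤ n * (k * k) := Nat.mul_le_mul_left _ (Nat.mul_pos hk hk)
  have h₂ : n * (k * 1) ≤ n * (k * k) := Nat.mul_le_mul_left _ (Nat.mul_le_mul_left _ hk)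
  have h₃ : 1 * k ≤ n * k := Nat.mul_le_mul_right _ hn
  rw [mul_one] at h₁ h₂
  omega

end Phases

/-- Z = (n+k)² covers the table indices, table entries and neighbour sums. The factor 256 = 2⁸
leaves room for the interleaved addresses and is at most (n+k)⁸ because n + k ≥ 2. -/
theorem sizes {n k : ℕ} (hn : 1 ≤ n) (hk : 1 ≤ k) :
    Sizes ((n + k) ^ 10) n k (2 * n + k) ((n + k) ^ 2) := by
  have h₁ : 2 ^ 8 ≤ (n + k) ^ 8 := Nat.pow_le_pow_left (by omega) 8
  refine ⟨hn, hk, rfl, by nlinarith, by nlinarith, by nlinarith, by nlinarith, ?_⟩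
  calc 256 * (n + k) ^ 2 ≤ (n + k) ^ 8 * (n + k) ^ 2 := Nat.mul_le_mul_right _ (by simpa using h₁)
    _ = (n + k) ^ 10 := by ring

end ConSum

theorem mainTheorem1 :
    ∃ (prog : WordRAM.Prog) (c : ℕ) (C : ℝ),
      ∀ (n k : ℕ) (_hn : 1 ≤ n) (_hk : 1 ≤ k) (G : SimpleGraph (Fin n)) (_hG : G.IsTree)
        (E : List (Fin n × Fin n)) (_hE : PebbleMotion.IsEdgeList G E) (σ : Fin k → Fin n),
        ∃ (t : ℕ) (s : WordRAM.State) (μ : Fin k → Fin n),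
          WordRAM.Exec ((n + k) ^ c) prog (WordRAM.State.init (PebbleMotion.encode E σ)) t s ∧
          (t : ℝ) ≤ C * ((n : ℝ) * (k : ℝ) ^ 2 * Real.log (max (n : ℝ) 2)) ∧
          PebbleMotion.IsOptimal (PebbleMotion.Con G) (PebbleMotion.sumCost G σ) μ ∧
          s.mem 0 = PebbleMotion.sumCost G σ μ ∧
          ∀ p : Fin k, s.mem (1 + (p : ℕ)) = (μ p : ℕ) := by
  -- The program takes at most 4000 n k² steps; dividing the constant by log 2 pays for the
  -- logarithm, which is at least log 2.
  refine ⟨ConSum.solve, 10, 4000 / Real.log 2, fun n k hn hk G hG E hE σ => ?_⟩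
  obtain ⟨t, s, hexec, ht, μ, hopt, hcost, hμ⟩ :=
    ConSum.run_solve (σ := σ) (ConSum.sizes hn hk) hG hE
  refine ⟨t, s, μ, hexec, ?_, hopt, hcost, hμ⟩
  have h₁ : (t : ℝ) ≤ 4000 * (n * (k : ℝ) ^ 2) := by
    rw [pow_two]
    exact_mod_cast ht
  have h₂ : 0 < Real.log 2 := Real.log_pos one_lt_two
  have h₃ : Real.log 2 ≤ Real.log (max (n : ℝ) 2) :=
    Real.log_le_log two_pos (le_max_right _ _)
  calc (t : ℝ) ≤ 4000 * (n * (k : ℝ) ^ 2) := h₁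
    _ = 4000 / Real.log 2 * (n * (k : ℝ) ^ 2 * Real.log 2) := by
      field_simp
    _ ≤ 4000 / Real.log 2 * (n * (k : ℝ) ^ 2 * Real.log (max (n : ℝ) 2)) := by
      gcongr
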